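/- Let $n\ge 1$ and let $\lambda$ be a Young diagram with $\ell(\lambda)<n$ that is of hook shape (every row below the first has at most one box) or of two-column shape (the first row has exactly two boxes). Let $\mathrm{SST}_n(\lambda)$ be the set of semistandard tableaux of shape $\lambda$ with entries in $\{1,\dots,n\}$ (rows weakly increasing from left to right, columns strictly increasing from top to bottom). The promotion $\mathrm{pr}:\mathrm{SST}_n(\lambda)\to\mathrm{SST}_n(\lambda)$ is defined as follows: replace every entry $n$ of $T$ by a dot; process the dots one after another from left to right, sliding each one to the northwest by jeu de taquin (exchange the dot repeatedly with the larger of the numbers directly above it and directly to its left, with the upper one if they are equal, until neither neighbouring box carries a number); finally replace the dots by $1$ and increase all other entries by $1$. Equip $\mathrm{SST}_n(\lambda)$ with its standard $U_q(\mathfrak{sl}_n)$-crystal structure, with operators $\tilde e_i,\tilde f_i$ for $i\in I=\{1,\dots,n-1\}$: read the boxes row by row from bottom to top, each row from left to right, and pair each $i+1$, as an opening bracket, with an $i$ to its right, as a closing bracket; $\tilde f_i$ changes the rightmost unpaired $i$ into $i+1$, $\tilde e_i$ changes the leftmost unpaired $i+1$ into $i$, and the result is $0$ if there is no such entry. Put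 $\langle h_i,\mathrm{wt}(T)\rangle=c_i-c_{i+1}$, where $c_k$ is the number of entries $k$ in $T$, and $$\tilde s_i(T)=\begin{cases}\tilde f_i^{\,\langle h_i,\mathrm{wt}(T)\rangle}(T)&\text{if }\langle h_i,\mathrm{wt}(T)\rangle\ge 0,\\ \tilde e_i^{\,-\langle h_i,\mathrm{wt}(T)\rangle}(T)&\text{if }\langle h_i,\mathrm{wt}(T)\rangle<0,\end{cases}\qquad \mathsf c=\tilde s_1\tilde s_2\cdots\tilde s_{n-1}.$$ Then, as maps on $\mathrm{SST}_n(\lambda)$: 1. if $n\ge 2$, then $\tilde s_1\cdot\mathrm{pr}^2=\mathrm{pr}^2\cdot\tilde s_{n-1}$; 2. $\tilde s_i\cdot\mathrm{pr}^n=\mathrm{pr}^n\cdot\tilde s_i$ for all $i\in I$; 3. $\mathsf c\cdot\mathrm{pr}^n=\mathrm{pr}^n\cdot\mathsf c$. -/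

import Mathlib

namespace HookPromotion

/-! ## Tableaux -/

/-- `SST n μ`: semistandard tableaux of shape `μ` with entries in `{1, …, n}`.
Rows and columns are indexed from `0`. -/
def SST (n : ℕ) (μ : YoungDiagram) : Type :=
  {T : SemistandardYoungTableau μ // ∀ r c, (r, c) ∈ μ → 1 ≤ T r c ∧ T r c ≤ n}

/-- Hook shape `(a, 1^m)`: every row below the first one has at most one box. -/
def IsHook (μ : YoungDiagram) : Prop := ∀ r, 1 ≤ r → μ.rowLen r ≤ 1

/-- Two-column shape: the first row has exactly two boxes. -/
def IsTwoColumn (μ : YoungDiagram) : Prop := μ.rowLen 0 = 2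

/-- Replace the entry of the box `(r, c)` by `v`. -/
def setCell (T : ℕ → ℕ → ℕ) (r c v : ℕ) : ℕ → ℕ → ℕ :=
  fun r' c' => if r' = r ∧ c' = c then v else T r' c'

/-! ## Promotion -/

/-- Slide a dot, located at the box `(r, c)`, to the northwest by jeu de taquin.
Dots are encoded by the value `0`. The dot is exchanged with the larger one of its upper and left
neighbours, and with the upper one if they are equal; it stops when neither neighbour exists and
carries a number. -/
def slide (T : ℕ → ℕ → ℕ) (r c : ℕ) : ℕ → ℕ → ℕ :=
  if (if r = 0 then 0 else T (r - 1) c) = 0 ∧ (if c = 0 then 0 else T r (c - 1)) = 0 then T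
  else if (if c = 0 then 0 else T r (c - 1)) ≤ (if r = 0 then 0 else T (r - 1) c) then
    slide (setCell (setCell T r c (T (r - 1) c)) (r - 1) c 0) (r - 1) c
  else
    slide (setCell (setCell T r c (T r (c - 1))) r (c - 1) 0) r (c - 1)
termination_by r + c
decreasing_by all_goals grind

/-- Replace every entry `n` by a dot (`0`). -/
def dotted (n : ℕ) (T : ℕ → ℕ → ℕ) : ℕ → ℕ → ℕ := fun r c => if T r c = n then 0 else T r c

/-- Slide the dots which sit in the columns `0, …, m - 1`, from left to right. As the columns of `T`
increase strictly, an entry `n` can only be the lowest one of its column. -/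
def slideDots (n : ℕ) (μ : YoungDiagram) (T : ℕ → ℕ → ℕ) : ℕ → ℕ → ℕ → ℕ
  | 0 => dotted n T
  | m + 1 =>
    if T (μ.colLen m - 1) m = n then slide (slideDots n μ T m) (μ.colLen m - 1) m
    else slideDots n μ T m

/-- The filling obtained from `T` by promotion: the entries `n` become dots, all dots are slid to
the northwest, then the dots become `1` and the other entries increase by `1`. -/
def prFilling (n : ℕ) (μ : YoungDiagram) (T : ℕ → ℕ → ℕ) : ℕ → ℕ → ℕ :=
  fun r c => if (r, c) ∈ μ then slideDots n μ T (μ.rowLen 0) r c + 1 else 0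

/-- Semistandardness of `G` away from the boxes in `E`. -/
def PSS (μ : YoungDiagram) (E : ℕ → ℕ → Prop) (G : ℕ → ℕ → ℕ) : Prop :=
  (∀ r c1 c2, c1 < c2 → (r, c2) ∈ μ → ¬ E r c1 → ¬ E r c2 → G r c1 ≤ G r c2) ∧
  (∀ r1 r2 c, r1 < r2 → (r2, c) ∈ μ → ¬ E r1 c → ¬ E r2 c → G r1 c < G r2 c)

theorem slide_spec (μ : YoungDiagram) (n : ℕ) (E : ℕ → ℕ → Prop) (z : ℕ → ℕ) :
    ∀ (k : ℕ) (G : ℕ → ℕ → ℕ) (r c : ℕ), r + c = k → (r, c) ∈ μ →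
    (∀ a b, E a b → c < b ∧ (a + 1, b) ∉ μ) →
    PSS μ (fun a b => E a b ∨ (a = r ∧ b = c)) G →
    G r c = 0 →
    (∀ a b, (a, b) ∈ μ → ¬ E a b → ¬ (a = r ∧ b = c) → (G a b = 0 ↔ a = 0 ∧ b < z 0)) →
    (∀ a a', a' ≤ a → a ≤ r → z a' ≤ z a) →
    z r ≤ c →
    (∀ a, a < r → (a + 1, z (a + 1)) ∈ μ → 1 ≤ z (a + 1) →
      G (a + 1) (z (a + 1) - 1) ≤ G a (z (a + 1))) →
    (∀ a b, (a, b) ∈ μ → G a b < n) →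
    PSS μ E (slide G r c) ∧
    (∀ a b, (a, b) ∈ μ → ¬ E a b → (slide G r c a b = 0 ↔ a = 0 ∧ b < z 0 + 1)) ∧
    (∀ a b, (a, b) ∈ μ → slide G r c a b < n) ∧
    (∀ a b, (r < a ∨ c < b) → slide G r c a b = G a b) ∧
    ∃ z' : ℕ → ℕ, (∀ a a', a' ≤ a → a ≤ r → z' a' ≤ z' a) ∧ z' 0 = z 0 + 1 ∧ z' r ≤ c + 1 ∧
      (∀ a, a < r → (a + 1, z' (a + 1)) ∈ μ → 1 ≤ z' (a + 1) →
        slide G r c (a + 1) (z' (a + 1) - 1) ≤ slide G r c a (z' (a + 1))) := by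
  intro k
  induction k with
  | zero =>
    intro G r c hk hm hE hP h0 hz hmono hzc hbar hn
    obtain ⟨rfl, rfl⟩ : r = 0 ∧ c = 0 := by omega
    have hs : slide G 0 0 = G := by rw [slide]; simp
    rw [hs]
    refine ⟨⟨?_, ?_⟩, ?_, hn, fun _ _ _ => rfl, fun _ => z 0 + 1, ?_, rfl, by dsimp only; omega, ?_⟩
    · intro a c1 c2 h12 hm2 e1 e2
      by_cases hh : a = 0 ∧ c1 = 0
      · rw [hh.1, hh.2, h0]; omega
      · exact hP.1 a c1 c2 h12 hm2 (by grind) (by grind)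
    · intro r1 r2 a h12 hm2 e1 e2
      by_cases hh : r1 = 0 ∧ a = 0
      · have := hz r2 a hm2 e2 (by omega)
        rw [hh.1, hh.2, h0]
        rw [hh.2] at this
        omega
      · exact hP.2 r1 r2 a h12 hm2 (by grind) (by grind)
    · intro a b hab e
      by_cases hh : a = 0 ∧ b = 0
      · rw [hh.1, hh.2, h0]; omega
      · have := hz a b hab e hh
        omega
    · intros; exact le_rfl
    · intros; omega
  | succ k ih =>
    intro G r c hk hm hE hP h0 hz hmono hzc hbar hn
    have hz0 : z 0 ≤ c := le_trans (hmono r 0 (by omega) le_rfl) hzc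
    have hdown : ∀ a b a' b', a' ≤ a → b' ≤ b → (a, b) ∈ μ → (a', b') ∈ μ :=
      fun a b a' b' h1 h2 h => μ.up_left_mem h1 h2 h
    by_cases hfin : (if r = 0 then 0 else G (r - 1) c) = 0 ∧ (if c = 0 then 0 else G r (c - 1)) = 0
    · have hs : slide G r c = G := by rw [slide, if_pos hfin]
      have hr : r = 0 := by
        by_contra hr
        have h1 := hfin.1
        rw [if_neg hr] at h1
        have := (hz (r - 1) c (hdown r c _ _ (by omega) le_rfl hm)
          (fun e => by have := (hE _ _ e).1; omega) (by omega)).1 h1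
        omega
      subst hr
      have hc : c = z 0 := by
        by_cases hc : c = 0
        · omega
        · have h1 := hfin.2
          rw [if_neg hc] at h1
          have := (hz 0 (c - 1) (hdown 0 c _ _ le_rfl (by omega) hm)
            (fun e => by have := (hE _ _ e).1; omega) (by omega)).1 h1
          omega
      rw [hs]
      refine ⟨⟨?_, ?_⟩, ?_, hn, fun _ _ _ => rfl, fun _ => z 0 + 1, ?_, rfl, by dsimp only; omega, ?_⟩
      · intro a c1 c2 h12 hm2 e1 e2
        by_cases hh : a = 0 ∧ c1 = c
        · rw [hh.1, hh.2, h0]; omega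
        · by_cases hh2 : a = 0 ∧ c2 = c
          · have := (hz a c1 (hdown a c2 _ _ le_rfl (by omega) hm2) e1 hh).2 (by omega)
            omega
          · exact hP.1 a c1 c2 h12 hm2 (by grind) (by grind)
      · intro r1 r2 a h12 hm2 e1 e2
        by_cases hh : r1 = 0 ∧ a = c
        · have := hz r2 a hm2 e2 (by omega)
          rw [hh.1, hh.2, h0]
          rw [hh.2] at this
          omega
        · exact hP.2 r1 r2 a h12 hm2 (by grind) (by grind)
      · intro a b hab e
        by_cases hh : a = 0 ∧ b = c
        · rw [hh.1, hh.2, h0]; omega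
        · have := hz a b hab e hh
          omega
      · intros; exact le_rfl
      · intros; omega
    · by_cases hup : (if c = 0 then 0 else G r (c - 1)) ≤ (if r = 0 then 0 else G (r - 1) c)
      · obtain ⟨r, rfl⟩ : ∃ s, r = s + 1 := by
          rcases r with _ | s
          · exfalso; grind
          · exact ⟨s, rfl⟩
        have hs : slide G (r + 1) c =
            slide (setCell (setCell G (r + 1) c (G r c)) r c 0) r c := by
          rw [slide, if_neg hfin, if_pos hup]; simp
        rw [hs]
        set G1 := setCell (setCell G (r + 1) c (G r c)) r c 0 with hG1
        have g1 : G1 r c = 0 := by simp [hG1, setCell]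
        have g2 : G1 (r + 1) c = G r c := by simp [hG1, setCell]
        have g3 : ∀ a b, ¬ (a = r ∧ b = c) → ¬ (a = r + 1 ∧ b = c) → G1 a b = G a b := by
          intro a b h1 h2; simp [hG1, setCell, h1, h2]
        have hmr : (r, c) ∈ μ := hdown _ _ _ _ (by omega) le_rfl hm
        have hEc : ∀ a b, b ≤ c → ¬ E a b := fun a b hb e => by have := (hE _ _ e).1; omega
        have hGrc : G r c ≠ 0 := by
          intro h
          have := (hz r c hmr (hEc _ _ le_rfl) (by omega)).1 h
          omega
        obtain ⟨q1, q2, q3, q4, z', y1, y2, y3, y4⟩ := ih G1 r c (by omega) hmr hE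
          (by
            refine ⟨?_, ?_⟩
            · intro a c1 c2 h12 hm2 e1 e2
              push Not at e1 e2
              by_cases hh : a = r + 1 ∧ c1 = c
              · obtain ⟨rfl, rfl⟩ := hh
                rw [g2, g3 _ c2 (by omega) (by omega)]
                have hm3 := hdown _ _ r c2 (by omega) le_rfl hm2
                have e3 : ¬ E r c2 := fun e => (hE _ _ e).2 hm2
                have l1 := hP.1 r c1 c2 h12 hm3 (by grind) (by grind)
                have l2 := hP.2 r (r + 1) c2 (by omega) hm2 (by grind) (by grind)
                omega
              · by_cases hh2 : a = r + 1 ∧ c2 = c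
                · obtain ⟨rfl, rfl⟩ := hh2
                  rw [g2, g3 _ c1 (by omega) (by omega)]
                  rcases c2 with _ | d
                  · omega
                  · simp only [Nat.succ_ne_zero, if_false, Nat.add_sub_cancel] at hup
                    refine le_trans ?_ hup
                    rcases Nat.lt_or_ge c1 d with hlt | hge
                    · exact hP.1 (r + 1) c1 d hlt (hdown _ _ _ _ le_rfl (by omega) hm2)
                        (by have := hEc (r + 1) c1 (by omega); grind)
                        (by have := hEc (r + 1) d (by omega); grind)
                    · have : c1 = d := by omega
                      rw [this]
                · rw [g3 _ _ (by tauto) (by tauto), g3 _ _ (by tauto) (by tauto)]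
                  exact hP.1 a c1 c2 h12 hm2 (by tauto) (by tauto)
            · intro r1 r2 b h12 hm2 e1 e2
              push Not at e1 e2
              by_cases hh : r1 = r + 1 ∧ b = c
              · obtain ⟨rfl, rfl⟩ := hh
                rw [g2, g3 _ _ (by omega) (by omega)]
                exact hP.2 r r2 b (by omega) hm2
                  (by have := hEc r b le_rfl; grind) (by have := hEc r2 b le_rfl; grind)
              · by_cases hh2 : r2 = r + 1 ∧ b = c
                · obtain ⟨rfl, rfl⟩ := hh2
                  have hr1 : r1 ≠ r := fun h => e1.2 h rfl
                  rw [g2, g3 _ _ (by omega) (by omega)]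
                  exact hP.2 r1 r b (by omega) hmr
                    (by have := hEc r1 b le_rfl; grind) (by have := hEc r b le_rfl; grind)
                · rw [g3 _ _ (by tauto) (by tauto), g3 _ _ (by tauto) (by tauto)]
                  exact hP.2 r1 r2 b h12 hm2 (by tauto) (by tauto))
          g1
          (by
            intro a b hab e hne
            by_cases hh : a = r + 1 ∧ b = c
            · obtain ⟨rfl, rfl⟩ := hh
              rw [g2]; omega
            · rw [g3 _ _ hne hh]; exact hz a b hab e hh)
          (fun a a' h1 h2 => hmono a a' h1 (by omega))
          (le_trans (hmono (r + 1) r (by omega) le_rfl) hzc)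
          (by
            intro a ha h1 h2
            have m1 := hmono (r + 1) (a + 1) (by omega) le_rfl
            rw [g3 _ _ (by omega) (by omega), g3 _ _ (by omega) (by omega)]
            exact hbar a (by omega) h1 h2)
          (by
            intro a b hab
            by_cases hh : a = r + 1 ∧ b = c
            · obtain ⟨rfl, rfl⟩ := hh
              rw [g2]; exact hn _ _ hmr
            · by_cases hh2 : a = r ∧ b = c
              · obtain ⟨rfl, rfl⟩ := hh2
                rw [g1]; exact lt_of_le_of_lt (Nat.zero_le _) (hn _ _ hmr)
              · rw [g3 _ _ hh2 hh]; exact hn _ _ hab)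
        refine ⟨q1, q2, q3, ?_, fun a => if a ≤ r then z' a else c + 1, ?_, by simpa using y2, by simp,
          ?_⟩
        · intro a b hab
          rw [q4 a b (by omega), g3 _ _ (by omega) (by omega)]
        · intro a a' h1 h2
          by_cases ha : a ≤ r
          · have ha' : a' ≤ r := by omega
            simp only [ha, ha', if_true]
            exact y1 a a' h1 ha
          · by_cases ha' : a' ≤ r
            · simp only [ha, ha', if_true, if_false]
              exact le_trans (y1 r a' ha' le_rfl) y3
            · simp only [ha, ha', if_false]; exact le_rfl
        · intro a ha h1 h2
          by_cases har : a < r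
          · have : a + 1 ≤ r := har
            simp only [this, if_true] at h1 h2 ⊢
            exact y4 a har h1 h2
          · obtain rfl : a = r := by omega
            have hna : ¬ (a + 1 ≤ a) := by omega
            simp only [hna, if_false] at h1 h2 ⊢
            rw [Nat.add_sub_cancel, q4 (a + 1) c (by omega), q4 a (c + 1) (by omega), g2,
              g3 _ _ (by omega) (by omega)]
            have e3 : ¬ E a (c + 1) := fun e => (hE _ _ e).2 h1
            exact hP.1 a c (c + 1) (by omega) (hdown _ _ _ _ (by omega) le_rfl h1)
              (by have := hEc a c le_rfl; grind) (by grind)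
      · obtain ⟨c, rfl⟩ : ∃ d, c = d + 1 := by
          rcases c with _ | d
          · exfalso; grind
          · exact ⟨d, rfl⟩
        have hs : slide G r (c + 1) =
            slide (setCell (setCell G r (c + 1) (G r c)) r c 0) r c := by
          rw [slide, if_neg hfin, if_neg hup]; simp
        rw [hs]
        set G1 := setCell (setCell G r (c + 1) (G r c)) r c 0 with hG1
        have g1 : G1 r c = 0 := by simp [hG1, setCell]
        have g2 : G1 r (c + 1) = G r c := by simp [hG1, setCell]
        have g3 : ∀ a b, ¬ (a = r ∧ b = c) → ¬ (a = r ∧ b = c + 1) → G1 a b = G a b := by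
          intro a b h1 h2; simp [hG1, setCell, h1, h2]
        have hmc : (r, c) ∈ μ := hdown _ _ _ _ le_rfl (by omega) hm
        have hEc : ∀ a b, b ≤ c + 1 → ¬ E a b := fun a b hb e => by have := (hE _ _ e).1; omega
        simp only [Nat.succ_ne_zero, if_false, Nat.add_sub_cancel, not_le] at hup
        have hup' : ∀ s, r = s + 1 → G s (c + 1) < G r c := by
          rintro s rfl
          simpa using hup
        have hzlt : z r ≤ c := by
          by_contra hcon
          have hzr : z r = c + 1 := by omega
          rcases r with _ | s
          · have := (hz 0 c hmc (hEc _ _ (by omega)) (by omega)).2 (by omega)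
            omega
          · have h1 := hbar s (by omega) (by rw [hzr]; exact hm) (by omega)
            rw [hzr, Nat.add_sub_cancel] at h1
            have := hup' s rfl
            omega
        have hGrc : ¬ (G r c = 0) := by omega
        obtain ⟨q1, q2, q3, q4, z', y1, y2, y3, y4⟩ := ih G1 r c (by omega) hmc
          (fun a b e => ⟨by have := (hE a b e).1; omega, (hE a b e).2⟩)
          (by
            refine ⟨?_, ?_⟩
            · intro a c1 c2 h12 hm2 e1 e2
              push Not at e1 e2
              by_cases hh : a = r ∧ c1 = c + 1
              · obtain ⟨rfl, rfl⟩ := hh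
                rw [g2, g3 _ c2 (by omega) (by omega)]
                exact hP.1 a c c2 (by omega) hm2 (by have := hEc a c (by omega); grind) (by grind)
              · by_cases hh2 : a = r ∧ c2 = c + 1
                · obtain ⟨rfl, rfl⟩ := hh2
                  have : c1 ≠ c := e1.2 rfl
                  rw [g2, g3 _ c1 (by omega) (by omega)]
                  exact hP.1 a c1 c (by omega) hmc (by grind) (by have := hEc a c (by omega); grind)
                · rw [g3 _ _ (by tauto) (by tauto), g3 _ _ (by tauto) (by tauto)]
                  exact hP.1 a c1 c2 h12 hm2 (by tauto) (by tauto)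
            · intro r1 r2 b h12 hm2 e1 e2
              push Not at e1 e2
              by_cases hh : r1 = r ∧ b = c + 1
              · obtain ⟨rfl, rfl⟩ := hh
                rw [g2, g3 _ _ (by omega) (by omega)]
                have hm3 := hdown _ _ r2 c le_rfl (by omega) hm2
                have l1 := hP.2 r1 r2 c h12 hm3 (by have := hEc r1 c (by omega); grind)
                  (by have := hEc r2 c (by omega); grind)
                have l2 := hP.1 r2 c (c + 1) (by omega) hm2 (by have := hEc r2 c (by omega); grind)
                  (by grind)
                omega
              · by_cases hh2 : r2 = r ∧ b = c + 1
                · obtain ⟨rfl, rfl⟩ := hh2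
                  rw [g2, g3 _ _ (by omega) (by omega)]
                  rcases r2 with _ | s
                  · omega
                  · refine lt_of_le_of_lt ?_ (hup' s rfl)
                    rcases Nat.lt_or_ge r1 s with hlt | hge
                    · exact le_of_lt (hP.2 r1 s (c + 1) hlt (hdown _ _ _ _ (by omega) le_rfl hm2)
                        (by have := hEc r1 (c + 1) (by omega); grind)
                        (by have := hEc s (c + 1) (by omega); grind))
                    · have : r1 = s := by omega
                      rw [this]
                · rw [g3 _ _ (by tauto) (by tauto), g3 _ _ (by tauto) (by tauto)]
                  exact hP.2 r1 r2 b h12 hm2 (by tauto) (by tauto))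
          g1
          (by
            intro a b hab e hne
            by_cases hh : a = r ∧ b = c + 1
            · obtain ⟨rfl, rfl⟩ := hh
              have := hz a c hmc (hEc _ _ (by omega)) (by omega)
              rw [g2]; omega
            · rw [g3 _ _ hne hh]; exact hz a b hab e hh)
          hmono hzlt
          (by
            intro a ha h1 h2
            have m1 := hmono r (a + 1) (by omega) le_rfl
            rw [g3 _ _ (by omega) (by omega), g3 _ _ (by omega) (by omega)]
            exact hbar a ha h1 h2)
          (by
            intro a b hab
            by_cases hh : a = r ∧ b = c + 1
            · obtain ⟨rfl, rfl⟩ := hh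
              rw [g2]; exact hn _ _ hmc
            · by_cases hh2 : a = r ∧ b = c
              · obtain ⟨rfl, rfl⟩ := hh2
                rw [g1]; exact lt_of_le_of_lt (Nat.zero_le _) (hn _ _ hmc)
              · rw [g3 _ _ hh2 hh]; exact hn _ _ hab)
        refine ⟨q1, q2, q3, ?_, z', y1, y2, by omega, y4⟩
        intro a b hab
        rw [q4 a b (by omega), g3 _ _ (by omega) (by omega)]

theorem slideDots_spec {n : ℕ} {μ : YoungDiagram} (T : SST n μ) : ∀ m, m ≤ μ.rowLen 0 →
    ∃ (R : ℕ) (z : ℕ → ℕ),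
      PSS μ (fun a b => (a, b) ∈ μ ∧ T.1 a b = n ∧ m ≤ b) (slideDots n μ T.1 m) ∧
      (∀ a b, (a, b) ∈ μ → ¬ (T.1 a b = n ∧ m ≤ b) →
        (slideDots n μ T.1 m a b = 0 ↔ a = 0 ∧ b < z 0)) ∧
      (∀ a b, (a, b) ∈ μ → slideDots n μ T.1 m a b < n) ∧
      (∀ a b, (a, b) ∈ μ → T.1 a b = n → m ≤ b → slideDots n μ T.1 m a b = 0 ∧ a ≤ R) ∧
      (∀ a a', a' ≤ a → a ≤ R → z a' ≤ z a) ∧ z R ≤ m ∧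
      (∀ a, a < R → (a + 1, z (a + 1)) ∈ μ → 1 ≤ z (a + 1) →
        slideDots n μ T.1 m (a + 1) (z (a + 1) - 1) ≤ slideDots n μ T.1 m a (z (a + 1))) := by
  have hbot : ∀ a b, (a, b) ∈ μ → T.1 a b = n → (a + 1, b) ∉ μ := by
    intro a b h1 h2 h3
    have := T.1.col_strict (Nat.lt_succ_self a) h3
    have := (T.2 _ _ h3).2
    simp only [Nat.succ_eq_add_one] at *
    omega
  intro m
  induction m with
  | zero =>
    intro _
    have hd : ∀ a b, (a, b) ∈ μ → T.1 a b ≠ n → slideDots n μ T.1 0 a b = T.1 a b := by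
      intro a b _ h; simp [slideDots, dotted, h]
    have hd0 : ∀ a b, T.1 a b = n → slideDots n μ T.1 0 a b = 0 := by
      intro a b h; simp [slideDots, dotted, h]
    refine ⟨μ.colLen 0, fun _ => 0, ⟨?_, ?_⟩, ?_, ?_, ?_, by simp, by simp, ?_⟩
    · intro r c1 c2 h12 hm2 e1 e2
      have hm1 := μ.up_left_mem le_rfl h12.le hm2
      rw [hd _ _ hm1 (by simpa [hm1] using e1), hd _ _ hm2 (by simpa [hm2] using e2)]
      exact T.1.row_weak h12 hm2
    · intro r1 r2 c h12 hm2 e1 e2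
      have hm1 := μ.up_left_mem h12.le le_rfl hm2
      rw [hd _ _ hm1 (by simpa [hm1] using e1), hd _ _ hm2 (by simpa [hm2] using e2)]
      exact T.1.col_strict h12 hm2
    · intro a b hab h
      have := (T.2 _ _ hab).1
      rw [hd _ _ hab (by simpa using h)]
      dsimp only
      omega
    · intro a b hab
      have := T.2 _ _ hab
      by_cases h : T.1 a b = n
      · rw [hd0 _ _ h]; omega
      · rw [hd _ _ hab h]; omega
    · intro a b hab h _
      refine ⟨hd0 _ _ h, ?_⟩
      have := YoungDiagram.mem_iff_lt_colLen.1 (μ.up_left_mem le_rfl (Nat.zero_le b) hab)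
      omega
    · intro a _ _ h; simp at h
  | succ m ih =>
    intro hm
    obtain ⟨R, z, i1, i2, i3, i4, i5, i6, i7⟩ := ih (by omega)
    have hm0 : (0, m) ∈ μ := YoungDiagram.mem_iff_lt_rowLen.2 (by omega)
    have hcl := YoungDiagram.mem_iff_lt_colLen.1 hm0
    have hrm : (μ.colLen m - 1, m) ∈ μ := YoungDiagram.mem_iff_lt_colLen.2 (by omega)
    have huniq : ∀ a, (a, m) ∈ μ → T.1 a m = n → a = μ.colLen m - 1 := by
      intro a h1 h2
      have h3 := hbot a m h1 h2
      rw [YoungDiagram.mem_iff_lt_colLen] at h1 h3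
      omega
    by_cases hT : T.1 (μ.colLen m - 1) m = n
    · have hs : slideDots n μ T.1 (m + 1) = slide (slideDots n μ T.1 m) (μ.colLen m - 1) m := by
        rw [slideDots, if_pos hT]
      rw [hs]
      set r := μ.colLen m - 1 with hr
      obtain ⟨h0, hrR⟩ := i4 r m hrm hT le_rfl
      have hrow : ∀ a b, (a, b) ∈ μ → T.1 a b = n → m + 1 ≤ b → a ≤ r := by
        intro a b h1 h2 h3
        by_contra hcon
        have k1 := T.1.row_weak (show m < b by omega) h1
        have k2 := T.1.col_strict (show r < a by omega)
          (μ.up_left_mem le_rfl (show m ≤ b by omega) h1)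
        omega
      obtain ⟨q1, q2, q3, q4, z', y1, y2, y3, y4⟩ := slide_spec μ n
        (fun a b => (a, b) ∈ μ ∧ T.1 a b = n ∧ m + 1 ≤ b) z (r + m) (slideDots n μ T.1 m) r m rfl hrm
        (fun a b e => ⟨by omega, hbot a b e.1 e.2.1⟩)
        (by
          have key : ∀ a b, ¬ (((a, b) ∈ μ ∧ T.1 a b = n ∧ m + 1 ≤ b) ∨ (a = r ∧ b = m)) →
              ¬ ((a, b) ∈ μ ∧ T.1 a b = n ∧ m ≤ b) := by
            rintro a b h ⟨h1, h2, h3⟩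
            apply h
            rcases Nat.lt_or_ge m b with h4 | h4
            · exact Or.inl ⟨h1, h2, h4⟩
            · obtain rfl : b = m := by omega
              exact Or.inr ⟨huniq a h1 h2, rfl⟩
          exact ⟨fun a c1 c2 h12 hm2 e1 e2 => i1.1 a c1 c2 h12 hm2 (key _ _ e1) (key _ _ e2),
            fun r1 r2 b h12 hm2 e1 e2 => i1.2 r1 r2 b h12 hm2 (key _ _ e1) (key _ _ e2)⟩)
        h0
        (by
          intro a b hab e hne
          refine i2 a b hab ?_
          rintro ⟨h2, h3⟩
          rcases Nat.lt_or_ge m b with h4 | h4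
          · exact e ⟨hab, h2, h4⟩
          · obtain rfl : b = m := by omega
            exact hne ⟨huniq a hab h2, rfl⟩)
        (fun a a' h1 h2 => i5 a a' h1 (by omega))
        (le_trans (i5 R r hrR le_rfl) i6)
        (fun a ha => i7 a (by omega))
        i3
      refine ⟨r, z', q1, ?_, q3, ?_, y1, y3, y4⟩
      · intro a b hab h
        rw [y2]
        exact q2 a b hab (by tauto)
      · intro a b hab h hb
        refine ⟨?_, hrow a b hab h hb⟩
        rw [q4 a b (by omega)]
        exact (i4 a b hab h (by omega)).1
    · have hs : slideDots n μ T.1 (m + 1) = slideDots n μ T.1 m := by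
        rw [slideDots, if_neg hT]
      rw [hs]
      have key : ∀ a b, (a, b) ∈ μ → T.1 a b = n → m ≤ b → m + 1 ≤ b := by
        intro a b h1 h2 h3
        rcases Nat.lt_or_ge m b with h4 | h4
        · exact h4
        · obtain rfl : b = m := by omega
          have := huniq a h1 h2
          rw [this] at h2
          exact absurd h2 hT
      refine ⟨R, z, ⟨?_, ?_⟩, ?_, i3, ?_, i5, by omega, i7⟩
      · exact fun a c1 c2 h12 hm2 e1 e2 => i1.1 a c1 c2 h12 hm2
          (fun h => e1 ⟨h.1, h.2.1, key _ _ h.1 h.2.1 h.2.2⟩)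
          (fun h => e2 ⟨h.1, h.2.1, key _ _ h.1 h.2.1 h.2.2⟩)
      · exact fun r1 r2 b h12 hm2 e1 e2 => i1.2 r1 r2 b h12 hm2
          (fun h => e1 ⟨h.1, h.2.1, key _ _ h.1 h.2.1 h.2.2⟩)
          (fun h => e2 ⟨h.1, h.2.1, key _ _ h.1 h.2.1 h.2.2⟩)
      · exact fun a b hab h => i2 a b hab (fun h' => h ⟨h'.1, key _ _ hab h'.1 h'.2⟩)
      · exact fun a b hab h hb => i4 a b hab h (by omega)

/-- The promotion operator on `SST n μ`. -/
def pr {n : ℕ} {μ : YoungDiagram} (T : SST n μ) : SST n μ :=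
  ⟨{ entry := prFilling n μ T.1
     row_weak' := by
      intro i j1 j2 h12 hm2
      obtain ⟨R, z, i1, -⟩ := slideDots_spec T (μ.rowLen 0) le_rfl
      have hm1 := μ.up_left_mem le_rfl h12.le hm2
      have hE : ∀ a b, ¬ ((a, b) ∈ μ ∧ T.1 a b = n ∧ μ.rowLen 0 ≤ b) := by
        rintro a b ⟨h1, -, h3⟩
        have := YoungDiagram.mem_iff_lt_rowLen.1 (μ.up_left_mem (Nat.zero_le a) le_rfl h1)
        omega
      have := i1.1 i j1 j2 h12 hm2 (hE _ _) (hE _ _)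
      simpa [prFilling, hm1, hm2] using this
     col_strict' := by
      intro r1 r2 j h12 hm2
      obtain ⟨R, z, i1, -⟩ := slideDots_spec T (μ.rowLen 0) le_rfl
      have hm1 := μ.up_left_mem h12.le le_rfl hm2
      have hE : ∀ a b, ¬ ((a, b) ∈ μ ∧ T.1 a b = n ∧ μ.rowLen 0 ≤ b) := by
        rintro a b ⟨h1, -, h3⟩
        have := YoungDiagram.mem_iff_lt_rowLen.1 (μ.up_left_mem (Nat.zero_le a) le_rfl h1)
        omega
      have := i1.2 r1 r2 j h12 hm2 (hE _ _) (hE _ _)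
      simpa [prFilling, hm1, hm2] using this
     zeros' := by
      intro i j h
      simp [prFilling, h] },
   by
    intro r c h
    obtain ⟨R, z, -, -, i3, -⟩ := slideDots_spec T (μ.rowLen 0) le_rfl
    have := i3 r c h
    change 1 ≤ prFilling n μ T.1 r c ∧ prFilling n μ T.1 r c ≤ n
    simp only [prFilling, h, if_true]
    omega⟩

/-! ## The crystal structure -/

/-- The reading order on boxes: rows from bottom to top, each row from left to right.
`ReadLE a b` means that `a` is read before `b` or `a = b`. -/
def ReadLE (a b : ℕ × ℕ) : Prop := b.1 < a.1 ∨ (a.1 = b.1 ∧ a.2 ≤ b.2)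

instance (a b : ℕ × ℕ) : Decidable (ReadLE a b) :=
  inferInstanceAs (Decidable (_ ∨ _))

/-- The sign of a letter `v` for the color `i`: `+` for `i`, `-` for `i + 1`. -/
def sgn (i v : ℕ) : ℤ := if v = i then 1 else if v = i + 1 then -1 else 0

/-- The number of `i`'s minus the number of `i + 1`'s read up to the box `b` (included). -/
def prefixSum (μ : YoungDiagram) (T : ℕ → ℕ → ℕ) (i : ℕ) (b : ℕ × ℕ) : ℤ :=
  ∑ a ∈ μ.cells with ReadLE a b, sgn i (T a.1 a.2)

/-- The number of `i + 1`'s minus the number of `i`'s read from the box `b` (included) on. -/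
def suffixSum (μ : YoungDiagram) (T : ℕ → ℕ → ℕ) (i : ℕ) (b : ℕ × ℕ) : ℤ :=
  ∑ a ∈ μ.cells with ReadLE b a, -sgn i (T a.1 a.2)

/-- The box on which `f i` acts: the first box at which `prefixSum` attains its maximum, provided
that this maximum is positive. Equivalently, when in the reading word each `i + 1` is paired, as an
opening bracket, with an `i` to its right, as a closing bracket, it is the rightmost unpaired `i`
(signature rule). -/
def IsLoweringBox (μ : YoungDiagram) (T : ℕ → ℕ → ℕ) (i : ℕ) (b : ℕ × ℕ) : Prop :=
  b ∈ μ.cells ∧ 0 < prefixSum μ T i b ∧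
    ∀ a ∈ μ.cells, prefixSum μ T i a ≤ prefixSum μ T i b ∧
      (prefixSum μ T i a = prefixSum μ T i b → ReadLE b a)

/-- The box on which `e i` acts: the last box at which `suffixSum` attains its maximum, provided
that this maximum is positive. Equivalently, the leftmost unpaired `i + 1`. -/
def IsRaisingBox (μ : YoungDiagram) (T : ℕ → ℕ → ℕ) (i : ℕ) (b : ℕ × ℕ) : Prop :=
  b ∈ μ.cells ∧ 0 < suffixSum μ T i b ∧
    ∀ a ∈ μ.cells, suffixSum μ T i a ≤ suffixSum μ T i b ∧
      (suffixSum μ T i a = suffixSum μ T i b → ReadLE a b)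

section Signature

variable {α L : Type} [LinearOrder L] (S : Finset α) (rk : α → L) (σ : α → ℤ)

/-- `b` is the `rk`-first element at which the partial sums of `σ` attain a positive maximum. -/
def FirstMax (b : α) : Prop :=
  b ∈ S ∧ 0 < ∑ x ∈ S with rk x ≤ rk b, σ x ∧
    ∀ a ∈ S, ∑ x ∈ S with rk x ≤ rk a, σ x ≤ ∑ x ∈ S with rk x ≤ rk b, σ x ∧
      (∑ x ∈ S with rk x ≤ rk a, σ x = ∑ x ∈ S with rk x ≤ rk b, σ x → rk b ≤ rk a)

/-- `D` is an initial part of `S` for the order given by `rk`. -/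
def Initial (D : Finset α) : Prop := D ⊆ S ∧ ∀ x ∈ D, ∀ y ∈ S, rk y ≤ rk x → y ∈ D

variable {S rk σ}

theorem Initial.eq_filter {D : Finset α} (hD : Initial S rk D) (hne : D.Nonempty) :
    ∃ d ∈ D, D = S.filter (fun x => rk x ≤ rk d) := by
  obtain ⟨d, hd, hmax⟩ := Finset.exists_max_image D rk hne
  refine ⟨d, hd, ?_⟩
  ext x
  simp only [Finset.mem_filter]
  exact ⟨fun h => ⟨hD.1 h, hmax x h⟩, fun h => hD.2 d hd x h.1 h.2⟩

theorem FirstMax.sum_lt {b : α} (hb : FirstMax S rk σ b) {D : Finset α} (hD : Initial S rk D)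
    (hbD : b ∉ D) : ∑ x ∈ D, σ x < ∑ x ∈ S with rk x ≤ rk b, σ x := by
  rcases D.eq_empty_or_nonempty with rfl | hne
  · simpa using hb.2.1
  · obtain ⟨d, hd, hDd⟩ := hD.eq_filter hne
    obtain ⟨h1, h2⟩ := hb.2.2 d (hD.1 hd)
    rw [← hDd] at h1 h2
    refine lt_of_le_of_ne h1 fun h => hbD ?_
    exact hD.2 d hd b hb.1 (h2 h)

theorem exists_firstMax {D : Finset α} (hD : Initial S rk D) (hpos : 0 < ∑ x ∈ D, σ x) :
    ∃ b, FirstMax S rk σ b := by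
  have hne : D.Nonempty := by
    rcases D.eq_empty_or_nonempty with rfl | hne
    · simp at hpos
    · exact hne
  obtain ⟨d, hd, hDd⟩ := hD.eq_filter hne
  obtain ⟨m, hm, hmax⟩ := Finset.exists_max_image S
    (fun a => ∑ x ∈ S with rk x ≤ rk a, σ x) ⟨d, hD.1 hd⟩
  obtain ⟨b, hb, hmin⟩ := Finset.exists_min_image
    (S.filter fun a => ∑ x ∈ S with rk x ≤ rk a, σ x = ∑ x ∈ S with rk x ≤ rk m, σ x) rk
    ⟨m, by simp [hm]⟩
  rw [Finset.mem_filter] at hb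
  refine ⟨b, hb.1, ?_, fun a ha => ⟨by rw [hb.2]; exact hmax a ha, fun h => ?_⟩⟩
  · rw [hb.2]
    refine lt_of_lt_of_le ?_ (hmax d (hD.1 hd))
    rwa [← hDd]
  · exact hmin a (by rw [Finset.mem_filter]; exact ⟨ha, h.trans hb.2⟩)

theorem initial_lt (b : α) : Initial S rk (S.filter fun x => rk x < rk b) := by
  refine ⟨Finset.filter_subset _ _, fun x hx y hy hyx => ?_⟩
  simp only [Finset.mem_filter] at hx ⊢
  exact ⟨hy, hyx.trans_lt hx.2⟩

theorem sum_le_eq (hrk : Function.Injective rk) {b : α} (hb : b ∈ S) :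
    ∑ x ∈ S with rk x ≤ rk b, σ x = ∑ x ∈ S with rk x < rk b, σ x + σ b := by
  classical
  have : S.filter (fun x => rk x ≤ rk b) = insert b (S.filter fun x => rk x < rk b) := by
    ext x
    simp only [Finset.mem_filter, Finset.mem_insert]
    constructor
    · rintro ⟨h1, h2⟩
      rcases h2.lt_or_eq with h | h
      · exact Or.inr ⟨h1, h⟩
      · exact Or.inl (hrk h)
    · rintro (rfl | ⟨h1, h2⟩)
      · exact ⟨hb, le_rfl⟩
      · exact ⟨h1, h2.le⟩
  rw [this, Finset.sum_insert (by simp), add_comm]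

theorem FirstMax.pos (hrk : Function.Injective rk) {b : α} (hb : FirstMax S rk σ b) : 0 < σ b := by
  have h1 := hb.sum_lt (initial_lt b) (by simp)
  have h2 := sum_le_eq (σ := σ) hrk hb.1
  omega

theorem FirstMax.unique (hrk : Function.Injective rk) {a b : α} (ha : FirstMax S rk σ a)
    (hb : FirstMax S rk σ b) : a = b := by
  have h1 := ha.2.2 b hb.1
  have h2 := hb.2.2 a ha.1
  have h3 := le_antisymm h1.1 h2.1
  exact hrk (le_antisymm (h1.2 h3) (h2.2 h3.symm))

/-- Some initial part of `S` has sum at least `k`. -/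
def Reaches (S : Finset α) (rk : α → L) (σ : α → ℤ) (k : ℕ) : Prop :=
  ∃ D, Initial S rk D ∧ (k : ℤ) ≤ ∑ x ∈ D, σ x

theorem Reaches.step (hrk : Function.Injective rk) {k : ℕ} (h : Reaches S rk σ (k + 1)) {b : α}
    (hb : FirstMax S rk σ b) (hσ : σ b ≤ 1) {σ' : α → ℤ} (hσ' : ∀ x, x ≠ b → σ' x = σ x) :
    Reaches S rk σ' k := by
  obtain ⟨D, hD, hk⟩ := h
  refine ⟨_, initial_lt b, ?_⟩
  have h1 : ∑ x ∈ S with rk x < rk b, σ' x = ∑ x ∈ S with rk x < rk b, σ x :=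
    Finset.sum_congr rfl fun x hx => hσ' x (by
      rintro rfl
      simp at hx)
  have h2 := sum_le_eq (σ := σ) hrk hb.1
  have h3 : ∑ x ∈ D, σ x ≤ ∑ x ∈ S with rk x ≤ rk b, σ x := by
    rcases D.eq_empty_or_nonempty with rfl | hne
    · simpa using hb.2.1.le
    · obtain ⟨d, hd, hDd⟩ := hD.eq_filter hne
      have := (hb.2.2 d (hD.1 hd)).1
      rwa [← hDd] at this
  push_cast at hk
  omega

/-- If every positive element of `B` is matched injectively with a negative one, the sum over `B`
is not positive. -/
theorem sum_nonpos_of_matching (B : Finset α) (hσ : ∀ x ∈ B, σ x ≤ 1) (g : α → α)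
    (hg : ∀ x ∈ B, 0 < σ x → g x ∈ B ∧ σ (g x) ≤ -1)
    (hinj : ∀ x ∈ B, ∀ y ∈ B, 0 < σ x → 0 < σ y → g x = g y → x = y) : ∑ x ∈ B, σ x ≤ 0 := by
  classical
  have h1 : ∑ x ∈ B with 0 < σ x, σ x ≤ ((B.filter fun x => 0 < σ x).card : ℤ) := by
    have := Finset.sum_le_card_nsmul (B.filter fun x => 0 < σ x) σ 1
      (fun x hx => hσ x (Finset.mem_filter.1 hx).1)
    simpa using this
  have h2 : ∑ x ∈ B with ¬ 0 < σ x, σ x ≤ -((B.filter fun x => 0 < σ x).card : ℤ) := by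
    have hsub : (B.filter fun x => 0 < σ x).image g ⊆ B.filter fun x => ¬ 0 < σ x := by
      intro y hy
      obtain ⟨x, hx, rfl⟩ := Finset.mem_image.1 hy
      rw [Finset.mem_filter] at hx ⊢
      have := hg x hx.1 hx.2
      exact ⟨this.1, by omega⟩
    have hcard : ((B.filter fun x => 0 < σ x).image g).card = (B.filter fun x => 0 < σ x).card := by
      refine Finset.card_image_of_injOn fun x hx y hy hxy => ?_
      have hx' := Finset.mem_filter.1 (Finset.mem_coe.1 hx)
      have hy' := Finset.mem_filter.1 (Finset.mem_coe.1 hy)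
      exact hinj x hx'.1 y hy'.1 hx'.2 hy'.2 hxy
    have h3 : ∑ x ∈ B with ¬ 0 < σ x, σ x ≤ ∑ x ∈ (B.filter fun x => 0 < σ x).image g, σ x := by
      rw [← Finset.sum_sdiff hsub]
      have : ∑ x ∈ (B.filter fun x => ¬ 0 < σ x) \ (B.filter fun x => 0 < σ x).image g, σ x ≤ 0 :=
        Finset.sum_nonpos fun x hx => by
          have := (Finset.mem_filter.1 (Finset.mem_sdiff.1 hx).1).2
          omega
      omega
    have h4 := Finset.sum_le_card_nsmul ((B.filter fun x => 0 < σ x).image g) σ (-1) (by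
      intro y hy
      obtain ⟨x, hx, rfl⟩ := Finset.mem_image.1 hy
      rw [Finset.mem_filter] at hx
      exact (hg x hx.1 hx.2).2)
    rw [hcard] at h4
    simp only [smul_neg, nsmul_eq_mul, mul_one] at h4
    linarith
  have h5 := Finset.sum_filter_add_sum_filter_not B (fun x => 0 < σ x) σ
  omega

end Signature

/-- The reading order as a linear order. -/
def readKey (a : ℕ × ℕ) : ℕᵒᵈ ×ₗ ℕ := toLex (OrderDual.toDual a.1, a.2)

theorem readKey_le {a b : ℕ × ℕ} : readKey a ≤ readKey b ↔ ReadLE a b := by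
  rw [readKey, readKey, Prod.Lex.toLex_le_toLex]
  simp [ReadLE]

theorem readKey_injective : Function.Injective readKey := by
  rintro ⟨a, b⟩ ⟨c, d⟩ h
  have := congrArg ofLex h
  simpa [readKey] using this

theorem prefixSum_eq (μ : YoungDiagram) (T : ℕ → ℕ → ℕ) (i : ℕ) (b : ℕ × ℕ) :
    prefixSum μ T i b = ∑ a ∈ μ.cells with readKey a ≤ readKey b, sgn i (T a.1 a.2) :=
  Finset.sum_congr (by ext; simp [readKey_le]) fun _ _ => rfl

theorem suffixSum_eq (μ : YoungDiagram) (T : ℕ → ℕ → ℕ) (i : ℕ) (b : ℕ × ℕ) :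
    suffixSum μ T i b = ∑ a ∈ μ.cells with
      OrderDual.toDual (readKey a) ≤ OrderDual.toDual (readKey b), -sgn i (T a.1 a.2) :=
  Finset.sum_congr (by ext; simp [readKey_le]) fun _ _ => rfl

theorem isLoweringBox_iff {μ : YoungDiagram} {T : ℕ → ℕ → ℕ} {i : ℕ} {b : ℕ × ℕ} :
    IsLoweringBox μ T i b ↔ FirstMax μ.cells readKey (fun a => sgn i (T a.1 a.2)) b := by
  unfold IsLoweringBox FirstMax
  simp only [prefixSum_eq, readKey_le]

theorem isRaisingBox_iff {μ : YoungDiagram} {T : ℕ → ℕ → ℕ} {i : ℕ} {b : ℕ × ℕ} :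
    IsRaisingBox μ T i b ↔
      FirstMax μ.cells (fun a => OrderDual.toDual (readKey a)) (fun a => -sgn i (T a.1 a.2)) b := by
  unfold IsRaisingBox FirstMax
  simp only [suffixSum_eq, OrderDual.toDual_le_toDual, readKey_le]

theorem sgn_le_one (i v : ℕ) : sgn i v ≤ 1 := by unfold sgn; split_ifs <;> omega

theorem neg_one_le_sgn (i v : ℕ) : -1 ≤ sgn i v := by unfold sgn; split_ifs <;> omega

theorem sgn_pos {i v : ℕ} : 0 < sgn i v ↔ v = i := by unfold sgn; split_ifs <;> simp_all

theorem sgn_neg {i v : ℕ} : sgn i v < 0 ↔ v = i + 1 := by unfold sgn; split_ifs <;> simp_all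

theorem lowering_facts {n : ℕ} {μ : YoungDiagram} (T : SST n μ) {i r c : ℕ}
    (hb : IsLoweringBox μ T.1 i (r, c)) :
    T.1 r c = i ∧ (∀ c2, c < c2 → (r, c2) ∈ μ → i < T.1 r c2) ∧
      (∀ r2, r < r2 → (r2, c) ∈ μ → i + 1 < T.1 r2 c) := by
  rw [isLoweringBox_iff] at hb
  have hbm : (r, c) ∈ μ := by simpa using hb.1
  have h1 : T.1 r c = i := sgn_pos.1 (hb.pos readKey_injective)
  refine ⟨h1, ?_, ?_⟩
  · intro c2 hc hm2
    have h2 := T.1.row_weak hc hm2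
    rcases (h1 ▸ h2).lt_or_eq with h | h
    · exact h
    · exfalso
      have h3 := (hb.2.2 (r, c2) (by simpa using hm2)).1
      have hsub : μ.cells.filter (fun x => readKey x ≤ readKey (r, c)) ⊆
          μ.cells.filter (fun x => readKey x ≤ readKey (r, c2)) := by
        intro x hx
        simp only [Finset.mem_filter, readKey_le, ReadLE] at hx ⊢
        refine ⟨hx.1, ?_⟩
        have := hx.2
        omega
      rw [← Finset.sum_sdiff hsub] at h3
      have h4 : 0 < ∑ x ∈ μ.cells.filter (fun x => readKey x ≤ readKey (r, c2)) \
          μ.cells.filter (fun x => readKey x ≤ readKey (r, c)), sgn i (T.1 x.1 x.2) := by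
        refine Finset.sum_pos ?_ ⟨(r, c2), ?_⟩
        · rintro ⟨x1, x2⟩ hx
          simp only [Finset.mem_sdiff, Finset.mem_filter, readKey_le, ReadLE, μ.mem_cells] at hx
          rw [sgn_pos]
          obtain ⟨⟨k1, k2⟩, k3⟩ := hx
          replace k3 := not_and.1 k3 k1
          obtain rfl : x1 = r := by omega
          have k4 := T.1.row_weak_of_le (show c ≤ x2 by omega) k1
          have k5 := T.1.row_weak_of_le (show x2 ≤ c2 by omega) hm2
          simp only
          omega
        · rw [Finset.mem_sdiff, Finset.mem_filter, Finset.mem_filter, μ.mem_cells, readKey_le, readKey_le]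
          refine ⟨⟨hm2, Or.inr ⟨rfl, ?_⟩⟩, not_and.2 fun _ => ?_⟩
          · dsimp only; omega
          · dsimp only [ReadLE]; omega
      linarith
  · intro r2 hr hm2
    have hm1 : (r + 1, c) ∈ μ := μ.up_left_mem (by omega) le_rfl hm2
    have h2 := T.1.col_strict (show r < r + 1 by omega) hm1
    have h3 := T.1.col_weak (show r + 1 ≤ r2 by omega) hm2
    by_contra hcon
    have h4 : T.1 (r + 1) c = i + 1 := by omega
    set D := μ.cells.filter (fun x => r + 1 < x.1 ∨ (x.1 = r + 1 ∧ T.1 x.1 x.2 ≤ i)) with hDdef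
    have hD : Initial μ.cells readKey D := by
      refine ⟨Finset.filter_subset _ _, ?_⟩
      rintro ⟨x1, x2⟩ hx ⟨y1, y2⟩ hy hyx
      simp only [hDdef, Finset.mem_filter, readKey_le, ReadLE, μ.mem_cells] at hx hy hyx ⊢
      refine ⟨hy, ?_⟩
      rcases Nat.lt_or_ge (r + 1) y1 with h | h
      · exact Or.inl h
      · right
        obtain rfl : x1 = y1 := by omega
        have := T.1.row_weak_of_le (show y2 ≤ x2 by omega) hx.1
        omega
    have h5 := hb.sum_lt hD (by simp [hDdef])
    have hsub : D ⊆ μ.cells.filter (fun x => readKey x ≤ readKey (r, c)) := by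
      intro x hx
      simp only [hDdef, Finset.mem_filter, readKey_le, ReadLE] at hx ⊢
      refine ⟨hx.1, ?_⟩
      have := hx.2
      omega
    rw [← Finset.sum_sdiff hsub] at h5
    have h6 := sum_nonpos_of_matching (σ := fun x => sgn i (T.1 x.1 x.2))
      (μ.cells.filter (fun x => readKey x ≤ readKey (r, c)) \ D) (fun x _ => sgn_le_one _ _)
      (fun x => (x.1 + 1, x.2)) (by
        rintro ⟨x1, x2⟩ hx hpos
        rw [sgn_pos] at hpos
        simp only [hDdef, Finset.mem_sdiff, Finset.mem_filter, readKey_le, ReadLE, μ.mem_cells]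
          at hx hpos ⊢
        obtain ⟨⟨k1, k2⟩, k3⟩ := hx
        have hx1 : x1 = r := by
          have : ¬ (r + 1 < x1 ∨ (x1 = r + 1 ∧ T.1 x1 x2 ≤ i)) := fun h => k3 ⟨k1, h⟩
          omega
        subst hx1
        have hxm : (x1 + 1, x2) ∈ μ := μ.up_left_mem le_rfl (by omega) hm1
        have k4 := T.1.col_strict (show x1 < x1 + 1 by omega) hxm
        have k5 := T.1.row_weak_of_le (show x2 ≤ c by omega) hm1
        refine ⟨⟨⟨hxm, by omega⟩, not_and.2 fun _ => by omega⟩, ?_⟩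
        have : sgn i (T.1 (x1 + 1) x2) < 0 := sgn_neg.2 (by omega)
        omega)
      (by
        rintro ⟨x1, x2⟩ - ⟨y1, y2⟩ - - - h
        simpa using h)
    omega

theorem raising_facts {n : ℕ} {μ : YoungDiagram} (T : SST n μ) {i r c : ℕ}
    (hb : IsRaisingBox μ T.1 i (r, c)) :
    T.1 r c = i + 1 ∧ (∀ c1, c1 < c → T.1 r c1 ≤ i) ∧ (∀ r1, r1 < r → T.1 r1 c < i) := by
  rw [isRaisingBox_iff] at hb
  have hbm : (r, c) ∈ μ := by simpa using hb.1
  have h1 : T.1 r c = i + 1 := by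
    have := hb.pos (OrderDual.toDual.injective.comp readKey_injective)
    exact sgn_neg.1 (by simpa using this)
  refine ⟨h1, ?_, ?_⟩
  · intro c1 hc
    have hm1 := μ.up_left_mem le_rfl hc.le hbm
    have h2 := T.1.row_weak hc hbm
    by_contra hcon
    have h : T.1 r c1 = i + 1 := by omega
    have h3 := (hb.2.2 (r, c1) (by simpa using hm1)).1
    simp only [OrderDual.toDual_le_toDual] at h3
    have hsub : μ.cells.filter (fun x => readKey (r, c) ≤ readKey x) ⊆
        μ.cells.filter (fun x => readKey (r, c1) ≤ readKey x) := by
      intro x hx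
      simp only [Finset.mem_filter, readKey_le, ReadLE] at hx ⊢
      refine ⟨hx.1, ?_⟩
      have := hx.2
      omega
    rw [← Finset.sum_sdiff hsub] at h3
    have h4 : 0 < ∑ x ∈ μ.cells.filter (fun x => readKey (r, c1) ≤ readKey x) \
        μ.cells.filter (fun x => readKey (r, c) ≤ readKey x), -sgn i (T.1 x.1 x.2) := by
      refine Finset.sum_pos ?_ ⟨(r, c1), ?_⟩
      · rintro ⟨x1, x2⟩ hx
        simp only [Finset.mem_sdiff, Finset.mem_filter, readKey_le, ReadLE, μ.mem_cells] at hx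
        rw [neg_pos, sgn_neg]
        obtain ⟨⟨k1, k2⟩, k3⟩ := hx
        replace k3 := not_and.1 k3 k1
        obtain rfl : x1 = r := by omega
        have k4 := T.1.row_weak_of_le (show c1 ≤ x2 by omega) k1
        have k5 := T.1.row_weak_of_le (show x2 ≤ c by omega) hbm
        simp only
        omega
      · rw [Finset.mem_sdiff, Finset.mem_filter, Finset.mem_filter, μ.mem_cells, readKey_le, readKey_le]
        refine ⟨⟨hm1, Or.inr ⟨rfl, ?_⟩⟩, not_and.2 fun _ => ?_⟩
        · dsimp only; omega
        · dsimp only [ReadLE]; omega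
    omega
  · intro r1 hr
    obtain ⟨s, rfl⟩ : ∃ s, r = s + 1 := ⟨r - 1, by omega⟩
    have hms : (s, c) ∈ μ := μ.up_left_mem (by omega) le_rfl hbm
    have h2 := T.1.col_strict (show s < s + 1 by omega) hbm
    have h3 := T.1.col_weak (show r1 ≤ s by omega) hms
    by_contra hcon
    have h4 : T.1 s c = i := by omega
    set D := μ.cells.filter (fun x => x.1 < s ∨ (x.1 = s ∧ i + 1 ≤ T.1 x.1 x.2)) with hDdef
    have hD : Initial μ.cells (fun a => OrderDual.toDual (readKey a)) D := by
      refine ⟨Finset.filter_subset _ _, ?_⟩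
      rintro ⟨x1, x2⟩ hx ⟨y1, y2⟩ hy hyx
      simp only [hDdef, Finset.mem_filter, OrderDual.toDual_le_toDual, readKey_le, ReadLE,
        μ.mem_cells] at hx hy hyx ⊢
      refine ⟨hy, ?_⟩
      rcases Nat.lt_or_ge y1 s with h | h
      · exact Or.inl h
      · right
        obtain rfl : x1 = y1 := by omega
        have := T.1.row_weak_of_le (show x2 ≤ y2 by omega) hy
        omega
    have h5 := hb.sum_lt hD (by simp [hDdef])
    simp only [OrderDual.toDual_le_toDual] at h5
    have hsub : D ⊆ μ.cells.filter (fun x => readKey (s + 1, c) ≤ readKey x) := by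
      intro x hx
      simp only [hDdef, Finset.mem_filter, readKey_le, ReadLE] at hx ⊢
      refine ⟨hx.1, ?_⟩
      have := hx.2
      omega
    rw [← Finset.sum_sdiff hsub] at h5
    have h6 := sum_nonpos_of_matching (σ := fun x => -sgn i (T.1 x.1 x.2))
      (μ.cells.filter (fun x => readKey (s + 1, c) ≤ readKey x) \ D)
      (fun x _ => by have := neg_one_le_sgn i (T.1 x.1 x.2); omega)
      (fun x => (x.1 - 1, x.2)) (by
        rintro ⟨x1, x2⟩ hx hpos
        rw [neg_pos, sgn_neg] at hpos
        simp only [hDdef, Finset.mem_sdiff, Finset.mem_filter, readKey_le, ReadLE, μ.mem_cells]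
          at hx hpos ⊢
        obtain ⟨⟨k1, k2⟩, k3⟩ := hx
        have hx1 : x1 = s + 1 := by
          have : ¬ (x1 < s ∨ (x1 = s ∧ i + 1 ≤ T.1 x1 x2)) := fun h => k3 ⟨k1, h⟩
          omega
        subst hx1
        rw [Nat.add_sub_cancel]
        have hxm : (s, x2) ∈ μ := μ.up_left_mem (by omega) le_rfl k1
        have k4 := T.1.col_strict (show s < s + 1 by omega) k1
        have k5 := T.1.row_weak_of_le (show c ≤ x2 by omega) hxm
        refine ⟨⟨⟨hxm, by omega⟩, not_and.2 fun _ => by omega⟩, ?_⟩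
        have : 0 < sgn i (T.1 s x2) := sgn_pos.2 (by omega)
        omega)
      (by
        rintro ⟨x1, x2⟩ hx ⟨y1, y2⟩ hy hpx hpy h
        simp only [hDdef, Finset.mem_sdiff, Finset.mem_filter, readKey_le, ReadLE, μ.mem_cells,
          neg_pos, sgn_neg, Prod.mk.injEq] at hx hy hpx hpy h ⊢
        have k1 : ¬ (x1 < s ∨ (x1 = s ∧ i + 1 ≤ T.1 x1 x2)) := fun h => hx.2 ⟨hx.1.1, h⟩
        have k2 : ¬ (y1 < s ∨ (y1 = s ∧ i + 1 ≤ T.1 y1 y2)) := fun h => hy.2 ⟨hy.1.1, h⟩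
        omega)
    omega

/-- The tableau obtained by changing the entry of a box, if the conditions for it to be again in
`SST n μ` are satisfied. -/
def SST.update {n : ℕ} {μ : YoungDiagram} (T : SST n μ) (r c v : ℕ) (hm : (r, c) ∈ μ)
    (hv : 1 ≤ v ∧ v ≤ n) (hleft : ∀ c1, c1 < c → T.1 r c1 ≤ v)
    (hright : ∀ c2, c < c2 → (r, c2) ∈ μ → v ≤ T.1 r c2) (hup : ∀ r1, r1 < r → T.1 r1 c < v)
    (hdown : ∀ r2, r < r2 → (r2, c) ∈ μ → v < T.1 r2 c) : SST n μ :=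
  ⟨{ entry := setCell T.1 r c v
     row_weak' := by
      intro a j1 j2 h12 hm2
      have := T.1.row_weak h12 hm2
      simp only [setCell]
      split_ifs with h1 h2 h2
      · omega
      · obtain ⟨rfl, rfl⟩ := h1; exact hright j2 h12 hm2
      · obtain ⟨rfl, rfl⟩ := h2; exact hleft j1 h12
      · exact this
     col_strict' := by
      intro r1 r2 j h12 hm2
      have := T.1.col_strict h12 hm2
      simp only [setCell]
      split_ifs with h1 h2 h2
      · omega
      · obtain ⟨rfl, rfl⟩ := h1; exact hdown r2 h12 hm2
      · obtain ⟨rfl, rfl⟩ := h2; exact hup r1 h12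
      · exact this
     zeros' := by
      intro a j h
      have h1 : ¬ (a = r ∧ j = c) := by rintro ⟨rfl, rfl⟩; exact h hm
      simp only [setCell, h1, if_false]
      exact T.1.zeros h },
   by
    intro a j h
    change 1 ≤ setCell T.1 r c v a j ∧ setCell T.1 r c v a j ≤ n
    simp only [setCell]
    split_ifs
    · exact hv
    · exact T.2 a j h⟩

/-- The index set `I = {1, …, n - 1}` of the Cartan matrix of type `A_{n-1}`. -/
abbrev Index (n : ℕ) : Type := {i : ℕ // 1 ≤ i ∧ i < n}

/-- Change the entry `i` of the box `b` on which `f i` acts into `i + 1`. -/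
def lowerAt {n : ℕ} {μ : YoungDiagram} (i : Index n) (T : SST n μ) (b : ℕ × ℕ)
    (hb : IsLoweringBox μ T.1 i b) : SST n μ :=
  T.update b.1 b.2 (i + 1) (by simpa using hb.1) ⟨by omega, i.2.2⟩
    (fun c1 h => by
      have h1 := T.1.row_weak (i := b.1) h (by simpa using hb.1)
      have h2 := (lowering_facts T hb).1
      omega)
    (lowering_facts T hb).2.1
    (fun r1 h => by
      have h1 := T.1.col_strict (j := b.2) h (by simpa using hb.1)
      have h2 := (lowering_facts T hb).1
      omega)
    (lowering_facts T hb).2.2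

/-- Change the entry `i + 1` of the box `b` on which `e i` acts into `i`. -/
def raiseAt {n : ℕ} {μ : YoungDiagram} (i : Index n) (T : SST n μ) (b : ℕ × ℕ)
    (hb : IsRaisingBox μ T.1 i b) : SST n μ :=
  T.update b.1 b.2 i (by simpa using hb.1) ⟨i.2.1, i.2.2.le⟩
    (raising_facts T hb).2.1
    (fun c2 h hm => by
      have h1 := T.1.row_weak (i := b.1) h hm
      have h2 := (raising_facts T hb).1
      omega)
    (raising_facts T hb).2.2
    (fun r2 h hm => by
      have h1 := T.1.col_strict (j := b.2) h hm
      have h2 := (raising_facts T hb).1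
      omega)

open Classical in
/-- The crystal operator `f̃ i`; the value `none` is the element `0` outside the crystal. -/
noncomputable def f {n : ℕ} {μ : YoungDiagram} (i : Index n) (T : SST n μ) : Option (SST n μ) :=
  if h : ∃ b, IsLoweringBox μ T.1 i b then some (lowerAt i T h.choose h.choose_spec) else none

open Classical in
/-- The crystal operator `ẽ i`; the value `none` is the element `0` outside the crystal. -/
noncomputable def e {n : ℕ} {μ : YoungDiagram} (i : Index n) (T : SST n μ) : Option (SST n μ) :=
  if h : ∃ b, IsRaisingBox μ T.1 i b then some (raiseAt i T h.choose h.choose_spec) else none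

/-- The power `g ^ k` of an operator `g : B → B ∪ {0}`. -/
def iter {B : Type} (g : B → Option B) : ℕ → B → Option B
  | 0, b => some b
  | k + 1, b => (g b).bind (iter g k)

/-- The number of occurrences of `k` in `T`. -/
def count {n : ℕ} {μ : YoungDiagram} (T : SST n μ) (k : ℕ) : ℕ :=
  (μ.cells.filter fun a => T.1 a.1 a.2 = k).card

/-- The pairing `⟨h i, wt T⟩`, where `wt T = ∑ k, count T k • ε k`. -/
def pairing {n : ℕ} {μ : YoungDiagram} (i : Index n) (T : SST n μ) : ℤ :=
  (count T i : ℤ) - count T (i + 1)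

theorem sum_sgn {n : ℕ} {μ : YoungDiagram} (i : Index n) (T : SST n μ) :
    ∑ x ∈ μ.cells, sgn i (T.1 x.1 x.2) = pairing i T := by
  have : ∀ v : ℕ, sgn i v = (if v = i then 1 else 0) - (if v = i + 1 then 1 else 0) := by
    intro v; unfold sgn; split_ifs <;> omega
  simp only [this, Finset.sum_sub_distrib, Finset.sum_boole, pairing, count]

theorem iter_f_isSome {n : ℕ} {μ : YoungDiagram} (i : Index n) : ∀ (k : ℕ) (T : SST n μ),
    Reaches μ.cells readKey (fun x => sgn i (T.1 x.1 x.2)) k → (iter (f i) k T).isSome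
  | 0, _, _ => rfl
  | k + 1, T, h => by
    obtain ⟨D, hD, hk⟩ := h
    obtain ⟨b, hb⟩ := exists_firstMax hD (lt_of_lt_of_le (by positivity) hk)
    have hex : ∃ b, IsLoweringBox μ T.1 i b := ⟨b, isLoweringBox_iff.2 hb⟩
    have hf : f i T = some (lowerAt i T hex.choose hex.choose_spec) := dif_pos hex
    rw [iter, hf, Option.bind_some]
    refine iter_f_isSome i k _ (Reaches.step readKey_injective ⟨D, hD, hk⟩
      (isLoweringBox_iff.1 hex.choose_spec) (sgn_le_one _ _) ?_)
    intro x hx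
    have : ¬ (x.1 = hex.choose.1 ∧ x.2 = hex.choose.2) := fun h => hx (Prod.ext h.1 h.2)
    change sgn i (setCell T.1 _ _ _ x.1 x.2) = _
    simp only [setCell, this, if_false]

theorem iter_e_isSome {n : ℕ} {μ : YoungDiagram} (i : Index n) : ∀ (k : ℕ) (T : SST n μ),
    Reaches μ.cells (fun a => OrderDual.toDual (readKey a)) (fun x => -sgn i (T.1 x.1 x.2)) k →
      (iter (e i) k T).isSome
  | 0, _, _ => rfl
  | k + 1, T, h => by
    obtain ⟨D, hD, hk⟩ := h
    obtain ⟨b, hb⟩ := exists_firstMax hD (lt_of_lt_of_le (by positivity) hk)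
    have hex : ∃ b, IsRaisingBox μ T.1 i b := ⟨b, isRaisingBox_iff.2 hb⟩
    have hf : e i T = some (raiseAt i T hex.choose hex.choose_spec) := dif_pos hex
    rw [iter, hf, Option.bind_some]
    refine iter_e_isSome i k _ (Reaches.step (OrderDual.toDual.injective.comp readKey_injective)
      ⟨D, hD, hk⟩ (isRaisingBox_iff.1 hex.choose_spec)
      (by have := neg_one_le_sgn i (T.1 hex.choose.1 hex.choose.2); omega) ?_)
    intro x hx
    have : ¬ (x.1 = hex.choose.1 ∧ x.2 = hex.choose.2) := fun h => hx (Prod.ext h.1 h.2)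
    change -sgn i (setCell T.1 _ _ _ x.1 x.2) = _
    simp only [setCell, this, if_false]

theorem iter_f_pairing {n : ℕ} {μ : YoungDiagram} (i : Index n) (T : SST n μ)
    (h : 0 ≤ pairing i T) : (iter (f i) (pairing i T).toNat T).isSome :=
  iter_f_isSome i _ T ⟨μ.cells, ⟨subset_rfl, fun _ _ y hy _ => hy⟩, by rw [sum_sgn]; omega⟩

theorem iter_e_pairing {n : ℕ} {μ : YoungDiagram} (i : Index n) (T : SST n μ)
    (h : ¬ 0 ≤ pairing i T) : (iter (e i) (-pairing i T).toNat T).isSome :=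
  iter_e_isSome i _ T ⟨μ.cells, ⟨subset_rfl, fun _ _ y hy _ => hy⟩, by
    rw [Finset.sum_neg_distrib, sum_sgn]; omega⟩

/-- The operator `s̃ i` on `SST n μ`: `f̃ i ^ ⟨h i, wt T⟩` if `⟨h i, wt T⟩ ≥ 0`, and
`ẽ i ^ (-⟨h i, wt T⟩)` otherwise. -/
noncomputable def s {n : ℕ} {μ : YoungDiagram} (i : Index n) (T : SST n μ) : SST n μ :=
  if h : 0 ≤ pairing i T then (iter (f i) (pairing i T).toNat T).get (iter_f_pairing i T h)
  else (iter (e i) (-pairing i T).toNat T).get (iter_e_pairing i T h)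

/-- The Coxeter element `s̃ 1 ∘ s̃ 2 ∘ ⋯ ∘ s̃ (n - 1)` acting on `SST n μ`. -/
noncomputable def cox {n : ℕ} {μ : YoungDiagram} (T : SST n μ) : SST n μ :=
  (List.finRange (n - 1)).foldr (fun (k : Fin (n - 1)) T => s ⟨k.1 + 1, by omega, by have := k.2; omega⟩ T) T

end HookPromotion

namespace HookPromotion

/-! ## Slides are permutations of boxes -/

/-! For both kinds of shape a tableau is determined by two data: the set `col0 T` of entries of its
first column and its content. In a hook, the arm is the weakly increasing arrangement of the
remaining letters; in a two-column shape the remaining letters form the second column. So every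
identity between maps on tableaux can be checked on content and first column.

On contents, `pr` is the cyclic shift of the letters and `s i` is the transposition of `i` and `i +
1`, so the content half of the relations is immediate. On first columns, `s i` acts either by the
same transposition or trivially, and a condition `F` on the two multiplicities decides which: for
hooks it transposes exactly when one of the letters is missing, for two columns unless both occur
exactly once. Promotion shifts the first column cyclically if `n` lies in it, and shifts it if `n`
does not occur at all. If `n` occurs only outside it, a dot enters the first column and expels one
entry `y`. For a hook, `y` is the least entry. For two columns, `y` is the place where the height
(entries `≤ v` in the first column minus those in the second) leaves zero for the last time before
`n`.

Both descriptions of `y` are compatible with `s i` for `i + 1 < n`. The structure `ColumnModel`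
records what is needed, and `ColumnModel.s_pr` deduces `s (i + 1) ∘ pr = pr ∘ s i`. The wrap-around
relation `s 1 ∘ pr² = pr² ∘ s (n - 1)` is checked separately, in `IsHook.s_pr_pr` by an explicit
description of the first column of `pr (pr T)`, and in `IsTwoColumn.s_pr_pr` by comparing heights.
Finally `pr ^ n = pr ^ (i - 1) ∘ pr² ∘ pr ^ (n - 1 - i)` carries `s i` to `s (n - 1)`, then to `s
1`, then back to `s i`; the Coxeter element follows factor by factor. -/

theorem slide_stop {G : ℕ → ℕ → ℕ} {r c : ℕ} (h1 : (if r = 0 then 0 else G (r - 1) c) = 0)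
    (h2 : (if c = 0 then 0 else G r (c - 1)) = 0) : slide G r c = G := by
  rw [slide, if_pos ⟨h1, h2⟩]

theorem slide_up {G : ℕ → ℕ → ℕ} {r c : ℕ} (h0 : G r c ≠ 0)
    (h : (if c = 0 then 0 else G (r + 1) (c - 1)) ≤ G r c) :
    slide G (r + 1) c = slide (setCell (setCell G (r + 1) c (G r c)) r c 0) r c := by
  rw [slide, if_neg (by simp [h0]), if_pos (by simpa using h)]
  simp

theorem slide_left {G : ℕ → ℕ → ℕ} {r c : ℕ}
    (h : (if r = 0 then 0 else G (r - 1) (c + 1)) < G r c) :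
    slide G r (c + 1) = slide (setCell (setCell G r (c + 1) (G r c)) r c 0) r c := by
  rw [slide, if_neg (by simp; omega), if_neg (by simpa using h)]
  simp

theorem slide_cases (G : ℕ → ℕ → ℕ) (r c : ℕ) :
    ((if r = 0 then 0 else G (r - 1) c) = 0 ∧ (if c = 0 then 0 else G r (c - 1)) = 0) ∨
    (∃ r', r = r' + 1 ∧ G r' c ≠ 0 ∧ (if c = 0 then 0 else G (r' + 1) (c - 1)) ≤ G r' c) ∨
    (∃ c', c = c' + 1 ∧ (if r = 0 then 0 else G (r - 1) (c' + 1)) < G r c') := by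
  by_cases h : (if c = 0 then 0 else G r (c - 1)) ≤ (if r = 0 then 0 else G (r - 1) c)
  · rcases r with _ | r
    · left; simpa using h
    · by_cases h0 : G r c = 0
      · left; simp at h ⊢; simp_all
      · right; left; exact ⟨r, rfl, h0, by simpa using h⟩
  · rcases c with _ | c
    · simp at h
    · right; right; exact ⟨c, rfl, by simpa using h⟩

theorem setCell_swap {G : ℕ → ℕ → ℕ} {r c r' c' : ℕ} (h0 : G r c = 0) (a b : ℕ) :
    setCell (setCell G r c (G r' c')) r' c' 0 a b =
      G (Equiv.swap (r, c) (r', c') (a, b)).1 (Equiv.swap (r, c) (r', c') (a, b)).2 := by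
  simp only [setCell, Equiv.swap_apply_def, Prod.mk.injEq]
  split_ifs <;> simp_all

/-- Each move exchanges the dot with a neighbour, which is precomposition with a transposition of
boxes; the path only visits boxes weakly northwest of its start, so all other boxes stay fixed. -/
theorem slide_perm (k : ℕ) : ∀ (G : ℕ → ℕ → ℕ) (r c : ℕ), r + c = k → G r c = 0 →
    ∃ σ : Equiv.Perm (ℕ × ℕ), (∀ x : ℕ × ℕ, slide G r c x.1 x.2 = G (σ x).1 (σ x).2) ∧
      ∀ x, ¬ (x.1 ≤ r ∧ x.2 ≤ c) → σ x = x := by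
  induction k with
  | zero =>
    intro G r c hk h0
    obtain ⟨rfl, rfl⟩ : r = 0 ∧ c = 0 := by omega
    exact ⟨1, fun x => by rw [slide_stop (r := 0) (c := 0) (by simp) (by simp)]; rfl, fun _ _ => rfl⟩
  | succ k ih =>
    intro G r c hk h0
    have step : ∀ r' c', r' + c' = k → r' ≤ r → c' ≤ c →
        slide G r c = slide (setCell (setCell G r c (G r' c')) r' c' 0) r' c' →
        ∃ σ : Equiv.Perm (ℕ × ℕ), (∀ x : ℕ × ℕ, slide G r c x.1 x.2 = G (σ x).1 (σ x).2) ∧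
          ∀ x, ¬ (x.1 ≤ r ∧ x.2 ≤ c) → σ x = x := by
      intro r' c' hk' hr hc hs
      obtain ⟨σ, h1, h2⟩ := ih (setCell (setCell G r c (G r' c')) r' c' 0) r' c' hk' (by unfold setCell; simp)
      refine ⟨σ.trans (Equiv.swap (r, c) (r', c')), fun x => ?_, fun x hx => ?_⟩
      · rw [hs, h1, setCell_swap h0]; rfl
      · rw [Equiv.trans_apply, h2 x (by omega)]
        exact Equiv.swap_apply_of_ne_of_ne (by rintro rfl; simp at hx)
          (by rintro rfl; simp at hx; omega)
    rcases slide_cases G r c with ⟨h1, h2⟩ | ⟨r', rfl, h1, h2⟩ | ⟨c', rfl, h1⟩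
    · exact ⟨1, fun x => by rw [slide_stop h1 h2]; rfl, fun _ _ => rfl⟩
    · exact step r' c (by omega) (by omega) le_rfl (slide_up h1 h2)
    · exact step r c' (by omega) le_rfl (by omega) (slide_left h1)

theorem lowest_mem {μ : YoungDiagram} {m : ℕ} (hm : m < μ.rowLen 0) : (μ.colLen m - 1, m) ∈ μ := by
  have := YoungDiagram.mem_iff_lt_colLen.1 (YoungDiagram.mem_iff_lt_rowLen.2 hm)
  exact YoungDiagram.mem_iff_lt_colLen.2 (by omega)

theorem slideDots_dot {n : ℕ} {μ : YoungDiagram} (T : SST n μ) {m : ℕ} (hm : m < μ.rowLen 0)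
    (hT : T.1 (μ.colLen m - 1) m = n) : slideDots n μ T.1 m (μ.colLen m - 1) m = 0 := by
  obtain ⟨R, z, -, -, -, h, -⟩ := slideDots_spec T m hm.le
  exact (h _ _ (lowest_mem hm) hT le_rfl).1

theorem slideDots_perm {n : ℕ} {μ : YoungDiagram} (T : SST n μ) : ∀ m, m ≤ μ.rowLen 0 →
    ∃ σ : Equiv.Perm (ℕ × ℕ),
      (∀ x : ℕ × ℕ, slideDots n μ T.1 m x.1 x.2 = dotted n T.1 (σ x).1 (σ x).2) ∧
        ∀ x, x ∈ μ ↔ σ x ∈ μ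
  | 0, _ => ⟨1, fun _ => rfl, fun _ => Iff.rfl⟩
  | m + 1, hm => by
    obtain ⟨σ, h1, h2⟩ := slideDots_perm T m (by omega)
    rw [slideDots]
    split_ifs with hT
    · obtain ⟨τ, k1, k2⟩ := slide_perm _ _ _ _ rfl (slideDots_dot T (by omega) hT)
      have hmem : ∀ x : ℕ × ℕ, x.1 ≤ μ.colLen m - 1 ∧ x.2 ≤ m → x ∈ μ := fun x hx =>
        μ.up_left_mem hx.1 hx.2 (lowest_mem (by omega))
      refine ⟨τ.trans σ, fun x => by rw [k1, h1]; rfl, fun x => ?_⟩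
      rw [Equiv.trans_apply, ← h2]
      by_cases hx : x.1 ≤ μ.colLen m - 1 ∧ x.2 ≤ m
      -- `τ` maps the rectangle northwest of the dot to itself: a point outside is fixed, so by
      -- injectivity it is not the image of a point inside.
      · refine ⟨fun _ => hmem _ ?_, fun _ => hmem _ hx⟩
        by_contra hc
        rw [τ.injective (k2 _ hc)] at hc
        exact hc hx
      · rw [k2 x hx]
    · exact ⟨σ, h1, h2⟩

/-! ### Content under promotion -/

theorem dotted_eq {n : ℕ} {μ : YoungDiagram} (T : SST n μ) {r c : ℕ} (h : (r, c) ∈ μ) {v : ℕ} :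
    dotted n T.1 r c = v ↔ (v = 0 ∧ T.1 r c = n) ∨ (v ≠ 0 ∧ v ≠ n ∧ T.1 r c = v) := by
  have := T.2 r c h
  unfold dotted
  split_ifs <;> omega

theorem pr_apply {n : ℕ} {μ : YoungDiagram} (T : SST n μ) {r c : ℕ} (h : (r, c) ∈ μ) :
    (pr T).1 r c = slideDots n μ T.1 (μ.rowLen 0) r c + 1 := by
  change prFilling n μ T.1 r c = _
  simp [prFilling, h]

theorem count_pr {n : ℕ} {μ : YoungDiagram} (T : SST n μ) (v : ℕ) :
    count (pr T) (v + 1) = (μ.cells.filter fun x => dotted n T.1 x.1 x.2 = v).card := by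
  obtain ⟨σ, h1, h2⟩ := slideDots_perm T (μ.rowLen 0) le_rfl
  refine Finset.card_equiv σ fun x => ?_
  simp only [Finset.mem_filter, μ.mem_cells, ← h2, ← h1]
  refine and_congr_right fun hx => ?_
  rw [pr_apply T hx]
  omega

theorem count_pr_one {n : ℕ} {μ : YoungDiagram} (T : SST n μ) : count (pr T) 1 = count T n := by
  rw [count_pr T 0]
  refine congrArg _ (Finset.filter_congr fun x hx => ?_)
  rw [dotted_eq T ((μ.mem_cells _).1 hx)]
  simp

theorem count_pr_succ {n : ℕ} {μ : YoungDiagram} (T : SST n μ) {v : ℕ} (h1 : 1 ≤ v) (h2 : v < n) :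
    count (pr T) (v + 1) = count T v := by
  rw [count_pr T v]
  refine congrArg _ (Finset.filter_congr fun x hx => ?_)
  rw [dotted_eq T ((μ.mem_cells _).1 hx)]
  omega

theorem count_eq_zero {n : ℕ} {μ : YoungDiagram} (T : SST n μ) {v : ℕ} (h : ¬ (1 ≤ v ∧ v ≤ n)) :
    count T v = 0 := by
  rw [count, Finset.card_eq_zero, Finset.filter_eq_empty_iff]
  rintro ⟨r, c⟩ hx rfl
  exact h (T.2 r c ((μ.mem_cells _).1 hx))

theorem count_ne_zero {n : ℕ} {μ : YoungDiagram} (T : SST n μ) {v : ℕ} :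
    count T v ≠ 0 ↔ ∃ r c, (r, c) ∈ μ ∧ T.1 r c = v := by
  rw [count, Finset.card_ne_zero]
  constructor
  · rintro ⟨⟨r, c⟩, hx⟩
    rw [Finset.mem_filter, μ.mem_cells] at hx
    exact ⟨r, c, hx⟩
  · rintro ⟨r, c, hx⟩
    exact ⟨(r, c), by rwa [Finset.mem_filter, μ.mem_cells]⟩

/-! ### Splitting the content into the first column and the rest -/

/-- The entries of the first column. -/
def col0 {n : ℕ} {μ : YoungDiagram} (T : SST n μ) : Set ℕ := {v | ∃ r, (r, 0) ∈ μ ∧ T.1 r 0 = v}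

/-- The number of entries `v` outside the first column. -/
def restCount {n : ℕ} {μ : YoungDiagram} (T : SST n μ) (v : ℕ) : ℕ :=
  (μ.cells.filter fun x => 1 ≤ x.2 ∧ T.1 x.1 x.2 = v).card

theorem col_injective {n : ℕ} {μ : YoungDiagram} (T : SST n μ) {r r' c : ℕ} (h : (r, c) ∈ μ)
    (h' : (r', c) ∈ μ) (he : T.1 r c = T.1 r' c) : r = r' := by
  rcases lt_trichotomy r r' with hlt | rfl | hlt
  · have := T.1.col_strict hlt h'; omega
  · rfl
  · have := T.1.col_strict hlt h; omega

open Classical in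
theorem count_eq {n : ℕ} {μ : YoungDiagram} (T : SST n μ) (v : ℕ) :
    count T v = (if v ∈ col0 T then 1 else 0) + restCount T v := by
  rw [count, ← Finset.card_filter_add_card_filter_not (p := fun x => x.2 = 0), Finset.filter_filter,
    Finset.filter_filter]
  congr 1
  · split_ifs with h
    · obtain ⟨r, hr, rfl⟩ := h
      rw [Finset.card_eq_one]
      refine ⟨(r, 0), ?_⟩
      ext ⟨a, b⟩
      simp only [Finset.mem_filter, μ.mem_cells, Finset.mem_singleton, Prod.mk.injEq]
      constructor
      · rintro ⟨h1, h2, rfl⟩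
        exact ⟨col_injective T h1 hr h2, rfl⟩
      · rintro ⟨rfl, rfl⟩
        exact ⟨hr, rfl, rfl⟩
    · rw [Finset.card_eq_zero, Finset.filter_eq_empty_iff]
      rintro ⟨a, b⟩ hx ⟨h1, h2⟩
      dsimp only at h1 h2
      subst h2
      exact h ⟨a, (μ.mem_cells _).1 hx, h1⟩
  · refine congrArg _ (Finset.filter_congr fun x _ => ?_)
    constructor
    · rintro ⟨h1, h2⟩; exact ⟨by omega, h1⟩
    · rintro ⟨h1, h2⟩; exact ⟨h2, by omega⟩

theorem count_pos_of_mem {n : ℕ} {μ : YoungDiagram} (T : SST n μ) {v : ℕ} (h : v ∈ col0 T) :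
    count T v ≠ 0 := by
  obtain ⟨r, hr, rfl⟩ := h
  exact (count_ne_zero T).2 ⟨r, 0, hr, rfl⟩

theorem mem_col0_bounds {n : ℕ} {μ : YoungDiagram} (T : SST n μ) {v : ℕ} (h : v ∈ col0 T) :
    1 ≤ v ∧ v ≤ n := by
  obtain ⟨r, hr, rfl⟩ := h
  exact T.2 r 0 hr

/-! ## Tableaux are determined by their first column and their content -/

/-- A strictly increasing finite sequence is determined by its range. -/
theorem col_eq_of_range {n : ℕ} {μ : YoungDiagram} (T T' : SST n μ) (c : ℕ)
    (h : {v | ∃ r, (r, c) ∈ μ ∧ T.1 r c = v} = {v | ∃ r, (r, c) ∈ μ ∧ T'.1 r c = v}) {r : ℕ}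
    (hr : (r, c) ∈ μ) : T.1 r c = T'.1 r c := by
  have hmono : ∀ S : SST n μ, StrictMono fun k : Fin (μ.colLen c) => S.1 k c := fun S a b hab =>
    S.1.col_strict hab (YoungDiagram.mem_iff_lt_colLen.2 b.2)
  have hrange : ∀ S : SST n μ, (Set.range fun k : Fin (μ.colLen c) => S.1 k c) =
      {v | ∃ r, (r, c) ∈ μ ∧ S.1 r c = v} := by
    intro S
    ext v
    simp only [Set.mem_range, Set.mem_ofPred_eq, YoungDiagram.mem_iff_lt_colLen]
    exact ⟨fun ⟨k, hk⟩ => ⟨k, k.2, hk⟩, fun ⟨k, hk, h⟩ => ⟨⟨k, hk⟩, h⟩⟩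
  have := (StrictMono.range_inj (hmono T) (hmono T')).1 (by rw [hrange, hrange, h])
  exact congrFun this ⟨r, YoungDiagram.mem_iff_lt_colLen.1 hr⟩

theorem SST.ext' {n : ℕ} {μ : YoungDiagram} {T T' : SST n μ}
    (h : ∀ r c, (r, c) ∈ μ → T.1 r c = T'.1 r c) : T = T' := by
  refine Subtype.ext (SemistandardYoungTableau.ext fun r c => ?_)
  by_cases hm : (r, c) ∈ μ
  · exact h r c hm
  · rw [T.1.zeros hm, T'.1.zeros hm]

theorem restCount_congr {n : ℕ} {μ : YoungDiagram} {T T' : SST n μ} (hA : col0 T = col0 T')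
    (hc : ∀ v, count T v = count T' v) (v : ℕ) : restCount T v = restCount T' v := by
  have := hc v
  rw [count_eq, count_eq, hA] at this
  omega

theorem IsTwoColumn.col_lt {μ : YoungDiagram} (h : IsTwoColumn μ) {r c : ℕ} (hm : (r, c) ∈ μ) :
    c < 2 := by
  rw [← h]
  exact YoungDiagram.mem_iff_lt_rowLen.1 (μ.up_left_mem (Nat.zero_le r) le_rfl hm)

theorem IsHook.eq_zero {μ : YoungDiagram} (h : IsHook μ) {r c : ℕ} (hm : (r, c) ∈ μ) (hr : 1 ≤ r) :
    c = 0 := by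
  have := YoungDiagram.mem_iff_lt_rowLen.1 hm
  have := h r hr
  omega

theorem IsTwoColumn.restCount_ne_zero {n : ℕ} {μ : YoungDiagram} (h : IsTwoColumn μ) (T : SST n μ)
    (v : ℕ) : restCount T v ≠ 0 ↔ ∃ r, (r, 1) ∈ μ ∧ T.1 r 1 = v := by
  rw [restCount, Finset.card_ne_zero]
  constructor
  · rintro ⟨⟨r, c⟩, hx⟩
    simp only [Finset.mem_filter, μ.mem_cells] at hx
    obtain rfl : c = 1 := by have := h.col_lt hx.1; omega
    exact ⟨r, hx.1, hx.2.2⟩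
  · rintro ⟨r, hx, rfl⟩
    exact ⟨(r, 1), by simpa using hx⟩

theorem IsTwoColumn.restCount_le_one {n : ℕ} {μ : YoungDiagram} (h : IsTwoColumn μ) (T : SST n μ)
    (v : ℕ) : restCount T v ≤ 1 := by
  rw [restCount, Finset.card_le_one]
  rintro ⟨a, b⟩ hx ⟨c, d⟩ hy
  simp only [Finset.mem_filter, μ.mem_cells] at hx hy
  obtain rfl : b = 1 := by have := h.col_lt hx.1; omega
  obtain rfl : d = 1 := by have := h.col_lt hy.1; omega
  rw [col_injective T hx.1 hy.1 (hx.2.2.trans hy.2.2.symm)]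

theorem IsTwoColumn.ext {n : ℕ} {μ : YoungDiagram} (h : IsTwoColumn μ) {T T' : SST n μ}
    (hA : col0 T = col0 T') (hc : ∀ v, count T v = count T' v) : T = T' := by
  refine SST.ext' fun r c hm => ?_
  refine col_eq_of_range T T' c ?_ hm
  obtain rfl | rfl : c = 0 ∨ c = 1 := by have := h.col_lt hm; omega
  · exact hA
  · ext v
    have := restCount_congr hA hc v
    rw [Set.mem_ofPred_eq, Set.mem_ofPred_eq, ← h.restCount_ne_zero, ← h.restCount_ne_zero, this]

theorem IsHook.ext {n : ℕ} {μ : YoungDiagram} (h : IsHook μ) {T T' : SST n μ}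
    (hA : col0 T = col0 T') (hc : ∀ v, count T v = count T' v) : T = T' := by
  refine SST.ext' fun r c hm => ?_
  rcases c with _ | c
  · exact col_eq_of_range T T' 0 hA hm
  obtain rfl : r = 0 := by
    by_contra hr
    have := h.eq_zero hm (by omega)
    omega
  -- The arm without the corner, as a list: its multiplicities are the `restCount`s and it is
  -- sorted, so it is determined by them.
  have hcount : ∀ (S : SST n μ) v,
      ((List.range (μ.rowLen 0 - 1)).map fun k => S.1 0 (k + 1)).count v = restCount S v := by
    intro S v
    rw [List.count, List.countP_map, restCount]
    have hfilter : ∀ (p : ℕ → Bool) k,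
        (List.range k).countP p = ((Finset.range k).filter fun x => p x = true).card := by
      intro p k
      rw [List.countP_eq_length_filter]
      exact congrArg List.length (List.filter_congr fun x _ => by simp)
    rw [hfilter]
    refine Finset.card_nbij (fun k => (0, k + 1)) ?_ ?_ ?_
    · intro k hk
      simp only [Finset.coe_filter, Finset.mem_range, Function.comp, beq_iff_eq,
        Set.mem_ofPred_eq] at hk
      rw [Finset.mem_coe, Finset.mem_filter, μ.mem_cells, YoungDiagram.mem_iff_lt_rowLen]
      exact ⟨by omega, by simp, hk.2⟩
    · intro a _ b _ hab
      simpa using hab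
    · rintro ⟨a, b⟩ hx
      simp only [Finset.coe_filter, Set.mem_ofPred_eq, μ.mem_cells] at hx
      obtain rfl : a = 0 := by
        by_contra hr
        have := h.eq_zero hx.1 (by omega)
        omega
      have := YoungDiagram.mem_iff_lt_rowLen.1 hx.1
      refine ⟨b - 1, ?_, by simp; omega⟩
      simp only [Finset.coe_filter, Finset.mem_range, Function.comp, beq_iff_eq,
        Set.mem_ofPred_eq]
      rw [Nat.sub_add_cancel hx.2.1]
      exact ⟨by omega, hx.2.2⟩
  have hsorted : ∀ S : SST n μ,
      ((List.range (μ.rowLen 0 - 1)).map fun k => S.1 0 (k + 1)).Pairwise (· ≤ ·) := by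
    intro S
    rw [List.pairwise_map]
    refine List.Pairwise.imp_of_mem ?_ List.pairwise_lt_range
    intro a b _ hb hab
    rw [List.mem_range] at hb
    exact S.1.row_weak (by omega) (YoungDiagram.mem_iff_lt_rowLen.2 (by omega))
  have heq := List.Perm.eq_of_pairwise (fun a b _ _ h1 h2 => le_antisymm h1 h2) (hsorted T)
    (hsorted T') (List.perm_iff_count.2 fun v => by rw [hcount, hcount, restCount_congr hA hc])
  have hlt := YoungDiagram.mem_iff_lt_rowLen.1 hm
  exact List.map_inj_left.1 heq c (List.mem_range.2 (by omega))

/-! ## The first column under promotion -/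

theorem slide_perm_col (r : ℕ) : ∀ G : ℕ → ℕ → ℕ, G r 0 = 0 →
    ∃ σ : Equiv.Perm ℕ, (∀ a, slide G r 0 a 0 = G (σ a) 0) ∧ ∀ a, r < a → σ a = a := by
  induction r with
  | zero =>
    exact fun G _ => ⟨1, fun a => by
      rw [slide_stop (G := G) (r := 0) (c := 0) (if_pos rfl) (if_pos rfl)]; rfl, fun _ _ => rfl⟩
  | succ r ih =>
    intro G h0
    rcases slide_cases G (r + 1) 0 with ⟨h1, h2⟩ | ⟨r', hr, h1, h2⟩ | ⟨c', hc, -⟩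
    · exact ⟨1, fun a => by rw [slide_stop h1 h2]; rfl, fun _ _ => rfl⟩
    · obtain rfl : r = r' := by omega
      obtain ⟨σ, k1, k2⟩ := ih (setCell (setCell G (r + 1) 0 (G r 0)) r 0 0) (by simp [setCell])
      refine ⟨σ.trans (Equiv.swap (r + 1) r), fun a => ?_, fun a ha => ?_⟩
      · rw [slide_up h1 h2, k1, Equiv.trans_apply, Equiv.swap_apply_def]
        simp only [setCell]
        split_ifs <;> simp_all
      · rw [Equiv.trans_apply, k2 a (by omega)]
        exact Equiv.swap_apply_of_ne_of_ne (by omega) (by omega)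
    · omega

/-- A dot starting in the second column either stays there, and then it stops next to a dot already
present in the first column, or it crosses once, in the row `r0`, because the upper neighbour, if
there is one, is smaller than the left one. After crossing it only moves within the first column. Up
to order, the first column thus trades its entry in row `r0` for a dot. -/
theorem slide_col_one (r : ℕ) : ∀ G : ℕ → ℕ → ℕ, G r 1 = 0 →
    ((∀ a, slide G r 1 a 0 = G a 0) ∧ ∃ r0 ≤ r, G r0 0 = 0) ∨
    ∃ r0 ≤ r, (r0 = 0 ∨ G (r0 - 1) 1 < G r0 0) ∧ G r0 0 ≠ 0 ∧
      ∃ σ : Equiv.Perm ℕ, (∀ a, slide G r 1 a 0 = if σ a = r0 then 0 else G (σ a) 0) ∧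
        ∀ a, r < a → σ a = a := by
  induction r with
  | zero =>
    intro G h0
    rcases slide_cases G 0 1 with ⟨h1, h2⟩ | ⟨r', hr, h1, h2⟩ | ⟨c', hc, h1⟩
    · exact Or.inl ⟨fun a => by rw [slide_stop h1 h2], 0, le_rfl, by simpa using h2⟩
    · omega
    · obtain rfl : c' = 0 := by omega
      right
      obtain ⟨σ, k1, k2⟩ := slide_perm_col 0 (setCell (setCell G 0 1 (G 0 0)) 0 0 0)
        (by simp [setCell])
      refine ⟨0, le_rfl, Or.inl rfl, by omega, σ, fun a => ?_, k2⟩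
      rw [slide_left h1, k1]
      simp [setCell]
  | succ r ih =>
    intro G h0
    rcases slide_cases G (r + 1) 1 with ⟨h1, h2⟩ | ⟨r', hr, h1, h2⟩ | ⟨c', hc, h1⟩
    · exact Or.inl ⟨fun a => by rw [slide_stop h1 h2], r + 1, le_rfl, by simpa using h2⟩
    · obtain rfl : r = r' := by omega
      rw [slide_up h1 h2]
      have g0 : ∀ a, setCell (setCell G (r + 1) 1 (G r 1)) r 1 0 a 0 = G a 0 := by
        intro a; simp [setCell]
      have g1 : ∀ a < r, setCell (setCell G (r + 1) 1 (G r 1)) r 1 0 a 1 = G a 1 := by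
        intro a ha
        have : ¬ a = r := by omega
        have : ¬ a = r + 1 := by omega
        simp [setCell, *]
      rcases ih (setCell (setCell G (r + 1) 1 (G r 1)) r 1 0) (by simp [setCell]) with
        ⟨k1, r0, k2, k3⟩ | ⟨r0, k1, k2, k3, σ, k4, k5⟩
      · exact Or.inl ⟨fun a => by rw [k1, g0], r0, by omega, by rwa [g0] at k3⟩
      · refine Or.inr ⟨r0, by omega, ?_, by rwa [g0] at k3, σ, fun a => by rw [k4, g0],
          fun a ha => k5 a (by omega)⟩
        rcases Nat.eq_zero_or_pos r0 with h | h
        · exact Or.inl h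
        · rw [g0, g1 _ (by omega)] at k2
          exact k2
    · obtain rfl : c' = 0 := by omega
      right
      obtain ⟨σ, k1, k2⟩ := slide_perm_col (r + 1)
        (setCell (setCell G (r + 1) 1 (G (r + 1) 0)) (r + 1) 0 0) (by simp [setCell])
      refine ⟨r + 1, le_rfl, Or.inr (by simpa using h1), by omega, σ, fun a => ?_, k2⟩
      rw [slide_left h1, k1]
      simp [setCell]

/-! ### From slides to the entries of the promoted first column -/

theorem mem_col0_pr {n : ℕ} {μ : YoungDiagram} (T : SST n μ) {v : ℕ} :
    v + 1 ∈ col0 (pr T) ↔ ∃ r, (r, 0) ∈ μ ∧ slideDots n μ T.1 (μ.rowLen 0) r 0 = v := by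
  refine exists_congr fun r => and_congr_right fun h => ?_
  rw [pr_apply T h]
  omega

theorem exists_dotted_col {n : ℕ} {μ : YoungDiagram} (T : SST n μ) {v : ℕ} :
    (∃ r, (r, 0) ∈ μ ∧ dotted n T.1 r 0 = v) ↔
      (v = 0 ∧ n ∈ col0 T) ∨ (v ≠ 0 ∧ v ≠ n ∧ v ∈ col0 T) := by
  constructor
  · rintro ⟨r, h, hv⟩
    rw [dotted_eq T h] at hv
    exact hv.imp (fun k => ⟨k.1, r, h, k.2⟩) fun k => ⟨k.1, k.2.1, r, h, k.2.2⟩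
  · rintro (⟨h1, r, h, h2⟩ | ⟨h1, h2, r, h, h3⟩)
    · exact ⟨r, h, (dotted_eq T h).2 (Or.inl ⟨h1, h2⟩)⟩
    · exact ⟨r, h, (dotted_eq T h).2 (Or.inr ⟨h1, h2, h3⟩)⟩

/-- Converts the permutations supplied by the slide lemmas into equalities of sets of entries: a
permutation fixing all rows below a row of the first column preserves that column. -/
theorem exists_col_congr {μ : YoungDiagram} {P : ℕ → Prop} {r : ℕ} (hr : (r, 0) ∈ μ)
    {σ : Equiv.Perm ℕ} (hσ : ∀ a, r < a → σ a = a) :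
    (∃ a, (a, 0) ∈ μ ∧ P (σ a)) ↔ ∃ a, (a, 0) ∈ μ ∧ P a := by
  have hmem : ∀ a, (a, 0) ∈ μ → (σ a, 0) ∈ μ := by
    intro a ha
    by_cases h : σ a ≤ r
    · exact μ.up_left_mem h le_rfl hr
    · rw [σ.injective (hσ (σ a) (by omega))]
      exact ha
  have hmem' : ∀ a, (σ a, 0) ∈ μ → (a, 0) ∈ μ := by
    intro a ha
    by_cases h : a ≤ r
    · exact μ.up_left_mem h le_rfl hr
    · rwa [hσ a (by omega)] at ha
  constructor
  · rintro ⟨a, h1, h2⟩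
    exact ⟨σ a, hmem a h1, h2⟩
  · rintro ⟨a, h1, h2⟩
    exact ⟨σ.symm a, hmem' _ (by simpa using h1), by simpa using h2⟩

theorem exists_slideDots_one {n : ℕ} {μ : YoungDiagram} (T : SST n μ) (hL : 0 < μ.rowLen 0) {v : ℕ} :
    (∃ r, (r, 0) ∈ μ ∧ slideDots n μ T.1 1 r 0 = v) ↔ ∃ r, (r, 0) ∈ μ ∧ dotted n T.1 r 0 = v := by
  rw [slideDots]
  split_ifs with h
  · obtain ⟨σ, h1, h2⟩ := slide_perm_col _ _ (slideDots_dot T hL h)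
    simp only [h1]
    exact exists_col_congr (P := fun r => slideDots n μ T.1 0 r 0 = v) (lowest_mem hL) h2
  · rfl

theorem slideDots_one {n : ℕ} {μ : YoungDiagram} (T : SST n μ) (hL : 0 < μ.rowLen 0)
    (h : n ∉ col0 T) : slideDots n μ T.1 1 = dotted n T.1 := by
  rw [slideDots, if_neg]
  · rfl
  · exact fun h' => h ⟨_, lowest_mem hL, h'⟩

theorem slideDots_of_count_eq_zero {n : ℕ} {μ : YoungDiagram} (T : SST n μ) (h : count T n = 0) :
    ∀ m, m ≤ μ.rowLen 0 → slideDots n μ T.1 m = dotted n T.1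
  | 0, _ => rfl
  | m + 1, hm => by
    rw [slideDots, if_neg, slideDots_of_count_eq_zero T h m (by omega)]
    exact fun h' => (count_ne_zero T).2 ⟨_, _, lowest_mem hm, h'⟩ h

theorem corner_eq_one {n : ℕ} {μ : YoungDiagram} (T : SST n μ) (h : count T 1 ≠ 0) :
    (0, 0) ∈ μ ∧ T.1 0 0 = 1 := by
  obtain ⟨r, c, hm, h1⟩ := (count_ne_zero T).1 h
  have hm0 : (0, c) ∈ μ := μ.up_left_mem (Nat.zero_le r) le_rfl hm
  have h00 : (0, 0) ∈ μ := μ.up_left_mem le_rfl (Nat.zero_le c) hm0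
  have h2 := T.1.col_weak (Nat.zero_le r) hm
  have h3 := T.1.row_weak_of_le (Nat.zero_le c) hm0
  have h4 := (T.2 _ _ h00).1
  exact ⟨h00, by omega⟩

theorem corner_le {n : ℕ} {μ : YoungDiagram} (T : SST n μ) {v : ℕ} (h : count T v ≠ 0) :
    T.1 0 0 ∈ col0 T ∧ T.1 0 0 ≤ v := by
  obtain ⟨r, c, hm, rfl⟩ := (count_ne_zero T).1 h
  have hm0 : (0, c) ∈ μ := μ.up_left_mem (Nat.zero_le r) le_rfl hm
  have h2 := T.1.col_weak (Nat.zero_le r) hm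
  have h3 := T.1.row_weak_of_le (Nat.zero_le c) hm0
  exact ⟨⟨0, μ.up_left_mem le_rfl (Nat.zero_le c) hm0, rfl⟩, by omega⟩

theorem col0_pr_of_count_eq_zero {n : ℕ} {μ : YoungDiagram} (T : SST n μ) (h : count T n = 0)
    {v : ℕ} : v + 1 ∈ col0 (pr T) ↔ v ≠ 0 ∧ v ≠ n ∧ v ∈ col0 T := by
  rw [mem_col0_pr, slideDots_of_count_eq_zero T h _ le_rfl, exists_dotted_col]
  have : n ∉ col0 T := fun h' => count_pos_of_mem T h' h
  tauto

theorem rowLen_pos_of_mem {n : ℕ} {μ : YoungDiagram} {T : SST n μ} {v : ℕ} (h : count T v ≠ 0) :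
    0 < μ.rowLen 0 := by
  obtain ⟨r, c, hm, -⟩ := (count_ne_zero T).1 h
  have := YoungDiagram.mem_iff_lt_rowLen.1 (μ.up_left_mem (Nat.zero_le r) le_rfl hm)
  omega

/-- The resting place of a dot is read off from the result instead of from the paths: `pr T` is
semistandard and contains a `1` as soon as `T` contains an `n`, and a `1` forces the corner to be
`1`. -/
theorem slideDots_corner {n : ℕ} {μ : YoungDiagram} (T : SST n μ) (h : count T n ≠ 0) :
    (0, 0) ∈ μ ∧ slideDots n μ T.1 (μ.rowLen 0) 0 0 = 0 := by
  obtain ⟨h1, h2⟩ := corner_eq_one (pr T) (by rwa [count_pr_one])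
  rw [pr_apply T h1] at h2
  exact ⟨h1, by omega⟩

/-- Two dots left in the first column would give two entries `1` in one column of `pr T`. -/
theorem slideDots_ne_zero {n : ℕ} {μ : YoungDiagram} (T : SST n μ) {r r' : ℕ} (h : (r, 0) ∈ μ)
    (h' : (r', 0) ∈ μ) (hr : slideDots n μ T.1 (μ.rowLen 0) r 0 = 0)
    (hr' : slideDots n μ T.1 (μ.rowLen 0) r' 0 = 0) : r = r' :=
  col_injective (pr T) h h' (by rw [pr_apply T h, pr_apply T h', hr, hr'])

/-! ### Hooks -/

/-- In a hook all columns after the first have one box, so the later dots start in the top row, and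
a slide only permutes boxes weakly northwest of its start. -/
theorem IsHook.slideDots_arm {n : ℕ} {μ : YoungDiagram} (hμ : IsHook μ) (T : SST n μ) {a b : ℕ}
    (ha : 1 ≤ a) : ∀ m, 1 ≤ m → m ≤ μ.rowLen 0 → slideDots n μ T.1 m a b = slideDots n μ T.1 1 a b
  | 0, h, _ => by omega
  | 1, _, _ => rfl
  | m + 2, _, hm => by
    rw [← hμ.slideDots_arm T ha (m + 1) (by omega) (by omega), slideDots]
    split_ifs with h
    · have hz : μ.colLen (m + 1) - 1 = 0 := by
        by_contra hne
        have := hμ.eq_zero (lowest_mem hm) (by omega)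
        omega
      have h0 := slideDots_dot T hm h
      rw [hz] at h0 ⊢
      obtain ⟨σ, h1, h2⟩ := slide_perm _ _ _ _ rfl h0
      rw [h1 (a, b), h2 _ (by simp; omega)]
    · rfl

theorem IsHook.col0_pr_of_mem {n : ℕ} {μ : YoungDiagram} (hμ : IsHook μ) (T : SST n μ)
    (h : n ∈ col0 T) {v : ℕ} :
    v + 1 ∈ col0 (pr T) ↔ v = 0 ∨ (v ≠ n ∧ v ∈ col0 T) := by
  have hc := count_pos_of_mem T h
  have hL := rowLen_pos_of_mem hc
  obtain ⟨hm, h0⟩ := slideDots_corner T hc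
  -- The first dot reaches the corner: a dot resting lower in the leg would never move again, and
  -- together with the one in the corner it would make two dots in the column.
  have h1 : slideDots n μ T.1 1 0 0 = 0 := by
    obtain ⟨r, hr, h2⟩ := (exists_slideDots_one T hL).2 ((exists_dotted_col T).2 (Or.inl ⟨rfl, h⟩))
    rcases Nat.eq_zero_or_pos r with rfl | hpos
    · exact h2
    · rw [← hμ.slideDots_arm T hpos _ hL le_rfl] at h2
      have := slideDots_ne_zero T hr hm h2 h0
      omega
  have heq : ∀ r, slideDots n μ T.1 (μ.rowLen 0) r 0 = slideDots n μ T.1 1 r 0 := by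
    intro r
    rcases Nat.eq_zero_or_pos r with rfl | hpos
    · rw [h0, h1]
    · exact hμ.slideDots_arm T hpos _ hL le_rfl
  simp only [mem_col0_pr, heq]
  rw [exists_slideDots_one T hL, exists_dotted_col]
  have : v ∈ col0 T → v ≠ 0 := fun h => by have := (mem_col0_bounds T h).1; omega
  tauto

/-- No dot starts in the first column, so the leg below the corner is untouched; as a dot ends in
the corner, it is the corner entry that leaves the column. -/
theorem IsHook.col0_pr_of_notMem {n : ℕ} {μ : YoungDiagram} (hμ : IsHook μ) (T : SST n μ)
    (h : n ∉ col0 T) (hc : count T n ≠ 0) {v : ℕ} :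
    v + 1 ∈ col0 (pr T) ↔ v = 0 ∨ (v ∈ col0 T ∧ v ≠ T.1 0 0) := by
  have hL := rowLen_pos_of_mem hc
  obtain ⟨hm, h0⟩ := slideDots_corner T hc
  have heq : ∀ r, 1 ≤ r → (r, 0) ∈ μ → slideDots n μ T.1 (μ.rowLen 0) r 0 = T.1 r 0 := by
    intro r hr hrm
    rw [hμ.slideDots_arm T hr _ hL le_rfl, slideDots_one T hL h]
    unfold dotted
    rw [if_neg fun h' => h ⟨r, hrm, h'⟩]
  rw [mem_col0_pr]
  constructor
  · rintro ⟨r, hr, rfl⟩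
    rcases Nat.eq_zero_or_pos r with rfl | hpos
    · exact Or.inl h0
    · right
      rw [heq r hpos hr]
      refine ⟨⟨r, hr, rfl⟩, fun h' => ?_⟩
      have := col_injective T hr hm h'
      omega
  · rintro (rfl | ⟨⟨r, hr, rfl⟩, h2⟩)
    · exact ⟨0, hm, h0⟩
    · have hpos : 1 ≤ r := by
        by_contra hz
        obtain rfl : r = 0 := by omega
        exact h2 rfl
      exact ⟨r, hr, heq r hpos hr⟩

/-! ### Two columns -/

theorem IsTwoColumn.col0_pr_of_mem {n : ℕ} {μ : YoungDiagram} (hμ : IsTwoColumn μ) (T : SST n μ)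
    (h : n ∈ col0 T) {v : ℕ} :
    v + 1 ∈ col0 (pr T) ↔ v = 0 ∨ (v ≠ n ∧ v ∈ col0 T) := by
  have hμ' : μ.rowLen 0 = 2 := hμ
  have hL : 0 < μ.rowLen 0 := by omega
  obtain ⟨r1, hr1, hz⟩ := (exists_slideDots_one T hL).2
    ((exists_dotted_col T).2 (Or.inl ⟨rfl, h⟩))
  have heq : ∀ r, slideDots n μ T.1 (μ.rowLen 0) r 0 = slideDots n μ T.1 1 r 0 := by
    have hinj := fun r r' => slideDots_ne_zero T (r := r) (r' := r')
    rw [hμ', slideDots] at hinj ⊢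
    split_ifs at hinj ⊢ with h1
    · have hd := slideDots_dot T (by omega) h1
      have hlow := μ.up_left_mem le_rfl (Nat.zero_le 1) (lowest_mem (μ := μ) (m := 1) (by omega))
      rcases slide_col_one _ _ hd with ⟨k1, -⟩ | ⟨r0, k1, -, k3, σ, k4, k5⟩
      · exact k1
      -- If the second dot crossed, the first column would end up with two dots: the one that
      -- entered and the one already at `r1`.
      · exfalso
        have hmem : ∀ a, (σ a, 0) ∈ μ → (a, 0) ∈ μ := by
          intro a ha
          by_cases hle : a ≤ μ.colLen 1 - 1
          · exact μ.up_left_mem hle le_rfl hlow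
          · rwa [k5 a (by omega)] at ha
        have := hinj (σ.symm r0) (σ.symm r1)
          (hmem _ (by rw [Equiv.apply_symm_apply]; exact μ.up_left_mem k1 le_rfl hlow))
          (hmem _ (by rwa [Equiv.apply_symm_apply]))
          (by rw [k4, Equiv.apply_symm_apply, if_pos rfl])
          (by rw [k4, Equiv.apply_symm_apply, hz, ite_self])
        rw [σ.symm.injective this] at k3
        exact k3 hz
    · exact fun _ => rfl
  simp only [mem_col0_pr, heq]
  rw [exists_slideDots_one T hL, exists_dotted_col]
  have : v ∈ col0 T → v ≠ 0 := fun h => by have := (mem_col0_bounds T h).1; omega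
  tauto

/-- The row `r0` is the one in which the dot crosses. The inequality against the second column above
`r0` records why it crosses there; it serves later to locate the expelled entry by heights. -/
theorem IsTwoColumn.exists_col0_pr {n : ℕ} {μ : YoungDiagram} (hμ : IsTwoColumn μ) (T : SST n μ)
    (h : n ∉ col0 T) (hc : count T n ≠ 0) :
    ∃ r0, (r0, 0) ∈ μ ∧ (∀ r < r0, (r, 1) ∈ μ ∧ T.1 r 1 < T.1 r0 0) ∧
      ∀ v, v + 1 ∈ col0 (pr T) ↔ v = 0 ∨ (v ∈ col0 T ∧ v ≠ T.1 r0 0) := by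
  have hμ' : μ.rowLen 0 = 2 := hμ
  have hL : 0 < μ.rowLen 0 := by omega
  have hd0 : ∀ r, (r, 0) ∈ μ → dotted n T.1 r 0 = T.1 r 0 := by
    intro r hr
    unfold dotted
    rw [if_neg fun h' => h ⟨r, hr, h'⟩]
  obtain ⟨r1, hr1, hn1⟩ : ∃ r, (r, 1) ∈ μ ∧ T.1 r 1 = n := by
    obtain ⟨r, c, hm, hv⟩ := (count_ne_zero T).1 hc
    have := hμ.col_lt hm
    obtain rfl | rfl : c = 0 ∨ c = 1 := by omega
    · exact absurd ⟨r, hm, hv⟩ h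
    · exact ⟨r, hm, hv⟩
  have hlow := lowest_mem (μ := μ) (m := 1) (by omega)
  have hlow0 := μ.up_left_mem le_rfl (Nat.zero_le 1) hlow
  have hlast : T.1 (μ.colLen 1 - 1) 1 = n := by
    have h1 := YoungDiagram.mem_iff_lt_colLen.1 hr1
    have h2 := T.1.col_weak (show r1 ≤ μ.colLen 1 - 1 by omega) hlow
    have h3 := (T.2 _ _ hlow).2
    omega
  have hd := slideDots_dot T (by omega) hlast
  have hD : slideDots n μ T.1 (μ.rowLen 0) = slide (dotted n T.1) (μ.colLen 1 - 1) 1 := by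
    rw [hμ', slideDots, if_pos hlast, slideDots_one T hL h]
  rw [slideDots_one T hL h] at hd
  rcases slide_col_one _ _ hd with ⟨-, r0, k2, k3⟩ | ⟨r0, k1, k2, -, σ, k4, k5⟩
  -- Staying in the second column would need a dot in the first one, but there is no `n` there.
  · have hr0 := μ.up_left_mem k2 le_rfl hlow0
    rw [hd0 r0 hr0] at k3
    have := T.2 _ _ hr0
    omega
  · have hr0 := μ.up_left_mem k1 le_rfl hlow0
    refine ⟨r0, hr0, fun r hr => ?_, fun v => ?_⟩
    · have hr01 := μ.up_left_mem (show r0 - 1 ≤ _ by omega) le_rfl hlow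
      have h2 := T.1.col_strict (show r0 - 1 < μ.colLen 1 - 1 by omega) hlow
      have h3 := T.1.col_weak (show r ≤ r0 - 1 by omega) hr01
      rw [hd0 r0 hr0, dotted, if_neg (by omega)] at k2
      exact ⟨μ.up_left_mem (show r ≤ r0 - 1 by omega) le_rfl hr01, by omega⟩
    · simp only [mem_col0_pr, hD, k4]
      rw [exists_col_congr (P := fun a => (if a = r0 then 0 else dotted n T.1 a 0) = v) hlow0 k5]
      constructor
      · rintro ⟨a, ha, hv⟩
        split_ifs at hv with h1
        · exact Or.inl hv.symm
        · rw [hd0 a ha] at hv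
          exact Or.inr ⟨⟨a, ha, hv⟩, fun h' => h1 (col_injective T ha hr0 (hv.trans h'))⟩
      · rintro (rfl | ⟨⟨a, ha, rfl⟩, h2⟩)
        · exact ⟨r0, hr0, if_pos rfl⟩
        · exact ⟨a, ha, by rw [if_neg (by rintro rfl; exact h2 rfl), hd0 a ha]⟩

/-! ## The operators `s̃ i` on content and first column -/

theorem count_update {n : ℕ} {μ : YoungDiagram} {T T' : SST n μ} {r c w : ℕ} (hm : (r, c) ∈ μ)
    (h : ∀ a b, T'.1 a b = if a = r ∧ b = c then w else T.1 a b) (v : ℕ) :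
    count T' v + (if T.1 r c = v then 1 else 0) = count T v + if w = v then 1 else 0 := by
  have hmem : (r, c) ∈ μ.cells := (μ.mem_cells _).2 hm
  have key : ∀ S : SST n μ, count S v = (if S.1 r c = v then 1 else 0) +
      ∑ x ∈ μ.cells.erase (r, c), if S.1 x.1 x.2 = v then 1 else 0 := by
    intro S
    rw [count, Finset.card_filter, ← Finset.add_sum_erase _ _ hmem]
  have hrest : ∑ x ∈ μ.cells.erase (r, c), (if T'.1 x.1 x.2 = v then 1 else 0) =
      ∑ x ∈ μ.cells.erase (r, c), if T.1 x.1 x.2 = v then 1 else 0 := by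
    refine Finset.sum_congr rfl fun x hx => ?_
    have : ¬ (x.1 = r ∧ x.2 = c) := fun h' => (Finset.mem_erase.1 hx).1 (Prod.ext h'.1 h'.2)
    rw [h, if_neg this]
  have hw : T'.1 r c = w := by rw [h, if_pos ⟨rfl, rfl⟩]
  rw [key, key, hrest, hw]
  ring

theorem f_spec {n : ℕ} {μ : YoungDiagram} {i : Index n} {T T' : SST n μ} (h : f i T = some T') :
    ∃ r c, IsLoweringBox μ T.1 i (r, c) ∧ (r, c) ∈ μ ∧ T.1 r c = i ∧
      ∀ a b, T'.1 a b = if a = r ∧ b = c then (i : ℕ) + 1 else T.1 a b := by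
  unfold f at h
  split_ifs at h with hex
  obtain rfl := Option.some.inj h
  have hb := hex.choose_spec
  exact ⟨hex.choose.1, hex.choose.2, hb, (μ.mem_cells _).1 hb.1, (lowering_facts T hb).1,
    fun _ _ => rfl⟩

theorem e_spec {n : ℕ} {μ : YoungDiagram} {i : Index n} {T T' : SST n μ} (h : e i T = some T') :
    ∃ r c, IsRaisingBox μ T.1 i (r, c) ∧ (r, c) ∈ μ ∧ T.1 r c = i + 1 ∧
      ∀ a b, T'.1 a b = if a = r ∧ b = c then (i : ℕ) else T.1 a b := by
  unfold e at h
  split_ifs at h with hex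
  obtain rfl := Option.some.inj h
  have hb := hex.choose_spec
  exact ⟨hex.choose.1, hex.choose.2, hb, (μ.mem_cells _).1 hb.1, (raising_facts T hb).1,
    fun _ _ => rfl⟩

/-! ### Invariants along powers of crystal operators -/

/-- The index of `P` counts the applications still to be made. An invariant may therefore refer to
the remaining exponent, and is read off at `0`. -/
theorem iter_induct {B : Type} (g : B → Option B) (P : ℕ → B → Prop)
    (hstep : ∀ k b b', g b = some b' → P (k + 1) b → P k b') :
    ∀ k b b', iter g k b = some b' → P k b → P 0 b'
  | 0, b, b', h, hP => by
    obtain rfl := Option.some.inj h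
    exact hP
  | k + 1, b, b', h, hP => by
    rw [iter, Option.bind_eq_some_iff] at h
    obtain ⟨b1, h1, h2⟩ := h
    exact iter_induct g P hstep k b1 b' h2 (hstep k b b1 h1 hP)

theorem s_induct_f {n : ℕ} {μ : YoungDiagram} {i : Index n} {T : SST n μ} (h : 0 ≤ pairing i T)
    (P : ℕ → SST n μ → Prop) (h0 : P (pairing i T).toNat T)
    (hstep : ∀ k S S', f i S = some S' → P (k + 1) S → P k S') : P 0 (s i T) := by
  rw [s, dif_pos h]
  exact iter_induct (f i) P hstep _ T _ (Option.some_get _).symm h0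

theorem s_induct_e {n : ℕ} {μ : YoungDiagram} {i : Index n} {T : SST n μ} (h : ¬ 0 ≤ pairing i T)
    (P : ℕ → SST n μ → Prop) (h0 : P (-pairing i T).toNat T)
    (hstep : ∀ k S S', e i S = some S' → P (k + 1) S → P k S') : P 0 (s i T) := by
  rw [s, dif_neg h]
  exact iter_induct (e i) P hstep _ T _ (Option.some_get _).symm h0

/-- `S` arises from `T` by changing entries within `{i, i + 1}`. -/
def SameOutside {n : ℕ} {μ : YoungDiagram} (i : ℕ) (T S : SST n μ) : Prop :=
  ∀ r c, T.1 r c = S.1 r c ∨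
    ((T.1 r c = i ∨ T.1 r c = i + 1) ∧ (S.1 r c = i ∨ S.1 r c = i + 1))

theorem s_spec {n : ℕ} {μ : YoungDiagram} (i : Index n) (T : SST n μ) :
    SameOutside i T (s i T) ∧ count (s i T) i = count T (i + 1) ∧
      count (s i T) (i + 1) = count T i ∧
        ∀ v : ℕ, v ≠ i → v ≠ i + 1 → count (s i T) v = count T v := by
  by_cases h : 0 ≤ pairing i T
  -- While `k` applications remain, `S` has `k` letters `i` too many and `k` letters `i + 1` too few
  -- compared with the exchanged content.
  · have := s_induct_f h (fun k S => SameOutside i T S ∧ count S i = count T (i + 1) + k ∧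
      count S (i + 1) + k = count T i ∧ ∀ v : ℕ, v ≠ i → v ≠ i + 1 → count S v = count T v)
      (by
        refine ⟨fun _ _ => Or.inl rfl, ?_, ?_, fun _ _ _ => rfl⟩ <;> unfold pairing at * <;> omega)
      (by
        rintro k S S' hS ⟨h1, h2, h3, h4⟩
        obtain ⟨r, c, -, hm, hi, hu⟩ := f_spec hS
        have hc := count_update hm hu
        refine ⟨fun a b => ?_, ?_, ?_, fun v hv hv' => ?_⟩
        · have := h1 a b
          rw [hu]
          split_ifs with hab
          · obtain ⟨rfl, rfl⟩ := hab
            omega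
          · exact this
        · have := hc i
          rw [if_pos hi, if_neg (by omega)] at this
          omega
        · have := hc (i + 1)
          rw [if_pos rfl, if_neg (by omega)] at this
          omega
        · have := hc v
          rw [if_neg (by omega), if_neg (by omega)] at this
          rw [← h4 v hv hv']
          omega)
    simpa using this
  · have := s_induct_e h (fun k S => SameOutside i T S ∧ count S i + k = count T (i + 1) ∧
      count S (i + 1) = count T i + k ∧ ∀ v : ℕ, v ≠ i → v ≠ i + 1 → count S v = count T v)
      (by
        refine ⟨fun _ _ => Or.inl rfl, ?_, ?_, fun _ _ _ => rfl⟩ <;> unfold pairing at * <;> omega)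
      (by
        rintro k S S' hS ⟨h1, h2, h3, h4⟩
        obtain ⟨r, c, -, hm, hi, hu⟩ := e_spec hS
        have hc := count_update hm hu
        refine ⟨fun a b => ?_, ?_, ?_, fun v hv hv' => ?_⟩
        · have := h1 a b
          rw [hu]
          split_ifs with hab
          · obtain ⟨rfl, rfl⟩ := hab
            omega
          · exact this
        · have := hc i
          rw [if_pos rfl, if_neg (by omega)] at this
          omega
        · have := hc (i + 1)
          rw [if_pos hi, if_neg (by omega)] at this
          omega
        · have := hc v
          rw [if_neg (by omega), if_neg (by omega)] at this
          rw [← h4 v hv hv']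
          omega)
    simpa using this

theorem count_s {n : ℕ} {μ : YoungDiagram} (i : Index n) (T : SST n μ) (v : ℕ) :
    count (s i T) v = count T (Equiv.swap (i : ℕ) (i + 1) v) := by
  obtain ⟨-, h1, h2, h3⟩ := s_spec i T
  rw [Equiv.swap_apply_def]
  split_ifs with k1 k2
  · rw [k1, h1]
  · rw [k2, h2]
  · exact h3 v k1 k2

theorem s_eq_self {n : ℕ} {μ : YoungDiagram} {i : Index n} {T : SST n μ}
    (h : count T i = count T (i + 1)) : s i T = T := by
  have h0 : pairing i T = 0 := by rw [pairing, h, sub_self]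
  exact s_induct_f h0.ge (fun k S => k = 0 ∧ S = T) ⟨by rw [h0]; rfl, rfl⟩
    (fun k S S' _ h => absurd h.1 (Nat.succ_ne_zero k)) |>.2

theorem SameOutside.symm {n : ℕ} {μ : YoungDiagram} {i : ℕ} {T S : SST n μ}
    (h : SameOutside i T S) : SameOutside i S T := fun r c => by
  have := h r c
  omega

theorem SameOutside.mem_col0_iff {n : ℕ} {μ : YoungDiagram} {i : ℕ} {T S : SST n μ}
    (h : SameOutside i T S) {v : ℕ} (h1 : v ≠ i) (h2 : v ≠ i + 1) : v ∈ col0 S ↔ v ∈ col0 T := by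
  refine exists_congr fun r => and_congr_right fun _ => ?_
  have := h r 0
  omega

theorem SameOutside.mem_or {n : ℕ} {μ : YoungDiagram} {i : ℕ} {T S : SST n μ}
    (h : SameOutside i T S) (hT : i ∈ col0 T ∨ i + 1 ∈ col0 T) :
    i ∈ col0 S ∨ i + 1 ∈ col0 S := by
  obtain ⟨r, hr, hv⟩ | ⟨r, hr, hv⟩ := hT
  · have := h r 0
    have : S.1 r 0 = i ∨ S.1 r 0 = i + 1 := by omega
    exact this.imp (fun k => ⟨r, hr, k⟩) fun k => ⟨r, hr, k⟩
  · have := h r 0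
    have : S.1 r 0 = i ∨ S.1 r 0 = i + 1 := by omega
    exact this.imp (fun k => ⟨r, hr, k⟩) fun k => ⟨r, hr, k⟩

/-- The two boxes holding `i` and `i + 1` keep letters of this pair, and these must differ because
the column is strict. -/
theorem SameOutside.mem_and {n : ℕ} {μ : YoungDiagram} {i : ℕ} {T S : SST n μ}
    (h : SameOutside i T S) (h1 : i ∈ col0 T) (h2 : i + 1 ∈ col0 T) :
    i ∈ col0 S ∧ i + 1 ∈ col0 S := by
  obtain ⟨r, hr, hv⟩ := h1
  obtain ⟨r', hr', hv'⟩ := h2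
  have hne : S.1 r 0 ≠ S.1 r' 0 := fun he => by
    have := col_injective S hr hr' he
    subst this
    omega
  have k1 := h r 0
  have k2 := h r' 0
  have : (S.1 r 0 = i ∧ S.1 r' 0 = i + 1) ∨ (S.1 r 0 = i + 1 ∧ S.1 r' 0 = i) := by omega
  rcases this with ⟨k1, k2⟩ | ⟨k1, k2⟩
  · exact ⟨⟨r, hr, k1⟩, ⟨r', hr', k2⟩⟩
  · exact ⟨⟨r', hr', k2⟩, ⟨r, hr, k1⟩⟩

/-- If `s̃ i` exchanges the letters `i`, `i + 1` of the first column or keeps them according to `F`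
whenever the first column contains exactly one of them, then this holds in general. -/
theorem mem_col0_s_of {n : ℕ} {μ : YoungDiagram} (i : Index n) (T : SST n μ) (F : Prop) [Decidable F]
    (h1 : (i : ℕ) ∈ col0 T → (i : ℕ) + 1 ∉ col0 T → (F ↔ (i : ℕ) ∉ col0 (s i T)))
    (h2 : (i : ℕ) + 1 ∈ col0 T → (i : ℕ) ∉ col0 T → (F ↔ (i : ℕ) + 1 ∉ col0 (s i T))) (v : ℕ) :
    v ∈ col0 (s i T) ↔ (if F then Equiv.swap (i : ℕ) (i + 1) v else v) ∈ col0 T := by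
  have hs := (s_spec i T).1
  have k1 := hs.mem_or
  have k2 := hs.symm.mem_or
  have k3 := hs.mem_and
  have k4 := hs.symm.mem_and
  have k5 : v ≠ i → v ≠ i + 1 → (v ∈ col0 (s i T) ↔ v ∈ col0 T) := hs.mem_col0_iff
  by_cases e1 : v = i
  · rw [e1, Equiv.swap_apply_left]
    clear k5 hs e1
    split_ifs <;> grind
  · by_cases e2 : v = i + 1
    · rw [e2, Equiv.swap_apply_right]
      clear k5 hs e1 e2
      split_ifs <;> grind
    · rw [Equiv.swap_apply_of_ne_of_ne e1 e2, ite_self, hs.mem_col0_iff e1 e2]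

/-! ### Hooks -/

/-- An `i` in the arm, at `(0, c)`, would be read after `(r, 0)`. The boxes in between contain no `i
+ 1`, so the partial sum at `(0, c)` would exceed the maximum. Thus `f i` changes the `i` of the
first column only after all the others. -/
theorem IsHook.restCount_of_lowering {n : ℕ} {μ : YoungDiagram} (hμ : IsHook μ) {i r : ℕ}
    {T : SST n μ} (hb : IsLoweringBox μ T.1 i (r, 0)) : restCount T i = 0 := by
  rw [restCount, Finset.card_eq_zero, Finset.filter_eq_empty_iff]
  rintro ⟨a, c⟩ hx ⟨hc, hv⟩
  rw [μ.mem_cells] at hx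
  dsimp only at hc hv
  obtain rfl : a = 0 := by
    by_contra ha
    have := hμ.eq_zero hx (by omega)
    omega
  have hr := (lowering_facts T hb).1
  rw [isLoweringBox_iff] at hb
  have hrm : (r, 0) ∈ μ := by simpa using hb.1
  have h3 := (hb.2.2 (0, c) (by simpa using hx)).1
  have hsub : μ.cells.filter (fun x => readKey x ≤ readKey (r, 0)) ⊆
      μ.cells.filter (fun x => readKey x ≤ readKey (0, c)) := by
    intro x hx
    simp only [Finset.mem_filter, readKey_le, ReadLE] at hx ⊢
    refine ⟨hx.1, ?_⟩
    have := hx.2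
    omega
  rw [← Finset.sum_sdiff hsub] at h3
  have h4 : 0 < ∑ x ∈ μ.cells.filter (fun x => readKey x ≤ readKey (0, c)) \
      μ.cells.filter (fun x => readKey x ≤ readKey (r, 0)), sgn i (T.1 x.1 x.2) := by
    refine Finset.sum_pos' ?_ ⟨(0, c), ?_, sgn_pos.2 hv⟩
    · rintro ⟨x1, x2⟩ hx'
      simp only [Finset.mem_sdiff, Finset.mem_filter, readKey_le, ReadLE, μ.mem_cells] at hx'
      obtain ⟨⟨k1, k2⟩, k3⟩ := hx'
      replace k3 := not_and.1 k3 k1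
      have hle : T.1 x1 x2 ≤ i := by
        rcases Nat.eq_zero_or_pos x1 with rfl | hpos
        · have := T.1.row_weak_of_le (show x2 ≤ c by omega) hx
          omega
        · obtain rfl := hμ.eq_zero k1 hpos
          have := T.1.col_weak (show x1 ≤ r by omega) hrm
          omega
      by_contra hneg
      have := sgn_neg.1 (not_le.1 hneg)
      dsimp only at this
      omega
    · rw [Finset.mem_sdiff, Finset.mem_filter, Finset.mem_filter, μ.mem_cells, readKey_le, readKey_le]
      refine ⟨⟨hx, Or.inr ⟨rfl, le_rfl⟩⟩, not_and.2 fun _ => ?_⟩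
      dsimp only [ReadLE]; omega
  linarith

/-- An `i` in the arm would pair with the `i + 1` at `(r, 0)`, so that `e i` could not act there. -/
theorem IsHook.restCount_of_raising {n : ℕ} {μ : YoungDiagram} (hμ : IsHook μ) {i r : ℕ}
    {T : SST n μ} (hb : IsRaisingBox μ T.1 i (r, 0)) : restCount T i = 0 := by
  rw [restCount, Finset.card_eq_zero, Finset.filter_eq_empty_iff]
  rintro ⟨a, c⟩ hx ⟨hc, hv⟩
  rw [μ.mem_cells] at hx
  dsimp only at hc hv
  obtain rfl : a = 0 := by
    by_contra ha
    have := hμ.eq_zero hx (by omega)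
    omega
  have hr := (raising_facts T hb).1
  rw [isRaisingBox_iff] at hb
  have hrm : (r, 0) ∈ μ := by simpa using hb.1
  -- `D` is what is read after the `i` at `(0, c)`. Between `(r, 0)` and `D` the only `i + 1` is the
  -- one at `(r, 0)`, and it is cancelled by that `i`, so the suffix sum at `(r, 0)` does not exceed
  -- the sum over `D`.
  set D := μ.cells.filter (fun x => x.1 = 0 ∧ c < x.2) with hDdef
  have hD : Initial μ.cells (fun a => OrderDual.toDual (readKey a)) D := by
    refine ⟨Finset.filter_subset _ _, ?_⟩
    rintro ⟨x1, x2⟩ hx ⟨y1, y2⟩ hy hyx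
    simp only [hDdef, Finset.mem_filter, OrderDual.toDual_le_toDual, readKey_le, ReadLE,
      μ.mem_cells] at hx hy hyx ⊢
    exact ⟨hy, by omega⟩
  have h5 := hb.sum_lt hD (by simp [hDdef])
  simp only [OrderDual.toDual_le_toDual] at h5
  have hsub : D ⊆ μ.cells.filter (fun x => readKey (r, 0) ≤ readKey x) := by
    intro x hx
    simp only [hDdef, Finset.mem_filter, readKey_le, ReadLE] at hx ⊢
    refine ⟨hx.1, ?_⟩
    have := hx.2
    omega
  rw [← Finset.sum_sdiff hsub] at h5
  have hval : ∀ x ∈ μ.cells.filter (fun x => readKey (r, 0) ≤ readKey x) \ D,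
      0 < -sgn i (T.1 x.1 x.2) → x = (r, 0) := by
    rintro ⟨x1, x2⟩ hx' hpos
    rw [neg_pos, sgn_neg] at hpos
    simp only [hDdef, Finset.mem_sdiff, Finset.mem_filter, readKey_le, ReadLE, μ.mem_cells]
      at hx' hpos
    obtain ⟨⟨k1, k2⟩, k3⟩ := hx'
    replace k3 := not_and.1 k3 k1
    rcases Nat.eq_zero_or_pos x1 with rfl | hpos'
    · have := T.1.row_weak_of_le (show x2 ≤ c by omega) hx
      omega
    · obtain rfl := hμ.eq_zero k1 hpos'
      rw [col_injective T k1 hrm (hpos.trans hr.symm)]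
  have h6 := sum_nonpos_of_matching (σ := fun x => -sgn i (T.1 x.1 x.2))
    (μ.cells.filter (fun x => readKey (r, 0) ≤ readKey x) \ D)
    (fun x _ => by have := neg_one_le_sgn i (T.1 x.1 x.2); omega)
    (fun _ => (0, c)) (by
      intro x _ _
      have : 0 < sgn i (T.1 0 c) := sgn_pos.2 hv
      refine ⟨?_, by dsimp only; omega⟩
      simp only [hDdef, Finset.mem_sdiff, Finset.mem_filter, readKey_le, ReadLE, μ.mem_cells]
      exact ⟨⟨hx, by omega⟩, not_and.2 fun _ => by omega⟩)
    (fun x hx y hy hpx hpy _ => (hval x hx hpx).trans (hval y hy hpy).symm)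
  omega

theorem mem_col0_update {n : ℕ} {μ : YoungDiagram} {T T' : SST n μ} {r c v w : ℕ}
    (h : ∀ a b, T'.1 a b = if a = r ∧ b = c then w else T.1 a b) (hv : v ∈ col0 T)
    (hne : c = 0 → T.1 r 0 ≠ v) : v ∈ col0 T' := by
  obtain ⟨a, ha, rfl⟩ := hv
  refine ⟨a, ha, ?_⟩
  rw [h, if_neg]
  rintro ⟨rfl, rfl⟩
  exact hne rfl rfl

/-- Lowering reaches the `i` of the first column only when it is the last one, but `count T (i + 1)
≠ 0` letters `i` survive. Raising never alters an `i`. -/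
theorem IsHook.mem_of_count_ne_zero {n : ℕ} {μ : YoungDiagram} (hμ : IsHook μ) {i : Index n}
    {T : SST n μ} (h : (i : ℕ) ∈ col0 T) (hc : count T (i + 1) ≠ 0) : (i : ℕ) ∈ col0 (s i T) := by
  by_cases hp : 0 ≤ pairing i T
  · have := s_induct_f hp (fun _ S => (i : ℕ) ∈ col0 S ∨ count S i = 0) (Or.inl h) (by
      rintro k S S' hS hor
      obtain ⟨r, c, hb, hm, hi, hu⟩ := f_spec hS
      have hne : count S i ≠ 0 := (count_ne_zero S).2 ⟨r, c, hm, hi⟩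
      have hmem := hor.resolve_right hne
      rcases Nat.eq_zero_or_pos c with rfl | hpos
      · right
        have h1 := count_eq S i
        have h2 := count_update hm hu i
        rw [hμ.restCount_of_lowering hb, if_pos hmem] at h1
        rw [if_pos hi, if_neg (by omega)] at h2
        omega
      · exact Or.inl (mem_col0_update hu hmem (by omega)))
    exact this.resolve_right (by rwa [(s_spec i T).2.1])
  · exact s_induct_e hp (fun _ S => (i : ℕ) ∈ col0 S) h (by
      rintro k S S' hS hmem
      obtain ⟨r, c, hb, hm, hi, hu⟩ := e_spec hS
      exact mem_col0_update hu hmem (by rintro rfl; omega))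

/-- Raising at the first column would require that no `i` lies in the arm; as none lies in the first
column either, this contradicts the presence of an `i`, which persists under raising. -/
theorem IsHook.succ_mem_of_count_ne_zero {n : ℕ} {μ : YoungDiagram} (hμ : IsHook μ) {i : Index n}
    {T : SST n μ} (h : (i : ℕ) + 1 ∈ col0 T) (h' : (i : ℕ) ∉ col0 T) (hc : count T i ≠ 0) :
    (i : ℕ) + 1 ∈ col0 (s i T) := by
  by_cases hp : 0 ≤ pairing i T
  · exact s_induct_f hp (fun _ S => (i : ℕ) + 1 ∈ col0 S) h (by
      rintro k S S' hS hmem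
      obtain ⟨r, c, hb, hm, hi, hu⟩ := f_spec hS
      exact mem_col0_update hu hmem (by rintro rfl; omega))
  · exact (s_induct_e hp (fun _ S => (i : ℕ) + 1 ∈ col0 S ∧ (i : ℕ) ∉ col0 S ∧ count S i ≠ 0)
      ⟨h, h', hc⟩ (by
        rintro k S S' hS ⟨h1, h2, h3⟩
        obtain ⟨r, c, hb, hm, hi, hu⟩ := e_spec hS
        have h4 := count_update hm hu i
        rw [if_pos rfl, if_neg (by omega)] at h4
        rcases Nat.eq_zero_or_pos c with rfl | hpos
        · have h5 := count_eq S i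
          rw [hμ.restCount_of_raising hb, if_neg h2] at h5
          omega
        · refine ⟨mem_col0_update hu h1 (by omega), ?_, by omega⟩
          rintro ⟨a, ha, hv⟩
          rw [hu, if_neg (by omega)] at hv
          exact h2 ⟨a, ha, hv⟩)).1

theorem notMem_of_count {n : ℕ} {μ : YoungDiagram} {T : SST n μ} {v : ℕ} (h : count T v = 0) :
    v ∉ col0 T := fun h' => count_pos_of_mem T h' h

theorem IsHook.mem_col0_s {n : ℕ} {μ : YoungDiagram} (hμ : IsHook μ) (i : Index n) (T : SST n μ)
    (v : ℕ) : v ∈ col0 (s i T) ↔ (if count T i = 0 ∨ count T (i + 1) = 0 then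
      Equiv.swap (i : ℕ) (i + 1) v else v) ∈ col0 T := by
  obtain ⟨-, k1, k2, -⟩ := s_spec i T
  refine mem_col0_s_of i T _ (fun h1 h2 => ?_) (fun h1 h2 => ?_) v
  · have h3 := count_pos_of_mem T h1
    constructor
    · rintro (h | h)
      · exact absurd h h3
      · exact notMem_of_count (k1.trans h)
    · exact fun h => Or.inr (not_not.1 fun hc => h (hμ.mem_of_count_ne_zero h1 hc))
  · have h3 := count_pos_of_mem T h1
    constructor
    · rintro (h | h)
      · exact notMem_of_count (k2.trans h)
      · exact absurd h h3
    · exact fun h => Or.inl (not_not.1 fun hc => h (hμ.succ_mem_of_count_ne_zero h1 h2 hc))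

/-! ### Two columns -/

/-- Pure counting: each column contains a letter at most once and the multiplicities are exchanged.
If the first column contains exactly one of the two letters and keeps it, both multiplicities must
be `1`; conversely, `s i` is then the identity. The signature rule itself plays no further role. -/
theorem IsTwoColumn.mem_col0_s {n : ℕ} {μ : YoungDiagram} (hμ : IsTwoColumn μ) (i : Index n)
    (T : SST n μ) (v : ℕ) : v ∈ col0 (s i T) ↔ (if ¬ (count T i = 1 ∧ count T (i + 1) = 1) then
      Equiv.swap (i : ℕ) (i + 1) v else v) ∈ col0 T := by
  obtain ⟨k0, k1, k2, -⟩ := s_spec i T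
  have c1 := count_eq T i
  have c2 := count_eq T (i + 1)
  have c3 := count_eq (s i T) i
  have c4 := count_eq (s i T) (i + 1)
  have b1 := hμ.restCount_le_one T i
  have b2 := hμ.restCount_le_one T (i + 1)
  have b3 := hμ.restCount_le_one (s i T) i
  have b4 := hμ.restCount_le_one (s i T) (i + 1)
  refine mem_col0_s_of i T _ (fun h1 h2 => ?_) (fun h1 h2 => ?_) v
  · have m1 := k0.mem_or (Or.inl h1)
    have m2 : ¬ ((i : ℕ) ∈ col0 (s i T) ∧ (i : ℕ) + 1 ∈ col0 (s i T)) :=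
      fun h => h2 (k0.symm.mem_and h.1 h.2).2
    by_cases hF : count T i = 1 ∧ count T (i + 1) = 1
    · rw [s_eq_self (hF.1.trans hF.2.symm)]
      tauto
    · refine ⟨fun _ h => ?_, fun _ => hF⟩
      rw [if_pos h1] at c1
      rw [if_neg h2] at c2
      rw [if_pos h] at c3
      rw [if_neg fun h' => m2 ⟨h, h'⟩] at c4
      omega
  · have m1 := k0.mem_or (Or.inr h1)
    have m2 : ¬ ((i : ℕ) ∈ col0 (s i T) ∧ (i : ℕ) + 1 ∈ col0 (s i T)) :=
      fun h => h2 (k0.symm.mem_and h.1 h.2).1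
    by_cases hF : count T i = 1 ∧ count T (i + 1) = 1
    · rw [s_eq_self (hF.1.trans hF.2.symm)]
      tauto
    · refine ⟨fun _ h => ?_, fun _ => hF⟩
      rw [if_pos h1] at c2
      rw [if_neg h2] at c1
      rw [if_pos h] at c4
      rw [if_neg fun h' => m2 ⟨h', h⟩] at c3
      omega

/-! ## Intertwining relations -/

theorem swap_succ (i v : ℕ) :
    Equiv.swap (i + 1) (i + 1 + 1) (v + 1) = Equiv.swap i (i + 1) v + 1 := by
  simp only [Equiv.swap_apply_def]
  split_ifs <;> omega

theorem swap_bounds {n i v : ℕ} (h1 : 1 ≤ i) (h2 : i + 1 < n) (hv1 : 1 ≤ v) (hv2 : v < n) :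
    1 ≤ Equiv.swap i (i + 1) v ∧ Equiv.swap i (i + 1) v < n := by
  rw [Equiv.swap_apply_def]
  split_ifs <;> omega

theorem count_s_pr {n : ℕ} {μ : YoungDiagram} (i j : Index n) (hij : (j : ℕ) = i + 1) (T : SST n μ)
    (v : ℕ) : count (s j (pr T)) v = count (pr (s i T)) v := by
  have hi := i.2.1
  have hj := j.2.2
  by_cases hv : 1 ≤ v ∧ v ≤ n
  · obtain ⟨w, rfl⟩ : ∃ w, v = w + 1 := ⟨v - 1, by omega⟩
    rw [count_s, hij, swap_succ]
    rcases Nat.eq_zero_or_pos w with rfl | hw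
    · rw [Equiv.swap_apply_of_ne_of_ne (by omega) (by omega), zero_add, count_pr_one, count_pr_one,
        count_s, Equiv.swap_apply_of_ne_of_ne (by omega) (by omega)]
    · have := swap_bounds hi (show (i : ℕ) + 1 < n by omega) hw (by omega)
      rw [count_pr_succ _ this.1 this.2, count_pr_succ _ hw (by omega), count_s]
  · rw [count_eq_zero _ hv, count_eq_zero _ hv]

theorem count_pr_pr {n : ℕ} {μ : YoungDiagram} (hn : 2 ≤ n) (T : SST n μ) :
    count (pr (pr T)) 1 = count T (n - 1) ∧ count (pr (pr T)) 2 = count T n ∧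
      ∀ w, 1 ≤ w → w + 1 < n → count (pr (pr T)) (w + 2) = count T w := by
  refine ⟨?_, ?_, fun w h1 h2 => ?_⟩
  · have := count_pr_succ T (v := n - 1) (by omega) (by omega)
    rwa [Nat.sub_add_cancel (by omega), ← count_pr_one] at this
  · rw [count_pr_succ _ le_rfl (by omega), count_pr_one]
  · rw [count_pr_succ _ (by omega) (by omega), count_pr_succ _ h1 (by omega)]

/-- The index `n - 1`. -/
abbrev lastIndex (n : ℕ) (hn : 2 ≤ n) : Index n := ⟨n - 1, by omega, by omega⟩

theorem count_s_last {n : ℕ} {μ : YoungDiagram} (hn : 2 ≤ n) (T : SST n μ) :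
    count (s (lastIndex n hn) T) (n - 1) = count T n ∧
      count (s (lastIndex n hn) T) n = count T (n - 1) ∧
      ∀ w, w + 1 < n → count (s (lastIndex n hn) T) w = count T w := by
  obtain ⟨-, h1, h2, h3⟩ := s_spec (lastIndex n hn) T
  dsimp only at h1 h2 h3
  rw [Nat.sub_add_cancel (by omega)] at h1 h2
  exact ⟨h1, h2, fun w hw => h3 w (by omega) (by omega)⟩

theorem count_s_pr_pr {n : ℕ} {μ : YoungDiagram} (hn : 2 ≤ n) (T : SST n μ) (v : ℕ) :
    count (s ⟨1, le_rfl, hn⟩ (pr (pr T))) v = count (pr (pr (s (lastIndex n hn) T))) v := by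
  obtain ⟨h1, h2, h3⟩ := count_pr_pr hn T
  obtain ⟨k1, k2, k3⟩ := count_pr_pr hn (s (lastIndex n hn) T)
  obtain ⟨l1, l2, l3⟩ := count_s_last hn T
  by_cases hv : 1 ≤ v ∧ v ≤ n
  · rw [count_s]
    dsimp only
    obtain rfl | rfl | ⟨w, rfl⟩ : v = 1 ∨ v = 2 ∨ ∃ w, v = w + 1 + 2 := by
      rcases v with _ | _ | _ | w
      · omega
      · simp
      · simp
      · exact Or.inr (Or.inr ⟨w, rfl⟩)
    · rw [Equiv.swap_apply_left, k1, l1, h2]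
    · rw [Equiv.swap_apply_right, k2, l2, h1]
    · rw [Equiv.swap_apply_of_ne_of_ne (by omega) (by omega), k3 _ (by omega) (by omega),
        h3 _ (by omega) (by omega), l3 _ (by omega)]
  · rw [count_eq_zero _ hv, count_eq_zero _ hv]

/-! ### Tableaux as pairs of a first column and a content -/

open Classical in
/-- A description of promotion and of the operators `s̃ i` in terms of the content and the entries of
the first column: `s̃ i` acts on the first column by the transposition of `i`, `i + 1` if `F` holds for
the multiplicities of these letters and trivially otherwise; if `n` occurs, but not in the first
column, promotion removes from it the entry `y` with `Y T y`. -/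
structure ColumnModel (n : ℕ) (μ : YoungDiagram) (F : ℕ → ℕ → Prop) (Y : SST n μ → ℕ → Prop) :
    Prop where
  ext : ∀ T T' : SST n μ, col0 T = col0 T' → (∀ v, count T v = count T' v) → T = T'
  mem_s : ∀ (i : Index n) (T : SST n μ) (v : ℕ), v ∈ col0 (s i T) ↔
    (if F (count T i) (count T (i + 1)) then Equiv.swap (i : ℕ) (i + 1) else 1) v ∈ col0 T
  pr_mem : ∀ T : SST n μ, n ∈ col0 T → ∀ v, v + 1 ∈ col0 (pr T) ↔ v = 0 ∨ (v ≠ n ∧ v ∈ col0 T)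
  pr_notMem : ∀ T : SST n μ, n ∉ col0 T → count T n ≠ 0 →
    ∃ y, Y T y ∧ ∀ v, v + 1 ∈ col0 (pr T) ↔ v = 0 ∨ (v ∈ col0 T ∧ v ≠ y)
  unique : ∀ (T : SST n μ) y y', Y T y → Y T y' → y = y'
  map_s : ∀ (i : Index n) (T : SST n μ) (y : ℕ), (i : ℕ) + 1 < n → n ∉ col0 T → count T n ≠ 0 →
    Y T y →
      Y (s i T) ((if F (count T i) (count T (i + 1)) then Equiv.swap (i : ℕ) (i + 1) else 1) y)

namespace ColumnModel

variable {n : ℕ} {μ : YoungDiagram} {F : ℕ → ℕ → Prop} {Y : SST n μ → ℕ → Prop}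

/-- The shift conjugates the transposition of `i`, `i + 1` into that of `i + 1`, `i + 2`, and `F`
sees the same multiplicities. As `1 ≤ i` and `i + 1 < n`, the transposition fixes `0` and `n`, so
`T` and `s i T` fall into the same case of promotion; the expelled entries correspond by `map_s` and
`unique`. -/
theorem s_pr (h : ColumnModel n μ F Y) (i j : Index n) (hij : (j : ℕ) = i + 1) (T : SST n μ) :
    s j (pr T) = pr (s i T) := by
  classical
  refine h.ext _ _ ?_ (count_s_pr i j hij T)
  have hi := i.2.1
  have hj := j.2.2
  ext v
  rcases v with _ | v
  · exact ⟨fun h => by have := mem_col0_bounds _ h; omega,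
      fun h => by have := mem_col0_bounds _ h; omega⟩
  set σ : Equiv.Perm ℕ := if F (count T i) (count T (i + 1)) then Equiv.swap (i : ℕ) (i + 1) else 1
    with hσ
  have hmem : ∀ v, v ∈ col0 (s i T) ↔ σ v ∈ col0 T := h.mem_s i T
  have hmem' : v + 1 ∈ col0 (s j (pr T)) ↔ σ v + 1 ∈ col0 (pr T) := by
    rw [h.mem_s, hij, count_pr_succ T hi (by omega), count_pr_succ T (by omega) (by omega), hσ]
    split_ifs
    · rw [swap_succ]
    · rfl
  have hσn : σ n = n := by
    rw [hσ]
    split_ifs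
    · exact Equiv.swap_apply_of_ne_of_ne (by omega) (by omega)
    · rfl
  have hσ0 : σ 0 = 0 := by
    rw [hσ]
    split_ifs
    · exact Equiv.swap_apply_of_ne_of_ne (by omega) (by omega)
    · rfl
  have hσσ : ∀ v, σ (σ v) = v := by
    intro v
    rw [hσ]
    split_ifs
    · exact Equiv.swap_apply_self _ _ _
    · rfl
  have hv0 : σ v = 0 ↔ v = 0 := ⟨fun h => σ.injective (h.trans hσ0.symm), fun h => h ▸ hσ0⟩
  have hvn : σ v = n ↔ v = n := ⟨fun h => σ.injective (h.trans hσn.symm), fun h => h ▸ hσn⟩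
  have hn : n ∈ col0 (s i T) ↔ n ∈ col0 T := by rw [hmem, hσn]
  have hcn : count (s i T) n = count T n := by
    rw [count_s, Equiv.swap_apply_of_ne_of_ne (by omega) (by omega)]
  rw [hmem']
  by_cases h1 : n ∈ col0 T
  · rw [h.pr_mem T h1, h.pr_mem _ (hn.2 h1), hmem, hv0, Ne, hvn]
  · by_cases h2 : count T n = 0
    · rw [col0_pr_of_count_eq_zero T h2, col0_pr_of_count_eq_zero _ (hcn.trans h2), hmem, Ne, hv0, Ne,
        hvn]
    · obtain ⟨y, hy, k1⟩ := h.pr_notMem T h1 h2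
      obtain ⟨y', hy', k2⟩ := h.pr_notMem (s i T) (by rwa [hn]) (by rwa [hcn])
      obtain rfl : σ y = y' := h.unique _ _ _ (h.map_s i T y (by omega) h1 h2 hy) hy'
      rw [k1, k2, hmem, hv0]
      have : σ v = y ↔ v = σ y :=
        ⟨fun h => by rw [← h, hσσ], fun h => by rw [h, hσσ]⟩
      rw [Ne, this]

/-- The multiplicities of `i` and `i + 1` are exchanged after one application; a symmetric `F`
therefore makes the same decision twice. -/
theorem s_s (h : ColumnModel n μ F Y) (hF : ∀ a b, F a b ↔ F b a) (i : Index n) (T : SST n μ) :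
    s i (s i T) = T := by
  classical
  refine h.ext _ _ ?_ fun v => ?_
  · ext v
    obtain ⟨-, h1, h2, -⟩ := s_spec i T
    rw [h.mem_s, h.mem_s, h1, h2]
    by_cases hF' : F (count T i) (count T (i + 1))
    · rw [if_pos hF', if_pos ((hF _ _).1 hF'), Equiv.swap_apply_self]
    · rw [if_neg hF', if_neg (mt (hF _ _).1 hF')]
      rfl
  · rw [count_s, count_s, Equiv.swap_apply_self]

/-- A criterion for `s̃ 1 ∘ pr ^ 2 = pr ^ 2 ∘ s̃ (n - 1)` in terms of first columns. -/
theorem s_pr_pr_of (h : ColumnModel n μ F Y) (hn : 2 ≤ n) (T : SST n μ)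
    (h1 : 1 ∈ col0 (pr (pr (s (lastIndex n hn) T))) ↔
      (F (count T (n - 1)) (count T n) ∧ 2 ∈ col0 (pr (pr T))) ∨
        (¬ F (count T (n - 1)) (count T n) ∧ 1 ∈ col0 (pr (pr T))))
    (h2 : 2 ∈ col0 (pr (pr (s (lastIndex n hn) T))) ↔
      (F (count T (n - 1)) (count T n) ∧ 1 ∈ col0 (pr (pr T))) ∨
        (¬ F (count T (n - 1)) (count T n) ∧ 2 ∈ col0 (pr (pr T))))
    (h3 : ∀ w, 1 ≤ w → w + 1 < n →
      (w + 2 ∈ col0 (pr (pr (s (lastIndex n hn) T))) ↔ w + 2 ∈ col0 (pr (pr T)))) :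
    s ⟨1, le_rfl, hn⟩ (pr (pr T)) = pr (pr (s (lastIndex n hn) T)) := by
  classical
  refine h.ext _ _ ?_ (count_s_pr_pr hn T)
  obtain ⟨k1, k2, -⟩ := count_pr_pr hn T
  ext v
  rw [h.mem_s]
  dsimp only
  rw [k1, k2]
  by_cases hv : 1 ≤ v ∧ v ≤ n
  · obtain rfl | rfl | ⟨w, rfl⟩ : v = 1 ∨ v = 2 ∨ ∃ w, v = w + 1 + 2 := by
      rcases v with _ | _ | _ | w
      · omega
      · simp
      · simp
      · exact Or.inr (Or.inr ⟨w, rfl⟩)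
    · rw [h1]
      split_ifs with hF
      · rw [Equiv.swap_apply_left]; simp [hF]
      · simp [hF]
    · rw [h2]
      split_ifs with hF
      · rw [Equiv.swap_apply_right]; simp [hF]
      · simp [hF]
    · rw [h3 _ (by omega) (by omega)]
      split_ifs with hF
      · rw [Equiv.swap_apply_of_ne_of_ne (by omega) (by omega)]
      · rfl
  · have e2 : v ∉ col0 (pr (pr (s (lastIndex n hn) T))) := fun h => hv (mem_col0_bounds _ h)
    refine iff_of_false (fun h' => ?_) e2
    have h3 := mem_col0_bounds _ h'
    split_ifs at h3
    · rw [Equiv.swap_apply_def] at h3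
      split_ifs at h3 <;> omega
    · exact hv h3

/-- Membership of the letters `n - 1`, `n` and of the smaller ones after applying `s̃ (n - 1)`. -/
theorem mem_s_last (h : ColumnModel n μ F Y) (hn : 2 ≤ n) (T : SST n μ) :
    (F (count T (n - 1)) (count T n) → (n - 1 ∈ col0 (s (lastIndex n hn) T) ↔ n ∈ col0 T) ∧
      (n ∈ col0 (s (lastIndex n hn) T) ↔ n - 1 ∈ col0 T)) ∧
    (¬ F (count T (n - 1)) (count T n) → (n - 1 ∈ col0 (s (lastIndex n hn) T) ↔ n - 1 ∈ col0 T) ∧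
      (n ∈ col0 (s (lastIndex n hn) T) ↔ n ∈ col0 T)) ∧
    ∀ w, w + 1 < n → (w ∈ col0 (s (lastIndex n hn) T) ↔ w ∈ col0 T) := by
  classical
  have key := h.mem_s (lastIndex n hn) T
  simp only [Nat.sub_add_cancel (show 1 ≤ n by omega)] at key
  refine ⟨fun hF => ?_, fun hF => ?_, fun w hw => ?_⟩
  · rw [key, key, if_pos hF, Equiv.swap_apply_left, Equiv.swap_apply_right]
    exact ⟨Iff.rfl, Iff.rfl⟩
  · rw [key, key, if_neg hF]
    exact ⟨Iff.rfl, Iff.rfl⟩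
  · rw [key]
    split_ifs
    · rw [Equiv.swap_apply_of_ne_of_ne (by omega) (by omega)]
    · rfl

end ColumnModel

/-! ### Hooks -/

/-- If both letters occur, the set of occurring letters does not change. If one of them is missing,
the transposition still carries the least occurring letter to the least one, since no occurring
letter lies between `i` and `i + 1` or in the missing place. -/
theorem IsHook.map_s_min {n : ℕ} {μ : YoungDiagram} (hμ : IsHook μ) (i : Index n) (T : SST n μ)
    (y : ℕ) (hy : y ∈ col0 T ∧ ∀ z, count T z ≠ 0 → y ≤ z) :
    (if count T i = 0 ∨ count T (i + 1) = 0 then Equiv.swap (i : ℕ) (i + 1) else 1) y ∈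
        col0 (s i T) ∧ ∀ z, count (s i T) z ≠ 0 →
      (if count T i = 0 ∨ count T (i + 1) = 0 then Equiv.swap (i : ℕ) (i + 1) else 1) y ≤ z := by
  obtain ⟨hy, hmin⟩ := hy
  have hpos := count_pos_of_mem T hy
  constructor
  · rw [hμ.mem_col0_s]
    split_ifs
    · rwa [Equiv.swap_apply_self]
    · exact hy
  · intro z hz
    rw [count_s] at hz
    have h1 := hmin _ hz
    have h2 := hmin i
    have h3 := hmin (i + 1)
    rw [Equiv.swap_apply_def] at hz h1
    split_ifs with hF
    · rw [Equiv.swap_apply_def]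
      split_ifs at hz h1 ⊢ <;> grind
    · rw [Equiv.Perm.one_apply]
      split_ifs at h1 <;> omega

theorem IsHook.columnModel {n : ℕ} {μ : YoungDiagram} (hμ : IsHook μ) :
    ColumnModel n μ (fun a b => a = 0 ∨ b = 0)
      fun T y => y ∈ col0 T ∧ ∀ z, count T z ≠ 0 → y ≤ z where
  ext _ _ := hμ.ext
  mem_s i T v := by
    rw [hμ.mem_col0_s]
    split_ifs <;> rfl
  pr_mem T h _ := hμ.col0_pr_of_mem T h
  pr_notMem T h hc := ⟨T.1 0 0, ⟨(corner_le T hc).1, fun _ hz => (corner_le T hz).2⟩,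
    fun _ => hμ.col0_pr_of_notMem T h hc⟩
  unique T y y' h h' :=
    le_antisymm (h.2 _ (count_pos_of_mem T h'.1)) (h'.2 _ (count_pos_of_mem T h.1))
  map_s i T y _ _ _ hy := by
    convert hμ.map_s_min i T y hy

theorem IsHook.mem_col0_pr {n : ℕ} {μ : YoungDiagram} (hμ : IsHook μ) (T : SST n μ) (v : ℕ) :
    v + 1 ∈ col0 (pr T) ↔ (v = 0 ∧ count T n ≠ 0) ∨ (v ≠ 0 ∧ v ≠ n ∧ v ∈ col0 T ∧
      ¬ (v = T.1 0 0 ∧ n ∉ col0 T ∧ count T n ≠ 0)) := by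
  have h0 : v ∈ col0 T → v ≠ 0 := fun h => by have := (mem_col0_bounds T h).1; omega
  have h1 : n ∈ col0 T → count T n ≠ 0 := count_pos_of_mem T
  have h2 : n ∉ col0 T → v ∈ col0 T → v ≠ n := fun h h' he => h (he ▸ h')
  by_cases h : n ∈ col0 T
  · rw [hμ.col0_pr_of_mem T h]
    grind
  · by_cases hc : count T n = 0
    · rw [col0_pr_of_count_eq_zero T hc]
      grind
    · rw [hμ.col0_pr_of_notMem T h hc]
      grind

/-- The second promotion sees `n - 1` of `T` as its largest letter. If `n` occurs in `T`, the corner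
of `pr T` is the new `1`, and it is this letter that the second promotion may expel; otherwise the
corner is the shifted corner of `T`. Hence an entry `w < n - 1` is lost in at most one of the two
steps. -/
theorem IsHook.mem_col0_pr_pr {n : ℕ} {μ : YoungDiagram} (hμ : IsHook μ) (hn : 2 ≤ n)
    (T : SST n μ) :
    (1 ∈ col0 (pr (pr T)) ↔ count T (n - 1) ≠ 0) ∧
    (2 ∈ col0 (pr (pr T)) ↔ count T n ≠ 0 ∧ (count T (n - 1) = 0 ∨
      (n - 1 ∈ col0 T ∧ ¬ (n - 1 = T.1 0 0 ∧ n ∉ col0 T)))) ∧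
    ∀ w, 1 ≤ w → w + 1 < n → (w + 2 ∈ col0 (pr (pr T)) ↔ w ∈ col0 T ∧
      ¬ (w = T.1 0 0 ∧ n ∉ col0 T ∧ (count T n ≠ 0 ∨ (n - 1 ∉ col0 T ∧ count T (n - 1) ≠ 0)))) := by
  have hp : count (pr T) n = count T (n - 1) := by
    rw [← count_pr_one, (count_pr_pr hn T).1]
  have hx1 : count T n ≠ 0 → (pr T).1 0 0 = 1 := fun h =>
    (corner_eq_one (pr T) (by rwa [count_pr_one])).2
  have hx2 : ∀ w, w ∈ col0 T → count T n = 0 → (pr T).1 0 0 = T.1 0 0 + 1 := by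
    intro w hw hq
    have hm : (0, 0) ∈ μ := by
      obtain ⟨r, hr, -⟩ := hw
      exact μ.up_left_mem (Nat.zero_le r) le_rfl hr
    rw [pr_apply T hm, slideDots_of_count_eq_zero T hq _ le_rfl, dotted, if_neg]
    exact fun h => (count_ne_zero T).2 ⟨0, 0, hm, h⟩ hq
  have hx3 : ∀ w, w ∈ col0 T → T.1 0 0 ≤ w := fun w hw => (corner_le T (count_pos_of_mem T hw)).2
  have hlast := hμ.mem_col0_pr T (n - 1)
  rw [Nat.sub_add_cancel (by omega)] at hlast
  have hq0 : n ∈ col0 T → count T n ≠ 0 := count_pos_of_mem T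
  refine ⟨?_, ?_, fun w h1 h2 => ?_⟩
  · rw [hμ.mem_col0_pr (pr T) 0, hp]
    simp
  · rw [hμ.mem_col0_pr (pr T) 1, hμ.mem_col0_pr T 0, hp, hlast]
    have e1 : 1 ≠ n := by omega
    have e2 : n - 1 ≠ 0 := by omega
    have e3 : n - 1 ≠ n := by omega
    grind
  · rw [hμ.mem_col0_pr (pr T) (w + 1), hμ.mem_col0_pr T w, hp, hlast]
    have e1 : w + 1 ≠ n := by omega
    have e2 : n - 1 ≠ 0 := by omega
    have e3 : n - 1 ≠ n := by omega
    have e4 : w ≠ n := by omega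
    have e5 : w ≠ 0 := by omega
    have := hx2 w
    grind

theorem IsHook.s_pr_pr {n : ℕ} {μ : YoungDiagram} (hμ : IsHook μ) (hn : 2 ≤ n) (T : SST n μ) :
    s ⟨1, le_rfl, hn⟩ (pr (pr T)) = pr (pr (s (lastIndex n hn) T)) := by
  obtain ⟨a1, a2, a3⟩ := hμ.mem_col0_pr_pr hn T
  obtain ⟨b1, b2, b3⟩ := hμ.mem_col0_pr_pr hn (s (lastIndex n hn) T)
  obtain ⟨c1, c2, c3⟩ := hμ.columnModel.mem_s_last hn T
  obtain ⟨d1, d2, d3⟩ := count_s_last hn T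
  have e1 : n ∈ col0 T → count T n ≠ 0 := count_pos_of_mem T
  have e2 : n - 1 ∈ col0 T → count T (n - 1) ≠ 0 := count_pos_of_mem T
  -- By `map_s_min` the new corner `σ` is the image of the old one. Only two consequences matter: it
  -- is unchanged when both `n - 1` and `n` occur, and comparing it with a letter below `n - 1`
  -- gives the same answer as for `T`.
  have hx : ∀ z, count T z ≠ 0 → ∃ σ : ℕ, (s (lastIndex n hn) T).1 0 0 = σ ∧
      ((count T (n - 1) ≠ 0 ∧ count T n ≠ 0 → σ = T.1 0 0) ∧
        ∀ w, w + 1 < n → (w = σ ↔ w = T.1 0 0)) := by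
    intro z hz
    have k1 := hμ.map_s_min (lastIndex n hn) T (T.1 0 0)
      ⟨(corner_le T hz).1, fun _ hz => (corner_le T hz).2⟩
    have k2 := corner_le _ (count_pos_of_mem _ k1.1)
    have k3 := k1.2 _ (count_pos_of_mem _ k2.1)
    refine ⟨_, le_antisymm k2.2 k3, ?_⟩
    simp only [Nat.sub_add_cancel (show 1 ≤ n by omega)]
    refine ⟨fun h => ?_, fun w hw => ?_⟩
    · rw [if_neg fun h' => h'.elim h.1 h.2]; rfl
    · split_ifs
      · rw [Equiv.swap_apply_def]
        split_ifs <;> omega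
      · rfl
  refine hμ.columnModel.s_pr_pr_of hn T ?_ ?_ fun w h1 h2 => ?_
  · rw [b1, a1, a2, d1]
    grind
  · rw [b2, a1, a2, d1, d2]
    by_cases hF : count T (n - 1) = 0 ∨ count T n = 0
    · grind
    · obtain ⟨σ, s1, s2, s3⟩ := hx n (not_or.1 hF).2
      rw [s1, s2 (not_or.1 hF)]
      grind
  · rw [b3 w h1 h2, a3 w h1 h2, c3 w h2, d1, d2]
    refine and_congr_right fun hw => ?_
    obtain ⟨σ, s1, s2, s3⟩ := hx w (count_pos_of_mem T hw)
    rw [s1, s3 w h2]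
    by_cases hF : count T (n - 1) = 0 ∨ count T n = 0
    · grind
    · grind

/-! ### Heights of two-column tableaux -/

open Classical in
/-- The contribution of the letter `v` to the height. -/
noncomputable def heightStep {n : ℕ} {μ : YoungDiagram} (T : SST n μ) (v : ℕ) : ℤ :=
  2 * (if v ∈ col0 T then 1 else 0) - count T v

/-- Being expressed by first column and content alone, the steps are transported by any operator
whose effect on these two data is known. -/
theorem heightStep_congr {n : ℕ} {μ : YoungDiagram} {T S : SST n μ} {v w : ℕ}
    (h : v ∈ col0 T ↔ w ∈ col0 S) (hc : count T v = count S w) :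
    heightStep T v = heightStep S w := by
  rw [heightStep, heightStep, hc]
  by_cases hw : w ∈ col0 S
  · rw [if_pos hw, if_pos (h.2 hw)]
  · rw [if_neg hw, if_neg (mt h.1 hw)]

/-- The height of `T` at `v`: the number of entries `≤ v` in the first column minus the number of
the other entries `≤ v`. -/
noncomputable def height {n : ℕ} {μ : YoungDiagram} (T : SST n μ) (v : ℕ) : ℤ :=
  ∑ u ∈ Finset.range (v + 1), heightStep T u

theorem heightStep_zero {n : ℕ} {μ : YoungDiagram} (T : SST n μ) : heightStep T 0 = 0 := by
  have h := count_eq_zero T (v := 0) (by omega)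
  rw [heightStep, h, if_neg (notMem_of_count h)]
  simp

theorem height_zero {n : ℕ} {μ : YoungDiagram} (T : SST n μ) : height T 0 = 0 := by
  simp [height, heightStep_zero]

theorem height_succ {n : ℕ} {μ : YoungDiagram} (T : SST n μ) (v : ℕ) :
    height T (v + 1) = height T v + heightStep T (v + 1) := by
  rw [height, Finset.sum_range_succ]
  rfl

/-- The number of entries `≤ v` in the column `c`. -/
def colCountLE {n : ℕ} {μ : YoungDiagram} (T : SST n μ) (c v : ℕ) : ℕ :=
  ((Finset.range (μ.colLen c)).filter fun r => T.1 r c ≤ v).card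

theorem colCountLE_zero {n : ℕ} {μ : YoungDiagram} (T : SST n μ) (c : ℕ) : colCountLE T c 0 = 0 := by
  rw [colCountLE, Finset.card_eq_zero, Finset.filter_eq_empty_iff]
  intro r hr
  have := (T.2 r c (YoungDiagram.mem_iff_lt_colLen.2 (Finset.mem_range.1 hr))).1
  omega

open Classical in
theorem colCountLE_succ {n : ℕ} {μ : YoungDiagram} (T : SST n μ) (c v : ℕ) :
    colCountLE T c (v + 1) =
      colCountLE T c v + if ∃ r, (r, c) ∈ μ ∧ T.1 r c = v + 1 then 1 else 0 := by
  have hdisj : Disjoint ((Finset.range (μ.colLen c)).filter fun r => T.1 r c ≤ v)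
      ((Finset.range (μ.colLen c)).filter fun r => T.1 r c = v + 1) := by
    refine Finset.disjoint_filter.2 fun r _ h1 h2 => by omega
  rw [colCountLE, colCountLE, show ((Finset.range (μ.colLen c)).filter fun r => T.1 r c ≤ v + 1) =
    ((Finset.range (μ.colLen c)).filter fun r => T.1 r c ≤ v) ∪
      ((Finset.range (μ.colLen c)).filter fun r => T.1 r c = v + 1) by
      ext r
      rw [Finset.mem_filter, Finset.mem_union, Finset.mem_filter, Finset.mem_filter, ← and_or_left]
      exact and_congr_right fun _ => by omega, Finset.card_union_of_disjoint hdisj]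
  congr 1
  split_ifs with h
  · obtain ⟨r, hr, hv⟩ := h
    rw [Finset.card_eq_one]
    refine ⟨r, ?_⟩
    ext a
    simp only [Finset.mem_filter, Finset.mem_range, Finset.mem_singleton,
      ← YoungDiagram.mem_iff_lt_colLen]
    constructor
    · rintro ⟨h1, h2⟩
      exact col_injective T h1 hr (h2.trans hv.symm)
    · rintro rfl
      exact ⟨hr, hv⟩
  · rw [Finset.card_eq_zero, Finset.filter_eq_empty_iff]
    intro r hr hv
    exact h ⟨r, YoungDiagram.mem_iff_lt_colLen.2 (Finset.mem_range.1 hr), hv⟩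

namespace IsTwoColumn

variable {n : ℕ} {μ : YoungDiagram}

theorem height_eq (hμ : IsTwoColumn μ) (T : SST n μ) :
    ∀ v, height T v = colCountLE T 0 v - colCountLE T 1 v
  | 0 => by rw [height_zero, colCountLE_zero, colCountLE_zero]; rfl
  | v + 1 => by
    have h1 := hμ.restCount_ne_zero T (v + 1)
    have h2 := hμ.restCount_le_one T (v + 1)
    rw [height_succ, hμ.height_eq T v, colCountLE_succ, colCountLE_succ, ← h1, heightStep, count_eq]
    by_cases hv : v + 1 ∈ col0 T
    · rw [if_pos hv, if_pos (show ∃ r, (r, 0) ∈ μ ∧ T.1 r 0 = v + 1 from hv)]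
      split_ifs <;> push_cast <;> omega
    · rw [if_neg hv, if_neg (show ¬ ∃ r, (r, 0) ∈ μ ∧ T.1 r 0 = v + 1 from hv)]
      split_ifs <;> push_cast <;> omega

/-- Rows increase weakly, so to the left of each entry `≤ v` of the second column stands another
entry `≤ v`. -/
theorem height_nonneg (hμ : IsTwoColumn μ) (T : SST n μ) (v : ℕ) : 0 ≤ height T v := by
  rw [hμ.height_eq, sub_nonneg, Nat.cast_le]
  refine Finset.card_le_card fun r hr => ?_
  rw [Finset.mem_filter, Finset.mem_range, ← YoungDiagram.mem_iff_lt_colLen] at hr ⊢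
  exact ⟨μ.up_left_mem le_rfl (Nat.zero_le 1) hr.1,
    (T.1.row_weak_of_le (Nat.zero_le 1) hr.1).trans hr.2⟩

/-- The first-column entries smaller than that of row `r0` lie above `r0`, and by assumption their
right neighbours exist and are smaller as well. -/
theorem height_pred_nonpos (hμ : IsTwoColumn μ) (T : SST n μ) {r0 : ℕ} (hr0 : (r0, 0) ∈ μ)
    (h : ∀ r < r0, (r, 1) ∈ μ ∧ T.1 r 1 < T.1 r0 0) : height T (T.1 r0 0 - 1) ≤ 0 := by
  have hpos := (T.2 r0 0 hr0).1
  rw [hμ.height_eq, sub_nonpos, Nat.cast_le]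
  refine Finset.card_le_card fun r hr => ?_
  rw [Finset.mem_filter, Finset.mem_range, ← YoungDiagram.mem_iff_lt_colLen] at hr ⊢
  have hlt : r < r0 := by
    by_contra hge
    have := T.1.col_weak (not_lt.1 hge) hr.1
    omega
  have := h r hlt
  exact ⟨this.1, by omega⟩

/-! ### The expelled entry as the last departure of the height from zero -/

/-- `y` is the entry at which the height leaves `0` for the last time before `n`. -/
def LeavesZero (T : SST n μ) (y : ℕ) : Prop :=
  y ∈ col0 T ∧ y < n ∧ height T (y - 1) = 0 ∧ ∀ v, y ≤ v → v < n → 1 ≤ height T v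

theorem LeavesZero.unique {T : SST n μ} {y y' : ℕ} (h : LeavesZero T y) (h' : LeavesZero T y') :
    y = y' := by
  have h1 := (mem_col0_bounds T h.1).1
  have h2 := (mem_col0_bounds T h'.1).1
  rcases lt_trichotomy y y' with hlt | he | hlt
  · have := h.2.2.2 (y' - 1) (by omega) (by have := h'.2.1; omega)
    have := h'.2.2.1
    omega
  · exact he
  · have := h'.2.2.2 (y - 1) (by omega) (by have := h.2.1; omega)
    have := h.2.2.1
    omega

/-- The height rises from `0` to at least `1`; a letter of the first column has step `2 - count T
y`, so it occurs only once. -/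
theorem LeavesZero.heightStep_eq {T : SST n μ} {y : ℕ} (h : LeavesZero T y) :
    heightStep T y = 1 ∧ count T y = 1 := by
  obtain ⟨h1, h2, h3, h4⟩ := h
  have hb := (mem_col0_bounds T h1).1
  have hs := height_succ T (y - 1)
  rw [Nat.sub_add_cancel hb] at hs
  have := h4 y le_rfl h2
  have hc := count_pos_of_mem T h1
  rw [heightStep, if_pos h1] at hs ⊢
  omega

theorem count_eq_one (hμ : IsTwoColumn μ) (T : SST n μ) {v : ℕ} (h : v ∉ col0 T)
    (hc : count T v ≠ 0) : count T v = 1 := by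
  have h1 := count_eq T v
  rw [if_neg h] at h1
  have := hμ.restCount_le_one T v
  omega

theorem exists_leavesZero (hμ : IsTwoColumn μ) (T : SST n μ) (h : n ∉ col0 T)
    (hc : count T n ≠ 0) :
    ∃ y, LeavesZero T y ∧ ∀ v, v + 1 ∈ col0 (pr T) ↔ v = 0 ∨ (v ∈ col0 T ∧ v ≠ y) := by
  obtain ⟨r0, hr0, hlt, hmem⟩ := hμ.exists_col0_pr T h hc
  refine ⟨T.1 r0 0, ?_, hmem⟩
  have hz := hμ.height_pred_nonpos T hr0 hlt
  obtain ⟨y, hy⟩ : ∃ y, y = T.1 r0 0 := ⟨_, rfl⟩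
  have hyA : y ∈ col0 T := ⟨r0, hr0, hy.symm⟩
  have hb := mem_col0_bounds T hyA
  have hyn : y ≠ n := fun he => h (by rwa [he] at hyA)
  rw [← hy] at hz hmem ⊢
  have h1 : heightStep (pr T) 1 = 1 := by
    rw [heightStep, if_pos ((hmem 0).2 (Or.inl rfl)), count_pr_one, hμ.count_eq_one T h hc]
    rfl
  have hstep : ∀ v, 1 ≤ v → v < n →
      heightStep (pr T) (v + 1) = heightStep T v - if v = y then 2 else 0 := by
    intro v hv1 hv2
    have := hmem v
    rw [heightStep, heightStep, count_pr_succ T hv1 hv2]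
    split_ifs <;> grind
  -- Promotion puts an up-step in front and turns the up-step at `y` into a down-step. Heights of
  -- `pr T` are nonnegative, which forces the height of `T` to be at least `1` from `y` until `n`.
  have key : ∀ v, v < n → height (pr T) (v + 1) = height T v + 1 - if y ≤ v then 2 else 0 := by
    intro v
    induction v with
    | zero =>
      intro _
      rw [height_succ, height_zero, height_zero, if_neg (by omega)]
      simpa using h1
    | succ v ih =>
      intro hv
      rw [height_succ, ih (by omega), hstep (v + 1) (by omega) hv, height_succ]
      split_ifs <;> omega
  refine ⟨hyA, by omega, le_antisymm hz (hμ.height_nonneg T _), fun v hv1 hv2 => ?_⟩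
  have h2 := key v hv2
  have h3 := hμ.height_nonneg (pr T) (v + 1)
  rw [if_pos hv1] at h2
  omega

theorem heightStep_s (hμ : IsTwoColumn μ) {i : Index n} {T : SST n μ}
    (h : ¬ (count T i = 1 ∧ count T (i + 1) = 1)) (v : ℕ) :
    heightStep (s i T) v = heightStep T (Equiv.swap (i : ℕ) (i + 1) v) := by
  have := hμ.mem_col0_s i T v
  rw [if_pos h] at this
  exact heightStep_congr this (count_s i T v)

/-- Exchanging two consecutive steps of a lattice path moves only the point between them. -/
theorem height_s (hμ : IsTwoColumn μ) {i : Index n} {T : SST n μ}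
    (h : ¬ (count T i = 1 ∧ count T (i + 1) = 1)) :
    (∀ v : ℕ, v ≠ i → height (s i T) v = height T v) ∧
      height (s i T) i + heightStep T i = height T (i + 1) := by
  obtain ⟨k, hk⟩ : ∃ k, (i : ℕ) = k + 1 := ⟨i - 1, by have := i.2.1; omega⟩
  have hlow : ∀ v, v ≤ k → height (s i T) v = height T v := by
    intro v hv
    refine Finset.sum_congr rfl fun u hu => ?_
    have := Finset.mem_range.1 hu
    rw [hμ.heightStep_s h, Equiv.swap_apply_of_ne_of_ne (by omega) (by omega)]
  have h1 : height (s i T) i = height T k + heightStep T (i + 1) := by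
    have := hμ.heightStep_s h i
    rw [Equiv.swap_apply_left] at this
    rw [hk, height_succ, hlow k le_rfl, ← hk, this]
  have h2 : height T i = height T k + heightStep T i := by rw [hk, height_succ]
  have h3 := height_succ T i
  have h4 : height (s i T) (i + 1) = height T (i + 1) := by
    have := hμ.heightStep_s h (i + 1)
    rw [Equiv.swap_apply_right] at this
    rw [height_succ, this]
    omega
  refine ⟨fun v hv => ?_, by omega⟩
  rcases Nat.lt_or_ge v (i + 1) with hlt | hge
  · exact hlow v (by omega)
  · induction v, hge using Nat.le_induction with
    | base => exact h4
    | succ v hv' ih =>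
      rw [height_succ, height_succ, ih (by omega), hμ.heightStep_s h,
        Equiv.swap_apply_of_ne_of_ne (by omega) (by omega)]

theorem heightStep_cases (hμ : IsTwoColumn μ) (T : SST n μ) (v : ℕ) :
    heightStep T v = 0 ∨ (count T v = 1 ∧ (heightStep T v = 1 ∨ heightStep T v = -1)) := by
  have h1 := count_eq T v
  have := hμ.restCount_le_one T v
  rw [heightStep]
  split_ifs at h1 ⊢ <;> omega

/-- A nonzero step needs multiplicity `1`, so under the hypothesis one of the two exchanged steps is
flat. If the departure is one of them, it moves past a flat step. -/
theorem LeavesZero.map_s (hμ : IsTwoColumn μ) {i : Index n} {T : SST n μ} {y : ℕ}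
    (hi : (i : ℕ) + 1 < n) (hy : LeavesZero T y) (h : ¬ (count T i = 1 ∧ count T (i + 1) = 1)) :
    LeavesZero (s i T) (Equiv.swap (i : ℕ) (i + 1) y) := by
  obtain ⟨k1, k2⟩ := hμ.height_s h
  have hmem := hμ.mem_col0_s i T (Equiv.swap (i : ℕ) (i + 1) y)
  rw [if_pos h, Equiv.swap_apply_self] at hmem
  have c1 := hμ.heightStep_cases T i
  have c2 := hμ.heightStep_cases T (i + 1)
  have hs1 := hy.heightStep_eq.1
  obtain ⟨hyA, hyn, hy0, hy1⟩ := hy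
  have hyb := (mem_col0_bounds T hyA).1
  have hib := i.2.1
  have hh := height_succ T i
  have hh' := height_succ T (i - 1)
  rw [Nat.sub_add_cancel hib] at hh'
  refine ⟨hmem.2 hyA, ?_⟩
  by_cases e1 : y = i
  · rw [e1] at hs1 hy0
    have hc : heightStep T (i + 1) = 0 := by omega
    rw [e1, Equiv.swap_apply_left]
    refine ⟨hi, by rw [Nat.add_sub_cancel]; omega, fun v hv1 hv2 => ?_⟩
    rw [k1 v (by omega)]
    exact hy1 v (by omega) hv2
  · by_cases e2 : y = i + 1
    · rw [e2, Nat.add_sub_cancel] at hy0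
      rw [e2] at hs1
      have hc : heightStep T i = 0 := by omega
      rw [e2, Equiv.swap_apply_right]
      refine ⟨by omega, by rw [k1 _ (by omega)]; omega, fun v hv1 hv2 => ?_⟩
      by_cases e3 : v = i
      · rw [e3]; omega
      · rw [k1 v e3]
        exact hy1 v (by omega) hv2
    · rw [Equiv.swap_apply_of_ne_of_ne e1 e2]
      refine ⟨hyn, by rwa [k1 _ (by omega)], fun v hv1 hv2 => ?_⟩
      by_cases e3 : v = i
      -- As one of the two steps is flat, the moved point has the height of `T` at `i - 1` or at `i
      -- + 1`, both positive.
      · have h1 := hy1 (i - 1) (by omega) (by omega)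
        have h2 := hy1 (i + 1) (by omega) hi
        rw [e3]
        omega
      · rw [k1 v e3]
        exact hy1 v hv1 hv2

theorem columnModel (hμ : IsTwoColumn μ) :
    ColumnModel n μ (fun a b => ¬ (a = 1 ∧ b = 1)) LeavesZero where
  ext _ _ := hμ.ext
  mem_s i T v := by
    rw [hμ.mem_col0_s]
    split_ifs <;> rfl
  pr_mem T h _ := hμ.col0_pr_of_mem T h
  pr_notMem T h hc := hμ.exists_leavesZero T h hc
  unique T y y' h h' := h.unique h'
  map_s i T y hi _ _ hy := by
    by_cases h : count T i = 1 ∧ count T (i + 1) = 1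
    · rwa [if_neg (not_not.2 h), s_eq_self (h.1.trans h.2.symm)]
    · rw [if_pos h]
      exact hy.map_s hμ hi h

/-! ### Two promotions of a two-column tableau -/

theorem mem_col0_pr_of (hμ : IsTwoColumn μ) (T : SST n μ) (h : n ∈ col0 T ∨ count T n = 0) (v : ℕ) :
    v + 1 ∈ col0 (pr T) ↔ (v = 0 ∧ n ∈ col0 T) ∨ (v ≠ 0 ∧ v ≠ n ∧ v ∈ col0 T) := by
  have h0 : v ∈ col0 T → v ≠ 0 := fun h => by have := (mem_col0_bounds T h).1; omega
  rcases h with h | h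
  · rw [hμ.col0_pr_of_mem T h]
    tauto
  · rw [col0_pr_of_count_eq_zero T h]
    have := notMem_of_count h
    tauto

/-- Without an exchange between the columns the path is rotated: the step of `n` moves to the front.
-/
theorem height_pr_of (hμ : IsTwoColumn μ) (T : SST n μ) (h : n ∈ col0 T ∨ count T n = 0) (v : ℕ)
    (hv : v < n) : height (pr T) (v + 1) = heightStep T n + height T v := by
  induction v with
  | zero =>
    rw [height_succ, height_zero, height_zero, zero_add, zero_add, add_zero]
    refine heightStep_congr ?_ (count_pr_one T)
    simpa using hμ.mem_col0_pr_of T h 0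
  | succ v ih =>
    have hs : heightStep (pr T) (v + 1 + 1) = heightStep T (v + 1) := by
      refine heightStep_congr ?_ (count_pr_succ T (by omega) hv)
      rw [hμ.mem_col0_pr_of T h (v + 1)]
      have e1 : v + 1 ≠ n := by omega
      simp [e1]
    rw [height_succ, ih (by omega), hs, height_succ]
    ring

theorem mem_col0_last (hμ : IsTwoColumn μ) (hn : 2 ≤ n) (T : SST n μ)
    (h : n ∈ col0 T ∨ count T n = 0) : n ∈ col0 (pr T) ↔ n - 1 ∈ col0 T := by
  have := hμ.mem_col0_pr_of T h (n - 1)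
  rw [Nat.sub_add_cancel (by omega)] at this
  rw [this]
  have e1 : n - 1 ≠ 0 := by omega
  have e2 : n - 1 ≠ n := by omega
  tauto

theorem count_pr_last (hn : 2 ≤ n) (T : SST n μ) : count (pr T) n = count T (n - 1) := by
  rw [← count_pr_one, (count_pr_pr hn T).1]

/-- If neither `n` nor `n - 1` requires an exchange between the columns. -/
theorem mem_col0_pr_pr_of (hμ : IsTwoColumn μ) (hn : 2 ≤ n) (T : SST n μ)
    (h : n ∈ col0 T ∨ count T n = 0) (h' : n - 1 ∈ col0 T ∨ count T (n - 1) = 0) :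
    (1 ∈ col0 (pr (pr T)) ↔ n - 1 ∈ col0 T) ∧ (2 ∈ col0 (pr (pr T)) ↔ n ∈ col0 T) ∧
      ∀ w, 1 ≤ w → w + 1 < n → (w + 2 ∈ col0 (pr (pr T)) ↔ w ∈ col0 T) := by
  have hl := hμ.mem_col0_last hn T h
  have h2 : n ∈ col0 (pr T) ∨ count (pr T) n = 0 := by rwa [hl, count_pr_last hn]
  refine ⟨?_, ?_, fun w h3 h4 => ?_⟩
  · rw [hμ.mem_col0_pr_of _ h2 0, hl]
    simp
  · rw [hμ.mem_col0_pr_of _ h2 1, hμ.mem_col0_pr_of _ h 0]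
    have : 1 ≠ n := by omega
    simp [this]
  · rw [hμ.mem_col0_pr_of _ h2 (w + 1), hμ.mem_col0_pr_of _ h w]
    have e1 : w ≠ 0 := by omega
    have e2 : w ≠ n := by omega
    have e3 : w + 1 ≠ n := by omega
    simp [e1, e2, e3]

/-- For `T` the first promotion expels an entry `y` and the second expels none; for `s (n - 1) T`
the first expels none and the second does. The point is that the second one expels `y + 1`, the
shift of the same entry. -/
theorem s_pr_pr_of_notMem (hμ : IsTwoColumn μ) (hn : 2 ≤ n) (T : SST n μ) (h : n ∉ col0 T)
    (hc : count T n ≠ 0) (hne : count T (n - 1) ≠ count T n) :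
    s ⟨1, le_rfl, hn⟩ (pr (pr T)) = pr (pr (s (lastIndex n hn) T)) := by
  have hM := hμ.columnModel (n := n)
  have hc1 := hμ.count_eq_one T h hc
  have h' : n - 1 ∈ col0 T ∨ count T (n - 1) = 0 := by
    by_contra hcon
    rw [not_or] at hcon
    exact hne ((hμ.count_eq_one T hcon.1 hcon.2).trans hc1.symm)
  have hF : ¬ (count T (n - 1) = 1 ∧ count T n = 1) := fun h => hne (h.1.trans h.2.symm)
  obtain ⟨c1, -, c3⟩ := hM.mem_s_last hn T
  obtain ⟨c1, c2⟩ := c1 hF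
  obtain ⟨d1, d2, d3⟩ := count_s_last hn T
  obtain ⟨y, hy, hmem⟩ := hμ.exists_leavesZero T h hc
  have hyb := (mem_col0_bounds T hy.1).1
  have hy1 : y + 1 < n := by
    have h1 := hy.2.1
    -- `y` and `n` both have multiplicity `1`, while `n - 1` has a different one.
    have h2 : y ≠ n - 1 := fun he => hne (by rw [← he, hy.heightStep_eq.2, hc1])
    omega
  have hl := hmem (n - 1)
  rw [Nat.sub_add_cancel (by omega)] at hl
  have hl' : n ∈ col0 (pr T) ↔ n - 1 ∈ col0 T := by
    rw [hl]
    have e1 : n - 1 ≠ 0 := by omega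
    have e2 : n - 1 ≠ y := by omega
    simp only [e1, e2, false_or, ne_eq, not_false_eq_true, and_true]
  have hN : n ∈ col0 (pr T) ∨ count (pr T) n = 0 := by rwa [hl', count_pr_last hn]
  have a1 : 1 ∈ col0 (pr (pr T)) ↔ n - 1 ∈ col0 T := by
    rw [hμ.mem_col0_pr_of _ hN 0, hl']
    simp
  have a2 : 2 ∈ col0 (pr (pr T)) := by
    rw [hμ.mem_col0_pr_of _ hN 1, hmem 0]
    have : 1 ≠ n := by omega
    simp [this]
  have a3 : ∀ w, 1 ≤ w → w + 1 < n → (w + 2 ∈ col0 (pr (pr T)) ↔ w ∈ col0 T ∧ w ≠ y) := by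
    intro w h3 h4
    rw [hμ.mem_col0_pr_of _ hN (w + 1), hmem w]
    have e1 : w ≠ 0 := by omega
    have e3 : w + 1 ≠ n := by omega
    simp [e1, e3]
  set S := s (lastIndex n hn) T with hS
  have hN2 : n ∈ col0 S ∨ count S n = 0 := by rwa [c2, d2]
  have b1 : n ∉ col0 (pr S) := by rwa [hμ.mem_col0_last hn S hN2, c1]
  have b2 : count (pr S) n ≠ 0 := by rwa [count_pr_last hn, d1]
  obtain ⟨y', hy', hmem'⟩ := hμ.exists_leavesZero (pr S) b1 b2
  -- In `S` the letter `n` has the multiplicity that `n - 1` had in `T`, which is not `1`. Its step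
  -- is therefore flat, and `pr` shifts the height of `S` without raising it.
  have hstep0 : heightStep S n = 0 := by
    have := hμ.heightStep_cases S n
    rw [d2] at this
    exact this.resolve_right fun h3 => hne (h3.1.trans hc1.symm)
  have hheight : ∀ v, v + 1 < n → height (pr S) (v + 1) = height T v := by
    intro v hv
    rw [hμ.height_pr_of S hN2 v (by omega), hstep0, zero_add]
    refine (hμ.height_s (i := lastIndex n hn) (T := T) ?_).1 v ?_
    · simpa only [Nat.sub_add_cancel (show 1 ≤ n by omega)] using hF
    · dsimp only; omega
  obtain rfl : y + 1 = y' := by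
    refine LeavesZero.unique ⟨?_, by omega, ?_, fun v hv1 hv2 => ?_⟩ hy'
    · rw [hμ.mem_col0_pr_of S hN2, c3 y (by omega)]
      exact Or.inr ⟨by omega, by omega, hy.1⟩
    · obtain ⟨z, rfl⟩ : ∃ z, y = z + 1 := ⟨y - 1, by omega⟩
      rw [Nat.add_sub_cancel, hheight z (by omega)]
      exact hy.2.2.1
    · obtain ⟨z, rfl⟩ : ∃ z, v = z + 1 := ⟨v - 1, by omega⟩
      rw [hheight z hv2]
      exact hy.2.2.2 z (by omega) (by omega)
  refine hM.s_pr_pr_of hn T ?_ ?_ fun w h1 h2 => ?_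
  · rw [← hS, hmem' 0]
    simp only [true_or, true_iff]
    exact Or.inl ⟨hF, a2⟩
  · rw [← hS, hmem' 1, hμ.mem_col0_pr_of S hN2 0, c2, a1]
    have e1 : y ≠ 0 := by omega
    simp [e1, hF]
  · rw [← hS, hmem' (w + 1), hμ.mem_col0_pr_of S hN2 w, c3 w h2, a3 w h1 h2]
    have e1 : w ≠ 0 := by omega
    have e2 : w ≠ n := by omega
    simp [e1, e2]

theorem s_pr_pr (hμ : IsTwoColumn μ) (hn : 2 ≤ n) (T : SST n μ) :
    s ⟨1, le_rfl, hn⟩ (pr (pr T)) = pr (pr (s (lastIndex n hn) T)) := by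
  have hM := hμ.columnModel (n := n)
  have hsymm : ∀ a b : ℕ, ¬ (a = 1 ∧ b = 1) ↔ ¬ (b = 1 ∧ a = 1) := fun a b => by
    rw [and_comm]
  -- With equal multiplicities both operators `s` act as the identity. This covers the case in which
  -- both `n - 1` and `n` lie only in the second column.
  by_cases heq : count T (n - 1) = count T n
  · obtain ⟨h1, h2, -⟩ := count_pr_pr hn T
    rw [s_eq_self (i := lastIndex n hn) (T := T)
      (by simpa only [Nat.sub_add_cancel (show 1 ≤ n by omega)] using heq)]
    exact s_eq_self (h1.trans (heq.trans h2.symm))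
  have hF : ¬ (count T (n - 1) = 1 ∧ count T n = 1) := fun h => heq (h.1.trans h.2.symm)
  obtain ⟨c1, -, c3⟩ := hM.mem_s_last hn T
  obtain ⟨c1, c2⟩ := c1 hF
  obtain ⟨d1, d2, d3⟩ := count_s_last hn T
  by_cases h : n ∈ col0 T ∨ count T n = 0
  · by_cases h' : n - 1 ∈ col0 T ∨ count T (n - 1) = 0
    · obtain ⟨a1, a2, a3⟩ := hμ.mem_col0_pr_pr_of hn T h h'
      obtain ⟨b1, b2, b3⟩ := hμ.mem_col0_pr_pr_of hn (s (lastIndex n hn) T)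
        (by rwa [c2, d2]) (by rwa [c1, d1])
      refine hM.s_pr_pr_of hn T ?_ ?_ fun w h1 h2 => ?_
      · rw [b1, c1, a1, a2]
        simp [hF]
      · rw [b2, c2, a1, a2]
        simp [hF]
      · rw [b3 w h1 h2, a3 w h1 h2, c3 w h2]
    · rw [not_or] at h'
      -- Here `n - 1` lies only in the second column, so in `s (n - 1) T` it is `n` that does. Since
      -- `s` is an involution, the relation for that tableau gives the one for `T`.
      have key := hμ.s_pr_pr_of_notMem hn (s (lastIndex n hn) T) (by rw [c2]; exact h'.1)
        (by rw [d2]; exact h'.2) (by rw [d1, d2]; exact Ne.symm heq)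
      rw [hM.s_s hsymm] at key
      rw [← key, hM.s_s hsymm]
  · rw [not_or] at h
    exact hμ.s_pr_pr_of_notMem hn T h.1 h.2 heq

end IsTwoColumn

/-! ### Powers of promotion -/

theorem s_iterate_pr {n : ℕ} {μ : YoungDiagram}
    (hstep : ∀ (i j : Index n), (j : ℕ) = i + 1 → ∀ T : SST n μ, s j (pr T) = pr (s i T)) (k : ℕ) :
    ∀ (i j : Index n), (j : ℕ) = i + k → ∀ T : SST n μ, s j (pr^[k] T) = pr^[k] (s i T) := by
  induction k with
  | zero =>
    intro i j hij T
    rw [Subtype.ext (a1 := j) (a2 := i) hij]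
    rfl
  | succ k ih =>
    intro i j hij T
    have hj := j.2.2
    rw [Function.iterate_succ_apply, Function.iterate_succ_apply,
      ih ⟨i + 1, by omega, by omega⟩ j (by rw [hij]; dsimp only; omega), hstep i _ rfl]

/-- Along `pr ^ n` the index `i` climbs to `n - 1` in `n - 1 - i` steps, wraps to `1` in two steps
and climbs back to `i` in `i - 1` steps. -/
theorem s_iterate_pr_n {n : ℕ} {μ : YoungDiagram}
    (hstep : ∀ (i j : Index n), (j : ℕ) = i + 1 → ∀ T : SST n μ, s j (pr T) = pr (s i T))
    (hwrap : ∀ (hn : 2 ≤ n) (T : SST n μ),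
      s ⟨1, le_rfl, hn⟩ (pr (pr T)) = pr (pr (s (lastIndex n hn) T)))
    (i : Index n) (T : SST n μ) : s i (pr^[n] T) = pr^[n] (s i T) := by
  have h1 := i.2.1
  have h2 := i.2.2
  have hn : 2 ≤ n := by omega
  have e1 : ∀ S : SST n μ, pr^[n] S = pr^[i - 1] (pr (pr (pr^[n - 1 - i] S))) := by
    intro S
    rw [← Function.iterate_succ_apply' pr, ← Function.iterate_succ_apply' pr,
      ← Function.iterate_add_apply]
    congr 2
    omega
  rw [e1, e1, s_iterate_pr hstep (i - 1) ⟨1, le_rfl, hn⟩ i (by dsimp only; omega), hwrap hn,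
    s_iterate_pr hstep (n - 1 - i) i (lastIndex n hn) (by dsimp only; omega)]

theorem cox_iterate_pr {n : ℕ} {μ : YoungDiagram}
    (h : ∀ (i : Index n) (T : SST n μ), s i (pr^[n] T) = pr^[n] (s i T)) (T : SST n μ) :
    cox (pr^[n] T) = pr^[n] (cox T) := by
  unfold cox
  induction List.finRange (n - 1) with
  | nil => rfl
  | cons k l ih => rw [List.foldr_cons, List.foldr_cons, ih, h]

end HookPromotion

/-! ### The three relations for both kinds of shape -/

theorem lemma4p4 (n : ℕ) (μ : YoungDiagram) (hlen : μ.colLen 0 < n)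
    (hshape : HookPromotion.IsHook μ ∨ HookPromotion.IsTwoColumn μ) :
    (∀ (hn : 2 ≤ n) (T : HookPromotion.SST n μ),
      HookPromotion.s ⟨1, le_rfl, hn⟩ (HookPromotion.pr^[2] T) =
        HookPromotion.pr^[2] (HookPromotion.s ⟨n - 1, by omega, by omega⟩ T)) ∧
    (∀ (i : HookPromotion.Index n) (T : HookPromotion.SST n μ),
      HookPromotion.s i (HookPromotion.pr^[n] T) = HookPromotion.pr^[n] (HookPromotion.s i T)) ∧
    (∀ T : HookPromotion.SST n μ,
      HookPromotion.cox (HookPromotion.pr^[n] T) = HookPromotion.pr^[n] (HookPromotion.cox T)) := by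
  have hstep : ∀ (i j : HookPromotion.Index n), (j : ℕ) = i + 1 → ∀ T : HookPromotion.SST n μ,
      HookPromotion.s j (HookPromotion.pr T) = HookPromotion.pr (HookPromotion.s i T) :=
    hshape.elim (fun h => h.columnModel.s_pr) fun h => h.columnModel.s_pr
  have hwrap : ∀ (hn : 2 ≤ n) (T : HookPromotion.SST n μ),
      HookPromotion.s ⟨1, le_rfl, hn⟩ (HookPromotion.pr (HookPromotion.pr T)) =
        HookPromotion.pr (HookPromotion.pr (HookPromotion.s (HookPromotion.lastIndex n hn) T)) :=
    hshape.elim (fun h => h.s_pr_pr) fun h => h.s_pr_pr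
  have hpow := HookPromotion.s_iterate_pr_n hstep hwrap
  exact ⟨hwrap, hpow, HookPromotion.cox_iterate_pr hpow⟩
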